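/- **Setting.** Let $\Omega=\{z=(z_i)_{i\ge1}: z_1\ge z_2\ge\cdots\ge0,\ 0<|z|:=\sum_i z_i<\infty\}$ with the product topology and its Borel $\sigma$-algebra, $\Omega_1=\{z\in\Omega:|z|=1\}$, and let $B(\Omega)$ be the bounded Borel functions on $\Omega$. For $i\neq j$ let $M_{ij}z$ be obtained from $z$ by replacing $z_i,z_j$ by $z_i+z_j$ and reordering; for $0<y<z_i$ let $S_i^{(y)}z$ be obtained by replacing $z_i$ by $y$ and $z_i-y$ and reordering; put $S_i^{u}z=S_i^{(uz_i)}z$ for $0<u<1$. Fix $\lambda\ge0$. Let $\hat H,\check H$ be symmetric, nonnegative, measurable functions on $(0,\infty)^2$, homogeneous of degree $\lambda$ (i.e. $H(ax,ay)=a^\lambda H(x,y)$ for $a,x,y>0$), such that (H1) $\sup_{0<u<1}\hat H(u,1-u)\in(0,\infty)$ and (H2) $\int_0^1\check H(u,1-u)\,du\in(0,\infty)$. Set $K(x,y)=xy\hat H(x,y)$, $F(x,y)=(x+y)\check H(x,y)$ and $$L\Phi(z)=\tfrac12\sum_{i\ne j}K(z_i,z_j)\bigl(\Phi(M_{ij}z)-\Phi(z)\bigr)+\tfrac12\sum_i\int_0^{z_i}F(y,z_i-y)\bigl(\Phi(S_i^{(y)}z)-\Phi(z)\bigr)dy,$$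 where the sums are over indices with $z_iz_j>0$, respectively $z_i>0$. For an operator $A$ on functions on $\Omega$, a measurable $\Omega$-valued process $(Z(t))_{t\ge0}$ is *generated by* $A$ if, with respect to some filtration to which $Z$ is adapted, $\Phi(Z(t))-\Phi(Z(0))-\int_0^tA\Phi(Z(s))\,ds$ is a martingale for every $\Phi\in B(\Omega)$ with $A\Phi\in B(\Omega)$. The process generated by $A$ is *reversible with respect to* a probability measure $\mu$ on $\Omega$ ($\mu$ is a *reversible distribution*) if, whenever $Z$ is generated by $A$ and $Z(0)$ has law $\mu$, for all $n\in\mathbb N$, $T\ge0$ and $t_1,\dots,t_n\in[0,T]$ the vectors $(Z(t_1),\dots,Z(t_n))$ and $(Z(T-t_1),\dots,Z(T-t_n))$ have the same law. Let $\mathcal N$ be the space of $\mathbb Z_+$-valued Radon measures on $(0,\infty)$ with the Borel $\sigma$-algebra of the vague topology and $\Xi(z)=\sum_{i:z_i>0}\delta_{z_i}$. For a random element $Z$ of $\Omega$ and $\xi=\Xi(Z)$, the first and second *correlation functions* $r_1,r_2$ of $\xi$ are (if they exist) the Lebesgue densities of the mean measures of $\xi$ on $(0,\infty)$ and of $\xi^{[2]}=\sum_{i\ne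 j:\,Z_iZ_j>0}\delta_{(Z_i,Z_j)}$ on $(0,\infty)^2$. The *reduced Palm distributions* $P_{z_1}$ and $P_{z_1,z_2}$ are probability measures on $\mathcal N$, depending measurably on their indices, such that for all nonnegative measurable $G$ $$E\Bigl[\sum_{i:\,Z_i>0}G(Z_i,\xi)\Bigr]=\int r_1(z)\int G(z,\eta+\delta_z)\,P_z(d\eta)\,dz,$$ $$E\Bigl[\sum_{i\ne j:\,Z_iZ_j>0}G(Z_i,Z_j,\xi)\Bigr]=\iint r_2(z_1,z_2)\int G(z_1,z_2,\eta+\delta_{z_1}+\delta_{z_2})\,P_{z_1,z_2}(d\eta)\,dz_1dz_2 .$$ **Theorem 2.4.** (i) Let $Z$ be a random element of $\Omega$ such that the first and second correlation functions $r_1,r_2$ of $\xi=\Xi(Z)$ exist and, together with the reduced Palm distributions of $\xi$, satisfy the identity of measures on $\mathcal N$ $$K(z_1,z_2)\,r_2(z_1,z_2)\,P_{z_1,z_2}=F(z_1,z_2)\,r_1(z_1+z_2)\,P_{z_1+z_2}\qquad\text{for a.e. }(z_1,z_2)\in(0,\infty)^2. \tag{2.19}$$ Then the process generated by $L$ is reversible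 with respect to the law of $Z$. (ii) Let $\theta>0$, let $H$ be a symmetric, nonnegative, measurable function on $(0,\infty)^2$, homogeneous of degree $\lambda\ge0$, with $\sup_{0<u<1}H(u,1-u)\in(0,\infty)$, and let $$L^{(H,\theta)}\Phi(z)=\tfrac12\sum_{i\ne j}z_iz_jH(z_i,z_j)\bigl(\Phi(M_{ij}z)-\Phi(z)\bigr)+\tfrac\theta2\sum_iz_i^2\int_0^1H(uz_i,(1-u)z_i)\bigl(\Phi(S_i^{u}z)-\Phi(z)\bigr)du .$$ Let the random element $X=(X_i)$ of $\Omega_1$ be $\mathrm{PD}(\theta)$-distributed, where $\mathrm{PD}(\theta)$ is the Poisson–Dirichlet distribution, i.e. the law of the decreasing rearrangement of $\bigl(B_n\prod_{j<n}(1-B_j)\bigr)_{n\ge1}$ with $B_1,B_2,\dots$ i.i.d. $\mathrm{Beta}(1,\theta)$. Then for every $(0,\infty)$-valued random variable $V$ independent of $X$, the law of $(VX_i)_{i\ge1}$ is a reversible distribution of the process generated by $L^{(H,\theta)}$. -/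

import Mathlib

open MeasureTheory ProbabilityTheory
open scoped ENNReal NNReal

universe u v

noncomputable section

namespace CoagFrag

/-! ## State spaces and decreasing rearrangements -/

/-- The cone `Ω` of nonincreasing nonnegative sequences with finite, strictly positive sum,
with the Borel σ-algebra of the product topology. -/
abbrev Omega : Type :=
  {z : ℕ → ℝ // Antitone z ∧ (∀ n, 0 ≤ z n) ∧ Summable z ∧ 0 < ∑' n, z n}

/-- The total mass `|z| = ∑ zᵢ`. -/
def mass (z : Omega) : ℝ := ∑' n, z.1 n

/-- The infinite-dimensional simplex `Ω₁ = {x ∈ Ω : |x| = 1}`. -/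
abbrev OmegaOne : Type := {x : Omega // mass x = 1}

/-- The `n`-th largest entry (counting from `n = 0`) of a sequence, i.e. the decreasing
rearrangement of the sequence (zeros are dropped if there are infinitely many positive entries). -/
def decr (w : ℕ → ℝ) (n : ℕ) : ℝ :=
  sInf {t : ℝ | 0 ≤ t ∧ {i : ℕ | t < w i}.encard ≤ (n : ℕ∞)}

theorem decr_set_nonempty {w : ℕ → ℝ} (h0 : ∀ i, 0 ≤ w i) (hs : Summable w) (n : ℕ) :
    {t : ℝ | 0 ≤ t ∧ {i : ℕ | t < w i}.encard ≤ (n : ℕ∞)}.Nonempty := by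
  refine ⟨∑' i, w i, tsum_nonneg h0, ?_⟩
  have : {i : ℕ | ∑' i, w i < w i} = ∅ := by
    ext i
    simpa using hs.le_tsum i (fun j _ => h0 j)
  simp [this]

theorem decr_nonneg (w : ℕ → ℝ) (n : ℕ) : 0 ≤ decr w n :=
  Real.sInf_nonneg (fun _ ht => ht.1)

theorem decr_antitone {w : ℕ → ℝ} (h0 : ∀ i, 0 ≤ w i) (hs : Summable w) :
    Antitone (decr w) := by
  intro n m hnm
  refine csInf_le_csInf ⟨0, fun _ ht => ht.1⟩ (decr_set_nonempty h0 hs n) ?_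
  rintro t ⟨ht, hc⟩
  exact ⟨ht, hc.trans (by exact_mod_cast hnm)⟩

theorem lt_decr_iff {w : ℕ → ℝ} (h0 : ∀ i, 0 ≤ w i) (hs : Summable w) (n : ℕ) {t : ℝ}
    (ht : 0 ≤ t) : t < decr w n ↔ (n : ℕ∞) < {i : ℕ | t < w i}.encard := by
  constructor
  · intro h
    by_contra hc
    have hmem : t ∈ {t : ℝ | 0 ≤ t ∧ {i : ℕ | t < w i}.encard ≤ (n : ℕ∞)} := ⟨ht, not_lt.1 hc⟩
    have hle : decr w n ≤ t := csInf_le ⟨0, fun _ hs => hs.1⟩ hmem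
    exact absurd hle (not_le.2 h)
  · intro h
    have h1 : ((n + 1 : ℕ) : ℕ∞) ≤ {i : ℕ | t < w i}.encard := by
      have := Order.add_one_le_of_lt h
      exact_mod_cast this
    obtain ⟨A, hA, hcard⟩ := Set.exists_subset_encard_eq h1
    have hfin : A.Finite := Set.finite_of_encard_eq_coe hcard
    have hne : A.Nonempty := by
      rw [← Set.encard_pos, hcard]
      exact_mod_cast Nat.succ_pos n
    obtain ⟨a, haA, hamin⟩ := hfin.exists_minimalFor w A hne
    have hmin : ∀ i ∈ A, w a ≤ w i := fun i hi => by
      rcases le_total (w a) (w i) with h | h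
      · exact h
      · exact hamin hi h
    refine lt_of_lt_of_le (hA haA) (le_csInf (decr_set_nonempty h0 hs n) ?_)
    rintro s ⟨_, hsc⟩
    by_contra hlt
    have hsub : A ⊆ {i : ℕ | s < w i} := fun i hi => lt_of_lt_of_le (not_le.1 hlt) (hmin i hi)
    have := (Set.encard_le_encard hsub).trans hsc
    rw [hcard] at this
    have : n + 1 ≤ n := by exact_mod_cast this
    omega

theorem encard_lt_set (N : ℕ∞) : {n : ℕ | (n : ℕ∞) < N}.encard = N := by
  induction N using ENat.recTopCoe with
  | top =>
    have : {n : ℕ | (n : ℕ∞) < ⊤} = Set.univ := by ext; simp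
    rw [this, Set.encard_univ]; simp
  | coe k =>
    have : {n : ℕ | (n : ℕ∞) < (k : ℕ∞)} = ((Finset.range k : Finset ℕ) : Set ℕ) := by
      ext; simp
    rw [this, Set.encard_coe_eq_coe_finsetCard]; simp

theorem tsum_ofReal_layer (v : ℕ → ℝ) :
    ∑' n, ENNReal.ofReal (v n) =
      ∫⁻ t in Set.Ici (0 : ℝ), (({n : ℕ | t < v n}.encard : ℕ∞) : ℝ≥0∞) := by
  have h1 : ∀ n, ENNReal.ofReal (v n) =
      ∫⁻ t in Set.Ici (0 : ℝ), (Set.Iio (v n)).indicator 1 t := by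
    intro n
    rw [lintegral_indicator_one measurableSet_Iio, Measure.restrict_apply measurableSet_Iio,
      Set.inter_comm, Set.Ici_inter_Iio, Real.volume_Ico, sub_zero]
  simp_rw [h1]
  rw [← lintegral_tsum (fun n => (measurable_one.indicator measurableSet_Iio).aemeasurable)]
  refine lintegral_congr (fun t => ?_)
  have h2 : ∀ n, (Set.Iio (v n)).indicator (1 : ℝ → ℝ≥0∞) t =
      ({n : ℕ | t < v n}).indicator (fun _ => (1 : ℝ≥0∞)) n := by
    intro n
    by_cases h : t < v n <;> simp [h]
  simp_rw [h2]
  rw [← tsum_subtype]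
  simp

theorem tsum_ofReal_decr {w : ℕ → ℝ} (h0 : ∀ i, 0 ≤ w i) (hs : Summable w) :
    ∑' n, ENNReal.ofReal (decr w n) = ∑' n, ENNReal.ofReal (w n) := by
  rw [tsum_ofReal_layer, tsum_ofReal_layer]
  refine setLIntegral_congr_fun measurableSet_Ici (fun t ht => ?_)
  have : {n : ℕ | t < decr w n} = {n : ℕ | (n : ℕ∞) < {i : ℕ | t < w i}.encard} := by
    ext n
    exact lt_decr_iff h0 hs n ht
  simp only [this, encard_lt_set]

theorem hasSum_decr {w : ℕ → ℝ} (h0 : ∀ i, 0 ≤ w i) (hs : Summable w) :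
    HasSum (decr w) (∑' n, w n) := by
  have h1 := tsum_ofReal_decr h0 hs
  rw [← ENNReal.ofReal_tsum_of_nonneg h0 hs] at h1
  have h2 : Summable (decr w) := by
    have : ∑' n, ENNReal.ofReal (decr w n) ≠ ∞ := by rw [h1]; exact ENNReal.ofReal_ne_top
    have h3 := ENNReal.summable_toReal this
    simpa only [ENNReal.toReal_ofReal (decr_nonneg w _)] using h3
  rw [← ENNReal.ofReal_tsum_of_nonneg (decr_nonneg w) h2] at h1
  rw [← (ENNReal.ofReal_eq_ofReal_iff (tsum_nonneg (decr_nonneg w)) (tsum_nonneg h0)).1 h1]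
  exact h2.hasSum

/-- Reordering of a nonnegative sequence with finite positive sum into an element of `Ω`. -/
def rank (w : ℕ → ℝ) (h0 : ∀ i, 0 ≤ w i) (hs : Summable w) (hp : 0 < ∑' n, w n) : Omega :=
  ⟨decr w, decr_antitone h0 hs, decr_nonneg w, (hasSum_decr h0 hs).summable,
    by rw [(hasSum_decr h0 hs).tsum_eq]; exact hp⟩

theorem mass_rank (w : ℕ → ℝ) (h0 : ∀ i, 0 ≤ w i) (hs : Summable w) (hp : 0 < ∑' n, w n) :
    mass (rank w h0 hs hp) = ∑' n, w n := (hasSum_decr h0 hs).tsum_eq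

/-! ## Coagulation, fragmentation, dilation -/

/-- The sequence with the `i`-th and `j`-th entries replaced by `zᵢ + zⱼ` and `0`. -/
def mergeSeq (z : ℕ → ℝ) (i j : ℕ) : ℕ → ℝ :=
  Function.update (Function.update z i (z i + z j)) j 0

/-- The sequence with the `i`-th entry replaced by the two entries `zᵢ - y` and `y`. -/
def splitSeq (z : ℕ → ℝ) (i : ℕ) (y : ℝ) : ℕ → ℝ
  | 0 => z i - y
  | n + 1 => Function.update z i y n

theorem hasSum_mergeSeq {z : ℕ → ℝ} {a : ℝ} (h : HasSum z a) {i j : ℕ} (hij : i ≠ j) :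
    HasSum (mergeSeq z i j) a := by
  have h1 := (h.update i (z i + z j)).update j 0
  rw [Function.update_of_ne hij.symm] at h1
  have e : 0 - z j + (z i + z j - z i + a) = a := by ring
  rw [e] at h1
  exact h1

theorem hasSum_splitSeq {z : ℕ → ℝ} {a : ℝ} (h : HasSum z a) (i : ℕ) (y : ℝ) :
    HasSum (splitSeq z i y) a := by
  have h1 : HasSum (fun n => splitSeq z i y (n + 1)) (y - z i + a) := h.update i y
  have h2 := (hasSum_nat_add_iff (f := splitSeq z i y) 1).1 h1
  have e : y - z i + a + ∑ k ∈ Finset.range 1, splitSeq z i y k = a := by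
    simp only [Finset.sum_range_one, splitSeq]
    ring
  rw [e] at h2
  exact h2

open Classical in
/-- `M_{ij} z`: merge `zᵢ` and `zⱼ` into `zᵢ + zⱼ` and reorder (only used for `i ≠ j`). -/
def merge (z : Omega) (i j : ℕ) : Omega :=
  if hij : i ≠ j then
    rank (mergeSeq z.1 i j)
      (by
        intro n
        unfold mergeSeq
        simp only [Function.update_apply]
        split_ifs
        · exact le_rfl
        · exact add_nonneg (z.2.2.1 i) (z.2.2.1 j)
        · exact z.2.2.1 n)
      (hasSum_mergeSeq z.2.2.2.1.hasSum hij).summable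
      (by rw [(hasSum_mergeSeq z.2.2.2.1.hasSum hij).tsum_eq]; exact z.2.2.2.2)
  else z

open Classical in
/-- `S_i^{(y)} z`: split `zᵢ` into `y` and `zᵢ - y` and reorder (only used for `0 < y < zᵢ`). -/
def split (z : Omega) (i : ℕ) (y : ℝ) : Omega :=
  if hy : 0 ≤ y ∧ y ≤ z.1 i then
    rank (splitSeq z.1 i y)
      (by
        intro n
        cases n with
        | zero => exact sub_nonneg.2 hy.2
        | succ n =>
          simp only [splitSeq, Function.update_apply]
          split_ifs
          · exact hy.1
          · exact z.2.2.1 n)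
      (hasSum_splitSeq z.2.2.2.1.hasSum i y).summable
      (by rw [(hasSum_splitSeq z.2.2.2.1.hasSum i y).tsum_eq]; exact z.2.2.2.2)
  else z

/-- The dilation `D_a z = (a zᵢ)`. -/
def dilate (a : ℝ) (ha : 0 < a) (z : Omega) : Omega :=
  ⟨fun n => a * z.1 n, fun _ _ h => mul_le_mul_of_nonneg_left (z.2.1 h) ha.le,
    fun n => mul_nonneg ha.le (z.2.2.1 n), z.2.2.2.1.mul_left a,
    by rw [tsum_mul_left]; exact mul_pos ha z.2.2.2.2⟩

/-! ## Rates and generators -/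

/-- `H` is a symmetric, nonnegative, measurable function on `(0,∞)²`, homogeneous of degree
`lam`. Its values off `(0,∞)²` are irrelevant. -/
structure IsHomogeneousKernel (lam : ℝ) (H : ℝ → ℝ → ℝ) : Prop where
  measurable : Measurable ((Set.Ioi (0 : ℝ) ×ˢ Set.Ioi (0 : ℝ)).indicator (fun p => H p.1 p.2))
  nonneg : ∀ x y, 0 < x → 0 < y → 0 ≤ H x y
  symm : ∀ x y, 0 < x → 0 < y → H x y = H y x
  homogeneous : ∀ a x y, 0 < a → 0 < x → 0 < y → H (a * x) (a * y) = a ^ lam * H x y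

/-- `sup {H(u, 1 - u) : 0 < u < 1} ∈ (0,∞)`. -/
def CondH1 (H : ℝ → ℝ → ℝ) : Prop :=
  BddAbove ((fun u => H u (1 - u)) '' Set.Ioo 0 1) ∧
    0 < sSup ((fun u => H u (1 - u)) '' Set.Ioo 0 1)

/-- `∫₀¹ H(u, 1 - u) du ∈ (0,∞)`. -/
def CondH2 (H : ℝ → ℝ → ℝ) : Prop :=
  IntegrableOn (fun u => H u (1 - u)) (Set.Ioo 0 1) ∧
    0 < ∫ u in Set.Ioo (0 : ℝ) 1, H u (1 - u)

/-- The coagulation rate `K(x,y) = x y H(x,y)`. -/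
def coagRate (H : ℝ → ℝ → ℝ) (x y : ℝ) : ℝ := x * y * H x y

/-- The fragmentation rate `F(x,y) = (x + y) H(x,y)`. -/
def fragRate (H : ℝ → ℝ → ℝ) (x y : ℝ) : ℝ := (x + y) * H x y

open Classical in
/-- The coagulation-fragmentation operator `L` with rates `K` and `F`:
`LΦ(z) = ½ ∑_{i≠j} K(zᵢ,zⱼ)(Φ(M_{ij}z) - Φ(z)) + ½ ∑ᵢ ∫₀^{zᵢ} F(y,zᵢ-y)(Φ(S_i^{(y)}z) - Φ(z)) dy`,
the sums running over indices with `zᵢ zⱼ > 0`, respectively `zᵢ > 0`. -/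
def genL (K F : ℝ → ℝ → ℝ) (Φ : Omega → ℝ) (z : Omega) : ℝ :=
  (1 / 2) * (∑' p : ℕ × ℕ, if p.1 ≠ p.2 ∧ 0 < z.1 p.1 ∧ 0 < z.1 p.2 then
      K (z.1 p.1) (z.1 p.2) * (Φ (merge z p.1 p.2) - Φ z) else 0) +
  (1 / 2) * (∑' i : ℕ, if 0 < z.1 i then
      ∫ y in Set.Ioo 0 (z.1 i), F y (z.1 i - y) * (Φ (split z i y) - Φ z) else 0)

open Classical in
/-- The operator `L^{(H,θ)}`:
`½ ∑_{i≠j} zᵢzⱼ H(zᵢ,zⱼ)(Φ(M_{ij}z) - Φ(z))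
  + (θ/2) ∑ᵢ zᵢ² ∫₀¹ H(u zᵢ,(1-u) zᵢ)(Φ(S_i^{u}z) - Φ(z)) du`, where `S_i^u z = S_i^{(u zᵢ)} z`. -/
def genHθ (H : ℝ → ℝ → ℝ) (θ : ℝ) (Φ : Omega → ℝ) (z : Omega) : ℝ :=
  (1 / 2) * (∑' p : ℕ × ℕ, if p.1 ≠ p.2 ∧ 0 < z.1 p.1 ∧ 0 < z.1 p.2 then
      z.1 p.1 * z.1 p.2 * H (z.1 p.1) (z.1 p.2) * (Φ (merge z p.1 p.2) - Φ z) else 0) +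
  (θ / 2) * (∑' i : ℕ, if 0 < z.1 i then
      z.1 i ^ 2 * ∫ u in Set.Ioo (0 : ℝ) 1,
        H (u * z.1 i) ((1 - u) * z.1 i) * (Φ (split z i (u * z.1 i)) - Φ z) else 0)

/-! ## Processes and reversibility -/

/-- Bounded Borel functions on `Ω`. -/
def BddBorel (Φ : Omega → ℝ) : Prop :=
  Measurable Φ ∧ ∃ C : ℝ, ∀ z, |Φ z| ≤ C

/-- `Z` is a process generated by the (possibly unbounded) operator `A`, in the sense of the
martingale problem: it is a jointly measurable process and, for some filtration it is adapted to,
`Φ(Z(t)) - Φ(Z(0)) - ∫₀ᵗ AΦ(Z(s)) ds` is a martingale whenever `Φ` and `AΦ` are both bounded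
Borel functions. -/
def IsGeneratedBy (A : (Omega → ℝ) → Omega → ℝ) {S : Type u} [mS : MeasurableSpace S]
    (P : Measure S) (Z : ℝ≥0 → S → Omega) : Prop :=
  Measurable (fun p : ℝ≥0 × S => Z p.1 p.2) ∧
  ∃ ℱ : Filtration ℝ≥0 mS, (∀ t, Measurable[ℱ t] (Z t)) ∧
    ∀ Φ : Omega → ℝ, BddBorel Φ → BddBorel (A Φ) →
      Martingale (fun (t : ℝ≥0) (ω : S) => Φ (Z t ω) - Φ (Z 0 ω) -
        ∫ s in (0 : ℝ)..t, A Φ (Z s.toNNReal ω)) ℱ P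

/-- The process generated by `A` is reversible with respect to `μ`: started from `μ`, its
finite-dimensional distributions are invariant under every time reversal `t ↦ T - t`. -/
def IsReversible (A : (Omega → ℝ) → Omega → ℝ) (μ : Measure Omega) : Prop :=
  ∀ (S : Type u) [MeasurableSpace S] (P : Measure S) [IsProbabilityMeasure P]
    (Z : ℝ≥0 → S → Omega), IsGeneratedBy A P Z → P.map (Z 0) = μ →
    ∀ (n : ℕ) (T : ℝ≥0) (t : Fin n → ℝ≥0), (∀ i, t i ≤ T) →
      P.map (fun ω i => Z (t i) ω) = P.map (fun ω i => Z (T - t i) ω)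

/-! ## Point configurations, correlation functions, Palm distributions -/

/-- A measure on `(0,∞)` (a measure on `ℝ` giving no mass to `(-∞,0]`) that takes finite integer
values on Borel sets which are relatively compact in `(0,∞)`. -/
def IsConfig (η : Measure ℝ) : Prop :=
  η (Set.Iic 0) = 0 ∧
    ∀ a b : ℝ, 0 < a → ∀ B : Set ℝ, MeasurableSet B → B ⊆ Set.Icc a b → ∃ n : ℕ, η B = n

/-- The space `𝒩` of `ℤ₊`-valued Radon measures on `(0,∞)`. Its σ-algebra is generated by the
evaluations `η ↦ η B`, i.e. it is the Borel σ-algebra of the vague topology. -/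
abbrev Config : Type := {η : Measure ℝ // IsConfig η}

theorem isConfig_add {η ζ : Measure ℝ} (h : IsConfig η) (h' : IsConfig ζ) :
    IsConfig (η + ζ) := by
  refine ⟨by simp [h.1, h'.1], fun a b ha B hB hBs => ?_⟩
  obtain ⟨n, hn⟩ := h.2 a b ha B hB hBs
  obtain ⟨m, hm⟩ := h'.2 a b ha B hB hBs
  exact ⟨n + m, by simp [hn, hm]⟩

theorem isConfig_dirac {x : ℝ} (hx : 0 < x) : IsConfig (Measure.dirac x) := by
  refine ⟨?_, fun a b _ B hB _ => ?_⟩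
  · rw [Measure.dirac_apply' _ measurableSet_Iic]
    simp [hx]
  · rw [Measure.dirac_apply' _ hB]
    by_cases h : x ∈ B
    · exact ⟨1, by simp [h]⟩
    · exact ⟨0, by simp [h]⟩

open Classical in
/-- `η + δ_x` for `x > 0` (and `η` for `x ≤ 0`, which is never used). -/
def addPoint (η : Config) (x : ℝ) : Config :=
  if hx : 0 < x then ⟨η.1 + Measure.dirac x, isConfig_add η.2 (isConfig_dirac hx)⟩ else η

open Classical in
theorem isConfig_sum (z : Omega) :
    IsConfig (Measure.sum (fun i : ℕ => if 0 < z.1 i then Measure.dirac (z.1 i) else 0)) := by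
  refine ⟨?_, fun a b ha B hB hBs => ?_⟩
  · rw [Measure.sum_apply _ measurableSet_Iic, ENNReal.tsum_eq_zero]
    intro i
    split_ifs with h
    · exact (isConfig_dirac h).1
    · simp
  · have hfin : {i : ℕ | a ≤ z.1 i}.Finite := by
      have h1 : ∀ᶠ i in Filter.cofinite, z.1 i < a :=
        z.2.2.2.1.tendsto_cofinite_zero.eventually_lt_const ha
      simpa [Filter.eventually_cofinite] using h1
    refine ⟨∑ i ∈ hfin.toFinset, if z.1 i ∈ B then 1 else 0, ?_⟩
    rw [Measure.sum_apply _ hB, tsum_eq_sum (s := hfin.toFinset)]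
    · push_cast
      refine Finset.sum_congr rfl (fun i hi => ?_)
      have hi' : 0 < z.1 i := lt_of_lt_of_le ha (by simpa using hi)
      rw [if_pos hi', Measure.dirac_apply' _ hB]
      by_cases h : z.1 i ∈ B <;> simp [h]
    · intro i hi
      have hi' : z.1 i ∉ B := fun h => hi (by simpa using (hBs h).1)
      split_ifs
      · rw [Measure.dirac_apply' _ hB]; simp [hi']
      · simp

open Classical in
/-- The point configuration `Ξ(z) = ∑_{i : zᵢ > 0} δ_{zᵢ}`. -/
def Xi (z : Omega) : Config :=
  ⟨Measure.sum (fun i : ℕ => if 0 < z.1 i then Measure.dirac (z.1 i) else 0), isConfig_sum z⟩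

section Palm

variable {S : Type v} [MeasurableSpace S]

/-- `r` is the first correlation function of `ξ = Ξ(Z)`: the Lebesgue density on `(0,∞)` of the
mean measure of `ξ`. -/
def IsCorrelationFunction₁ (P : Measure S) (Z : S → Omega) (r : ℝ → ℝ≥0∞) : Prop :=
  Measurable r ∧ ∀ B : Set ℝ, MeasurableSet B →
    ∫⁻ ω, (Xi (Z ω)).1 B ∂P = ∫⁻ x in B ∩ Set.Ioi 0, r x

open Classical in
/-- `r` is the second correlation function of `ξ = Ξ(Z)`: the Lebesgue density on `(0,∞)²` of the
mean measure of `ξ^{[2]} = ∑_{i≠j} δ_{(Zᵢ,Zⱼ)}` (over `i`, `j` with `Zᵢ, Zⱼ > 0`). -/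
def IsCorrelationFunction₂ (P : Measure S) (Z : S → Omega) (r : ℝ × ℝ → ℝ≥0∞) : Prop :=
  Measurable r ∧ ∀ B : Set (ℝ × ℝ), MeasurableSet B →
    ∫⁻ ω, (∑' p : ℕ × ℕ, if p.1 ≠ p.2 ∧ 0 < (Z ω).1 p.1 ∧ 0 < (Z ω).1 p.2 then
        B.indicator (1 : ℝ × ℝ → ℝ≥0∞) ((Z ω).1 p.1, (Z ω).1 p.2) else 0) ∂P =
      ∫⁻ x in B ∩ (Set.Ioi 0 ×ˢ Set.Ioi 0), r x

open Classical in
/-- `Q` is the family of first-order reduced Palm distributions of `ξ = Ξ(Z)`, whose first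
correlation measure is `r(x) dx`:
`E[∑ᵢ G(Zᵢ, ξ)] = ∫ r(x) E_x[G(x, η + δ_x)] dx`. -/
def IsPalm₁ (P : Measure S) (Z : S → Omega) (r : ℝ → ℝ≥0∞) (Q : Kernel ℝ Config) : Prop :=
  ∀ G : ℝ × Config → ℝ≥0∞, Measurable G →
    ∫⁻ ω, (∑' i : ℕ, if 0 < (Z ω).1 i then G ((Z ω).1 i, Xi (Z ω)) else 0) ∂P =
      ∫⁻ x in Set.Ioi 0, r x * ∫⁻ η, G (x, addPoint η x) ∂(Q x)

open Classical in
/-- `Q` is the family of second-order reduced Palm distributions of `ξ = Ξ(Z)`, whose second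
correlation measure is `r(x) dx`:
`E[∑_{i≠j} G(Zᵢ, Zⱼ, ξ)] = ∫ r(x₁,x₂) E_{x₁,x₂}[G(x₁, x₂, η + δ_{x₁} + δ_{x₂})] dx₁dx₂`. -/
def IsPalm₂ (P : Measure S) (Z : S → Omega) (r : ℝ × ℝ → ℝ≥0∞) (Q : Kernel (ℝ × ℝ) Config) :
    Prop :=
  ∀ G : (ℝ × ℝ) × Config → ℝ≥0∞, Measurable G →
    ∫⁻ ω, (∑' p : ℕ × ℕ, if p.1 ≠ p.2 ∧ 0 < (Z ω).1 p.1 ∧ 0 < (Z ω).1 p.2 then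
        G (((Z ω).1 p.1, (Z ω).1 p.2), Xi (Z ω)) else 0) ∂P =
      ∫⁻ x in Set.Ioi 0 ×ˢ Set.Ioi 0,
        r x * ∫⁻ η, G (x, addPoint (addPoint η x.1) x.2) ∂(Q x)

end Palm

/-! ## The Poisson–Dirichlet distribution -/

/-- Stick breaking: `Yₙ = bₙ ∏_{j<n} (1 - bⱼ)`. -/
def stick (b : ℕ → ℝ) (n : ℕ) : ℝ := b n * ∏ j ∈ Finset.range n, (1 - b j)

theorem hasSum_unit : HasSum (fun n : ℕ => if n = 0 then (1 : ℝ) else 0) 1 :=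
  hasSum_ite_eq 0 1

/-- The point `(1,0,0,…)` of `Ω₁`. -/
def unitPoint : OmegaOne :=
  ⟨⟨fun n => if n = 0 then 1 else 0,
    by
      intro n m h
      dsimp only
      split_ifs with h1 h2
      · exact le_rfl
      · omega
      · norm_num
      · exact le_rfl,
    by intro n; dsimp only; split_ifs <;> norm_num,
    hasSum_unit.summable, by rw [hasSum_unit.tsum_eq]; norm_num⟩, hasSum_unit.tsum_eq⟩

open Classical in
/-- The decreasing rearrangement, as an element of `Ω₁`, of the stick-breaking sequence of `b`
whenever that sequence is nonnegative with sum `1`; otherwise (an event of probability zero in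
the next definition) the point `(1,0,0,…)`. -/
def rankedStick (b : ℕ → ℝ) : OmegaOne :=
  if h : (∀ n, 0 ≤ stick b n) ∧ HasSum (stick b) 1 then
    ⟨rank (stick b) h.1 h.2.summable (by rw [h.2.tsum_eq]; norm_num),
      by rw [mass_rank, h.2.tsum_eq]⟩
  else unitPoint

/-- The Poisson–Dirichlet distribution `PD(θ)` on `Ω₁`: the law of the decreasing rearrangement
of the stick-breaking (GEM) sequence of i.i.d. Beta(1,θ) variables. -/
def poissonDirichlet (θ : ℝ) : Measure OmegaOne :=
  (Measure.infinitePi (fun _ : ℕ => betaMeasure 1 θ)).map rankedStick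

end CoagFrag

end

open CoagFrag

/-! ## Operators acting on bounded functions supported in a level set -/

/-! Reversibility rests on detailed balance: under the initial law μ, the flow of mergers from z to
z' equals the flow of splittings from z' back to z (`DetailedBalance`). Both mechanisms conserve the
total mass, and on {|z| ≤ m} homogeneity of degree λ ≥ 0 together with the bounds on the kernels
makes the total jump rate bounded. On bounded functions supported in such a level set, the generator
is therefore a bounded jump operator A that is symmetric with respect to μ and annihilates the
indicator of the level set.

Tested on these functions alone, the martingale problem can be iterated to a Taylor expansion of E[g
Φ(Z_t)] about an earlier time s. Its limit is the Markov property with semigroup exp((t-s)A)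
(`expectation_expSeries`); neither a construction of the process nor a uniqueness theorem is needed.
Symmetry of the semigroup reverses the iterated integrals that give the finite-dimensional
distributions (`integral_chain_eq_reverse`), and m → ∞ removes the restriction to a level set
(`isReversible_of_levelOperators`).

For (i), the Palm formulas turn the two flows into integrals over (z₁, z₂) that involve the
configurations η + δ_{z₁} + δ_{z₂} and η + δ_{z₁+z₂}, taken against exactly the two measures
identified by the hypothesis (`palm_detailedBalance`).

For (ii), the flows are computed on the unranked stick-breaking sequence, which is legitimate
because they depend on the point configuration only. The law of this sequence is invariant under
breaking off a Beta(1,θ) fraction, and this alone implies invariance under size-biased picking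
(`IsGEM.sizeBiased`). The factor xy of the coagulation rate picks two pieces a, y by size, with
density θ²(1-a-y)^(θ-1). The factor x+y of the splitting rate picks one piece c with density
θ(1-c)^(θ-1), and the rate supplies another θ. With c = a + y the two integrals coincide, the
remaining mass being filled by the same independent copy. Independence of V and X then allows
averaging over the dilation factor. -/

namespace CoagFrag

section LevelOperator

variable {E : Type*} [MeasurableSpace E]

/-- Measurable functions bounded by `C` and supported in `U`. -/
structure LevelFun (U : Set E) (C : ℝ) (Φ : E → ℝ) : Prop where
  measurable : Measurable Φ
  bound : ∀ z, |Φ z| ≤ C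
  supp : ∀ z, z ∉ U → Φ z = 0

theorem LevelFun.mul {U : Set E} {C C' : ℝ} {Φ Ψ : E → ℝ} (hΦ : LevelFun U C Φ)
    (hΨ : LevelFun U C' Ψ) : LevelFun U (C * C') (Φ * Ψ) where
  measurable := hΦ.measurable.mul hΨ.measurable
  bound z := by
    rw [Pi.mul_apply, abs_mul]
    exact mul_le_mul (hΦ.bound z) (hΨ.bound z) (abs_nonneg _)
      ((abs_nonneg _).trans (hΦ.bound z))
  supp z hz := by rw [Pi.mul_apply, hΦ.supp z hz, zero_mul]

theorem levelFun_indicator {U B : Set E} (hB : MeasurableSet B) (h : B ⊆ U) :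
    LevelFun U 1 (B.indicator 1) where
  measurable := measurable_one.indicator hB
  bound z := by by_cases hz : z ∈ B <;> simp [hz]
  supp z hz := Set.indicator_of_notMem (fun hb => hz (h hb)) _

/-- `A` maps functions bounded by `C` and supported in `U` to functions bounded by `R * C` and
supported in `U`, annihilates `1_U`, and is symmetric with respect to `μ`. -/
structure IsLevelOperator (A : (E → ℝ) → E → ℝ) (U : Set E) (R : ℝ) (μ : Measure E) : Prop where
  measurableSet : MeasurableSet U
  nonneg : 0 ≤ R
  map : ∀ C Φ, LevelFun U C Φ → LevelFun U (R * C) (A Φ)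
  map_indicator : A (U.indicator 1) = 0
  symm : ∀ C C' Φ Ψ, LevelFun U C Φ → LevelFun U C' Ψ →
    ∫ z, Ψ z * A Φ z ∂μ = ∫ z, A Ψ z * Φ z ∂μ

/-- The exponential series `∑ hᵏ Aᵏ / k!` applied to a function. -/
noncomputable def expSeries (A : (E → ℝ) → E → ℝ) (h : ℝ) (Φ : E → ℝ) (z : E) : ℝ :=
  ∑' k : ℕ, h ^ k / (k.factorial : ℝ) * (A^[k] Φ) z

variable {A : (E → ℝ) → E → ℝ} {U : Set E} {R : ℝ} {μ : Measure E}

theorem IsLevelOperator.indicator (hA : IsLevelOperator A U R μ) :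
    LevelFun U 1 (U.indicator (1 : E → ℝ)) := levelFun_indicator hA.measurableSet subset_rfl

theorem IsLevelOperator.iterate (hA : IsLevelOperator A U R μ) {C : ℝ} {Φ : E → ℝ}
    (hΦ : LevelFun U C Φ) (k : ℕ) : LevelFun U (R ^ k * C) (A^[k] Φ) := by
  induction k with
  | zero => simpa using hΦ
  | succ k ih =>
    rw [Function.iterate_succ_apply', pow_succ', mul_assoc]
    exact hA.map _ _ ih

theorem IsLevelOperator.iterate_symm (hA : IsLevelOperator A U R μ) (k : ℕ) {C C' : ℝ}
    {Φ Ψ : E → ℝ} (hΦ : LevelFun U C Φ) (hΨ : LevelFun U C' Ψ) :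
    ∫ z, Ψ z * (A^[k] Φ) z ∂μ = ∫ z, (A^[k] Ψ) z * Φ z ∂μ := by
  induction k generalizing C' Ψ with
  | zero => rfl
  | succ k ih =>
    rw [Function.iterate_succ_apply', hA.symm _ _ _ _ (hA.iterate hΦ k) hΨ,
      ih (hA.map _ _ hΨ), Function.iterate_succ_apply]

/-- Linearity of `A` is not part of the structure; the bound with constant 0 replaces it. -/
theorem IsLevelOperator.map_zero (hA : IsLevelOperator A U R μ) : A 0 = 0 := by
  have h := hA.map 0 0 ⟨measurable_zero, by simp, by simp⟩
  funext z
  have := h.bound z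
  rw [mul_zero] at this
  exact abs_eq_zero.1 (le_antisymm this (abs_nonneg _))

theorem IsLevelOperator.iterate_indicator (hA : IsLevelOperator A U R μ) (k : ℕ) :
    A^[k + 1] (U.indicator 1) = 0 := by
  induction k with
  | zero => exact hA.map_indicator
  | succ k ih => rw [Function.iterate_succ_apply', ih, hA.map_zero]

theorem expSeries_term_bound (hA : IsLevelOperator A U R μ) {C : ℝ} {Φ : E → ℝ}
    (hΦ : LevelFun U C Φ) {h : ℝ} (hh : 0 ≤ h) (k : ℕ) (z : E) :
    |h ^ k / (k.factorial : ℝ) * (A^[k] Φ) z| ≤ (h * R) ^ k / (k.factorial : ℝ) * C := by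
  rw [abs_mul, abs_of_nonneg (by positivity)]
  calc _ ≤ h ^ k / (k.factorial : ℝ) * (R ^ k * C) := by
        gcongr
        exact (hA.iterate hΦ k).bound z
    _ = _ := by rw [mul_pow]; ring

theorem summable_expSeries_bound (h R C : ℝ) :
    Summable fun k : ℕ => (h * R) ^ k / (k.factorial : ℝ) * C :=
  (Real.summable_pow_div_factorial _).mul_right _

theorem IsLevelOperator.expSeries (hA : IsLevelOperator A U R μ) {C : ℝ} {Φ : E → ℝ}
    (hΦ : LevelFun U C Φ) {h : ℝ} (hh : 0 ≤ h) :
    LevelFun U (∑' k : ℕ, (h * R) ^ k / (k.factorial : ℝ) * C) (expSeries A h Φ) where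
  measurable := by
    have hs : ∀ z, Summable fun k : ℕ => h ^ k / (k.factorial : ℝ) * (A^[k] Φ) z := fun z =>
      Summable.of_norm_bounded (summable_expSeries_bound h R C)
        fun k => expSeries_term_bound hA hΦ hh k z
    refine measurable_of_tendsto_metrizable (f := fun n z =>
      ∑ k ∈ Finset.range n, h ^ k / (k.factorial : ℝ) * (A^[k] Φ) z) (fun n => ?_) ?_
    · exact Finset.measurable_fun_sum _ fun k _ => (hA.iterate hΦ k).measurable.const_mul _
    · exact tendsto_pi_nhds.2 fun z => (hs z).hasSum.tendsto_sum_nat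
  bound z := by
    rw [CoagFrag.expSeries, ← Real.norm_eq_abs]
    exact tsum_of_norm_bounded (summable_expSeries_bound h R C).hasSum
      fun k => expSeries_term_bound hA hΦ hh k z
  supp z hz := by
    have : ∀ k, (A^[k] Φ) z = 0 := fun k => (hA.iterate hΦ k).supp z hz
    simp [CoagFrag.expSeries, this]

/-- Only the term of order 0 survives. The semigroup is conservative on the level set, where the
indicator of `U` plays the role of the constant 1. -/
theorem IsLevelOperator.expSeries_indicator (hA : IsLevelOperator A U R μ) (h : ℝ) :
    CoagFrag.expSeries A h (U.indicator 1) = U.indicator 1 := by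
  funext z
  unfold CoagFrag.expSeries
  rw [tsum_eq_single 0]
  · simp
  · intro k hk
    obtain ⟨n, rfl⟩ := Nat.exists_eq_succ_of_ne_zero hk
    rw [Nat.succ_eq_add_one, hA.iterate_indicator n]
    simp

/-- Integrals against a bounded function of the exponential series. -/
theorem IsLevelOperator.hasSum_integral (hA : IsLevelOperator A U R μ) {C : ℝ} {Φ : E → ℝ}
    (hΦ : LevelFun U C Φ) {h : ℝ} (hh : 0 ≤ h) {S : Type*} [MeasurableSpace S] (P : Measure S)
    [IsFiniteMeasure P] {X : S → E} (hX : Measurable X) {g : S → ℝ} (hg : Measurable g) {c : ℝ}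
    (hc : ∀ ω, |g ω| ≤ c) :
    HasSum (fun k : ℕ => h ^ k / (k.factorial : ℝ) * ∫ ω, g ω * (A^[k] Φ) (X ω) ∂P)
      (∫ ω, g ω * CoagFrag.expSeries A h Φ (X ω) ∂P) := by
  have hbd : ∀ k ω, ‖g ω * (h ^ k / (k.factorial : ℝ) * (A^[k] Φ) (X ω))‖ ≤
      c * ((h * R) ^ k / (k.factorial : ℝ) * C) := fun k ω => by
    rw [norm_mul]
    exact mul_le_mul (hc ω) (expSeries_term_bound hA hΦ hh k _) (norm_nonneg _)
      ((abs_nonneg _).trans (hc ω))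
  have hint : ∀ k : ℕ, Integrable
      (fun ω => g ω * (h ^ k / (k.factorial : ℝ) * (A^[k] Φ) (X ω))) P := fun k =>
    Integrable.of_bound (hg.mul (((hA.iterate hΦ k).measurable.comp hX).const_mul
      _)).aestronglyMeasurable _ (Filter.Eventually.of_forall (hbd k))
  -- The terms are dominated by those of an exponential series, so sum and integral may be
  -- exchanged.
  have key := hasSum_integral_of_summable_integral_norm hint
    (Summable.of_nonneg_of_le (fun k => integral_nonneg fun ω => norm_nonneg _)
      (fun k => (integral_mono (hint k).norm (integrable_const _) (hbd k)).trans
        (by simp : _ ≤ P.real Set.univ * (c * ((h * R) ^ k / (k.factorial : ℝ) * C))))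
      (((summable_expSeries_bound h R C).mul_left c).mul_left _))
  have e1 : (fun k : ℕ => h ^ k / (k.factorial : ℝ) * ∫ ω, g ω * (A^[k] Φ) (X ω) ∂P) =
      fun k => ∫ ω, g ω * (h ^ k / (k.factorial : ℝ) * (A^[k] Φ) (X ω)) ∂P := by
    funext k
    rw [← integral_const_mul]
    congr 1
    funext ω
    ring
  have e2 : (fun ω => g ω * CoagFrag.expSeries A h Φ (X ω)) =
      fun ω => ∑' k : ℕ, g ω * (h ^ k / (k.factorial : ℝ) * (A^[k] Φ) (X ω)) := by
    funext ω
    rw [tsum_mul_left]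
    rfl
  rw [e1, e2]
  exact key

theorem IsLevelOperator.expSeries_symm [IsFiniteMeasure μ] (hA : IsLevelOperator A U R μ)
    {C C' : ℝ} {Φ Ψ : E → ℝ} (hΦ : LevelFun U C Φ) (hΨ : LevelFun U C' Ψ) {h : ℝ} (hh : 0 ≤ h) :
    ∫ z, Ψ z * CoagFrag.expSeries A h Φ z ∂μ = ∫ z, CoagFrag.expSeries A h Ψ z * Φ z ∂μ := by
  have h1 := hA.hasSum_integral hΦ hh μ measurable_id hΨ.measurable hΨ.bound
  have h2 := hA.hasSum_integral hΨ hh μ measurable_id hΦ.measurable hΦ.bound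
  simp only [id] at h1 h2
  simp_rw [mul_comm (CoagFrag.expSeries A h Ψ _) (Φ _)]
  refine h1.unique ?_
  convert h2 using 3 with k
  rw [hA.iterate_symm k hΦ hΨ]
  simp_rw [mul_comm]

end LevelOperator

end CoagFrag

/-! ## The Markov property of solutions of the martingale problem -/

namespace CoagFrag

theorem abs_mul_levelFun_le {S : Type*} {U : Set Omega} {C c : ℝ} {Φ : Omega → ℝ}
    (hΦ : LevelFun U C Φ) {g : S → ℝ}
    (hc : ∀ ω, |g ω| ≤ c) (z : Omega) (ω : S) : ‖g ω * Φ z‖ ≤ c * C := by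
  rw [norm_mul]
  exact mul_le_mul (hc ω) (hΦ.bound _) (norm_nonneg _) ((abs_nonneg _).trans (hc ω))

section Markov

variable {A : (Omega → ℝ) → Omega → ℝ} {U : Set Omega} {R : ℝ} {μ : Measure Omega}
  {S : Type u} [mS : MeasurableSpace S] {P : Measure S} {Z : ℝ≥0 → S → Omega}

theorem isFiniteMeasure_restrict_uIoc (a b : ℝ) :
    IsFiniteMeasure ((volume : Measure ℝ).restrict (Set.uIoc a b)) := by
  rw [Set.uIoc]
  infer_instance

theorem LevelFun.bddBorel {C : ℝ} {Φ : Omega → ℝ} (hΦ : LevelFun U C Φ) : BddBorel Φ :=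
  ⟨hΦ.measurable, C, hΦ.bound⟩

theorem measurable_toNNReal_path (hZ : Measurable fun p : ℝ≥0 × S => Z p.1 p.2) {Φ : Omega → ℝ}
    (hΦ : Measurable Φ) : Measurable fun p : ℝ × S => Φ (Z p.1.toNNReal p.2) :=
  hΦ.comp (hZ.comp ((measurable_real_toNNReal.comp measurable_fst).prodMk measurable_snd))

theorem measurable_eval (hZ : Measurable fun p : ℝ≥0 × S => Z p.1 p.2) (t : ℝ≥0) :
    Measurable (Z t) := hZ.comp (measurable_const.prodMk measurable_id)

theorem intervalIntegrable_path (hZ : Measurable fun p : ℝ≥0 × S => Z p.1 p.2) {C : ℝ}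
    {Φ : Omega → ℝ} (hΦ : LevelFun U C Φ) (ω : S) (a b : ℝ) :
    IntervalIntegrable (fun r : ℝ => Φ (Z r.toNNReal ω)) volume a b := by
  have := isFiniteMeasure_restrict_uIoc a b
  rw [intervalIntegrable_iff]
  exact Integrable.of_bound (((measurable_toNNReal_path hZ hΦ.measurable).comp
    (measurable_id.prodMk measurable_const)).aestronglyMeasurable) C
    (Filter.Eventually.of_forall fun _ => hΦ.bound _)

theorem intervalIntegrable_expectation [IsProbabilityMeasure P]
    (hZ : Measurable fun p : ℝ≥0 × S => Z p.1 p.2) {C c : ℝ}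
    {Φ : Omega → ℝ} (hΦ : LevelFun U C Φ) {g : S → ℝ} (hg : Measurable g)
    (hc : ∀ ω, |g ω| ≤ c) (a b : ℝ) :
    IntervalIntegrable (fun r : ℝ => ∫ ω, g ω * Φ (Z r.toNNReal ω) ∂P) volume a b := by
  have := isFiniteMeasure_restrict_uIoc a b
  rw [intervalIntegrable_iff]
  refine Integrable.of_bound (C := c * C) ?_ (Filter.Eventually.of_forall fun r => ?_)
  · exact (StronglyMeasurable.integral_prod_right' (f := fun p : ℝ × S =>
      g p.2 * Φ (Z p.1.toNNReal p.2)) (((hg.comp measurable_snd).mul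
        (measurable_toNNReal_path hZ hΦ.measurable)).stronglyMeasurable)).aestronglyMeasurable
  · simpa using norm_integral_le_of_norm_le_const (μ := P)
      (Filter.Eventually.of_forall fun ω => abs_mul_levelFun_le hΦ hc (Z r.toNNReal ω) ω)

/-- The martingale property is tested against a bounded variable known at time s, and Fubini takes
the time integral of the compensator outside the expectation. -/
theorem expectation_increment [IsProbabilityMeasure P] (hA : IsLevelOperator A U R μ)
    (hZ : Measurable fun p : ℝ≥0 × S => Z p.1 p.2) {ℱ : Filtration ℝ≥0 mS}
    (hmart : ∀ Φ : Omega → ℝ, BddBorel Φ → BddBorel (A Φ) →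
      Martingale (fun (t : ℝ≥0) (ω : S) => Φ (Z t ω) - Φ (Z 0 ω) -
        ∫ s in (0 : ℝ)..t, A Φ (Z s.toNNReal ω)) ℱ P)
    {C c : ℝ} {Φ : Omega → ℝ} (hΦ : LevelFun U C Φ) {s t : ℝ≥0} (hst : s ≤ t)
    {g : S → ℝ} (hg : Measurable[ℱ s] g) (hc : ∀ ω, |g ω| ≤ c) :
    ∫ ω, g ω * Φ (Z t ω) ∂P = ∫ ω, g ω * Φ (Z s ω) ∂P +
      ∫ r in (s : ℝ)..t, ∫ ω, g ω * A Φ (Z r.toNNReal ω) ∂P := by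
  have hAΦ := hA.map _ _ hΦ
  have hM := hmart Φ hΦ.bddBorel hAΦ.bddBorel
  have hg' : Measurable g := hg.mono (ℱ.le s) le_rfl
  set M : ℝ≥0 → S → ℝ := fun t ω => Φ (Z t ω) - Φ (Z 0 ω) -
        ∫ s in (0 : ℝ)..t, A Φ (Z s.toNNReal ω) with hMdef
  have hMint : ∀ r, Integrable (M r) P := fun r => by
    refine Integrable.of_bound (((hM.1 r).mono (ℱ.le r)).aestronglyMeasurable)
      (C + C + R * C * |(r : ℝ) - 0|) (Filter.Eventually.of_forall fun ω => ?_)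
    refine (norm_sub_le _ _).trans (add_le_add ((norm_sub_le _ _).trans
      (add_le_add (hΦ.bound _) (hΦ.bound _))) ?_)
    exact intervalIntegral.norm_integral_le_of_norm_le_const fun x _ => hAΦ.bound _
  have hgM : ∀ r, Integrable (fun ω => g ω * M r ω) P := fun r =>
    (hMint r).bdd_mul hg'.aestronglyMeasurable
      (Filter.Eventually.of_forall fun ω => hc ω)
  -- `g` is `ℱ s`-measurable, so it can be pulled out of the conditional expectation.
  have h1 : ∫ ω, g ω * M t ω ∂P = ∫ ω, g ω * M s ω ∂P := by
    have h2 : P[g * M t | ℱ s] =ᵐ[P] g * P[M t | ℱ s] :=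
      condExp_stronglyMeasurable_mul_of_bound (ℱ.le s) hg.stronglyMeasurable (hMint t) c
        (Filter.Eventually.of_forall fun ω => hc ω)
    have h3 := hM.2 s t hst
    calc ∫ ω, g ω * M t ω ∂P = ∫ ω, (P[g * M t | ℱ s]) ω ∂P := (integral_condExp (ℱ.le s)).symm
      _ = ∫ ω, g ω * M s ω ∂P := by
        refine integral_congr_ae ?_
        filter_upwards [h2, h3] with ω e2 e3
        rw [e2, Pi.mul_apply, e3]
  have hgΦ : ∀ r, Integrable (fun ω => g ω * Φ (Z r ω)) P := fun r =>
    Integrable.of_bound (hg'.mul (hΦ.measurable.comp (measurable_eval hZ r))).aestronglyMeasurable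
      _ (Filter.Eventually.of_forall fun ω => abs_mul_levelFun_le hΦ hc _ ω)
  have h4 : ∫ r in (s : ℝ)..t, ∫ ω, g ω * A Φ (Z r.toNNReal ω) ∂P =
      ∫ ω, (∫ r in (s : ℝ)..t, g ω * A Φ (Z r.toNNReal ω)) ∂P := by
    have := isFiniteMeasure_restrict_uIoc (s : ℝ) t
    refine intervalIntegral_integral_swap (Integrable.of_bound (C := c * (R * C)) ?_
      (Filter.Eventually.of_forall fun p => abs_mul_levelFun_le hAΦ hc _ p.2))
    exact ((hg'.comp measurable_snd).mul
        (measurable_toNNReal_path hZ hAΦ.measurable)).aestronglyMeasurable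
  rw [h4]
  have h5 : ∀ ω, (∫ r in (s : ℝ)..t, g ω * A Φ (Z r.toNNReal ω)) =
      g ω * Φ (Z t ω) - g ω * Φ (Z s ω) - (g ω * M t ω - g ω * M s ω) := fun ω => by
    rw [intervalIntegral.integral_const_mul, ← intervalIntegral.integral_interval_sub_left
      (intervalIntegrable_path hZ hAΦ ω 0 t) (intervalIntegrable_path hZ hAΦ ω 0 s), hMdef]
    ring
  simp_rw [h5]
  have h6 : ∫ ω, (g ω * Φ (Z t ω) - g ω * Φ (Z s ω) - (g ω * M t ω - g ω * M s ω)) ∂P =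
      ∫ ω, (g ω * Φ (Z t ω) - g ω * Φ (Z s ω)) ∂P - ∫ ω, (g ω * M t ω - g ω * M s ω) ∂P :=
    integral_sub ((hgΦ t).sub (hgΦ s)) ((hgM t).sub (hgM s))
  rw [h6, integral_sub (hgΦ t) (hgΦ s), integral_sub (hgM t) (hgM s), h1]
  ring

/-- The increment formula expresses the remainder of order n + 1 for Φ as the time integral of the
remainder of order n for A Φ. The induction therefore runs over all Φ and t at once; each step
contributes a factor R and one integration in time. -/
theorem expectation_taylor [IsProbabilityMeasure P] (hA : IsLevelOperator A U R μ)
    (hZ : Measurable fun p : ℝ≥0 × S => Z p.1 p.2) {ℱ : Filtration ℝ≥0 mS}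
    (hmart : ∀ Φ : Omega → ℝ, BddBorel Φ → BddBorel (A Φ) →
      Martingale (fun (t : ℝ≥0) (ω : S) => Φ (Z t ω) - Φ (Z 0 ω) -
        ∫ s in (0 : ℝ)..t, A Φ (Z s.toNNReal ω)) ℱ P)
    {c : ℝ} {s : ℝ≥0} {g : S → ℝ} (hg : Measurable[ℱ s] g) (hc : ∀ ω, |g ω| ≤ c) (n : ℕ) :
    ∀ (C : ℝ) (Φ : Omega → ℝ), LevelFun U C Φ → ∀ t : ℝ≥0, s ≤ t →
      |∫ ω, g ω * Φ (Z t ω) ∂P - ∑ k ∈ Finset.range n,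
        ((t : ℝ) - s) ^ k / (k.factorial : ℝ) * ∫ ω, g ω * (A^[k] Φ) (Z s ω) ∂P| ≤
      c * (C * R ^ n) * (((t : ℝ) - s) ^ n / (n.factorial : ℝ)) := by
  have hg' : Measurable g := hg.mono (ℱ.le s) le_rfl
  have hpow : ∀ (k : ℕ) (t : ℝ), ∫ r in (s : ℝ)..t, (r - s) ^ k / (k.factorial : ℝ) =
      (t - s) ^ (k + 1) / ((k + 1).factorial : ℝ) := fun k t => by
    rw [intervalIntegral.integral_div, intervalIntegral.integral_comp_sub_right
      (fun x => x ^ k) (s : ℝ), integral_pow, Nat.factorial_succ]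
    push_cast
    rw [sub_self, zero_pow (Nat.succ_ne_zero k), sub_zero, div_div]
  induction n with
  | zero =>
    intro C Φ hΦ t _
    simpa using norm_integral_le_of_norm_le_const (μ := P)
      (Filter.Eventually.of_forall fun ω => abs_mul_levelFun_le hΦ hc (Z t ω) ω)
  | succ n ih =>
    intro C Φ hΦ t hst
    have hAΦ := hA.map _ _ hΦ
    have hst' : (s : ℝ) ≤ t := by exact_mod_cast hst
    have hterm : ∀ (k : ℕ) (a : ℝ), IntervalIntegrable
        (fun r : ℝ => (r - s) ^ k / (k.factorial : ℝ) * a) volume s t := fun k a =>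
      Continuous.intervalIntegrable (by fun_prop) _ _
    -- The term k = 0 cancels the value at time s; the others are time integrals of the terms
    -- belonging to `A Φ`.
    have e : ∫ ω, g ω * Φ (Z t ω) ∂P - ∑ k ∈ Finset.range (n + 1),
        ((t : ℝ) - s) ^ k / (k.factorial : ℝ) * ∫ ω, g ω * (A^[k] Φ) (Z s ω) ∂P =
        ∫ r in (s : ℝ)..t, (∫ ω, g ω * A Φ (Z r.toNNReal ω) ∂P - ∑ k ∈ Finset.range n,
          (r - s) ^ k / (k.factorial : ℝ) * ∫ ω, g ω * (A^[k] (A Φ)) (Z s ω) ∂P) := by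
      rw [intervalIntegral.integral_sub (intervalIntegrable_expectation hZ hAΦ hg' hc _ _)
        (Continuous.intervalIntegrable (by fun_prop) _ _),
        intervalIntegral.integral_finsetSum fun k _ => hterm k _,
        expectation_increment hA hZ hmart hΦ hst hg hc, Finset.sum_range_succ']
      simp_rw [intervalIntegral.integral_mul_const, hpow, Function.iterate_succ_apply]
      simp
      ring
    rw [e, ← Real.norm_eq_abs]
    have hb : ∀ r ∈ Set.Ioc (s : ℝ) t, ‖∫ ω, g ω * A Φ (Z r.toNNReal ω) ∂P -
        ∑ k ∈ Finset.range n, (r - s) ^ k / (k.factorial : ℝ) *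
          ∫ ω, g ω * (A^[k] (A Φ)) (Z s ω) ∂P‖ ≤
        c * (R * C * R ^ n) * ((r - s) ^ n / (n.factorial : ℝ)) := fun r hr => by
      have h0 : (0 : ℝ) ≤ r := s.2.trans hr.1.le
      have := ih _ _ hAΦ r.toNNReal (by
        rw [← NNReal.coe_le_coe, Real.coe_toNNReal r h0]; exact hr.1.le)
      rwa [Real.coe_toNNReal r h0] at this
    refine (intervalIntegral.norm_integral_le_of_norm_le hst'
      (Filter.Eventually.of_forall hb) (Continuous.intervalIntegrable (by fun_prop) _ _)).trans ?_
    rw [intervalIntegral.integral_const_mul, hpow]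
    apply le_of_eq
    ring

/-- The Markov property on a level set: the Taylor remainder vanishes in the limit because `A` is
bounded there. Allowing an arbitrary bounded `g` from the past is what makes finite-dimensional
distributions accessible. -/
theorem expectation_expSeries [IsProbabilityMeasure P] (hA : IsLevelOperator A U R μ)
    (hZ : Measurable fun p : ℝ≥0 × S => Z p.1 p.2) {ℱ : Filtration ℝ≥0 mS}
    (hmart : ∀ Φ : Omega → ℝ, BddBorel Φ → BddBorel (A Φ) →
      Martingale (fun (t : ℝ≥0) (ω : S) => Φ (Z t ω) - Φ (Z 0 ω) -
        ∫ s in (0 : ℝ)..t, A Φ (Z s.toNNReal ω)) ℱ P)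
    {c C : ℝ} {s t : ℝ≥0} (hst : s ≤ t) {g : S → ℝ} (hg : Measurable[ℱ s] g)
    (hc : ∀ ω, |g ω| ≤ c) {Φ : Omega → ℝ} (hΦ : LevelFun U C Φ) :
    ∫ ω, g ω * Φ (Z t ω) ∂P = ∫ ω, g ω * expSeries A ((t : ℝ) - s) Φ (Z s ω) ∂P := by
  have hst' : (0 : ℝ) ≤ (t : ℝ) - s := sub_nonneg.2 (by exact_mod_cast hst)
  have h1 := (hA.hasSum_integral hΦ hst' P (measurable_eval hZ s)
    (hg.mono (ℱ.le s) le_rfl) hc).tendsto_sum_nat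
  have h2 : Filter.Tendsto (fun n : ℕ => ∑ k ∈ Finset.range n,
      ((t : ℝ) - s) ^ k / (k.factorial : ℝ) * ∫ ω, g ω * (A^[k] Φ) (Z s ω) ∂P) Filter.atTop
      (nhds (∫ ω, g ω * Φ (Z t ω) ∂P)) := by
    rw [tendsto_iff_dist_tendsto_zero]
    refine squeeze_zero (g := fun n : ℕ => c * C * ((((t : ℝ) - s) * R) ^ n / (n.factorial : ℝ)))
      (fun n => dist_nonneg) (fun n => ?_) ?_
    · rw [dist_comm, Real.dist_eq]
      refine (expectation_taylor hA hZ hmart hg hc n C Φ hΦ t hst).trans (le_of_eq ?_)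
      rw [mul_pow]
      ring
    · simpa using (FloorSemiring.tendsto_pow_div_factorial_atTop (((t : ℝ) - s) * R)).const_mul
        (c * C)
  exact tendsto_nhds_unique h2 h1

end Markov

end CoagFrag

/-! ## Time reversal of finite-dimensional distributions -/

namespace CoagFrag

/-- The times of `l` are nondecreasing and at least `s`. -/
def TimesFrom {E : Type*} (s : ℝ) (l : List (ℝ × (E → ℝ))) : Prop :=
  (∀ p ∈ l, s ≤ p.1) ∧ l.Pairwise fun p q => p.1 ≤ q.1

theorem timesFrom_cons {E : Type*} {s : ℝ} {p : ℝ × (E → ℝ)} {l : List (ℝ × (E → ℝ))} :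
    TimesFrom s (p :: l) ↔ s ≤ p.1 ∧ TimesFrom p.1 l := by
  unfold TimesFrom
  rw [List.pairwise_cons, List.forall_mem_cons]
  constructor
  · rintro ⟨⟨h1, -⟩, h3, h4⟩
    exact ⟨h1, h3, h4⟩
  · rintro ⟨h1, h3, h4⟩
    exact ⟨⟨h1, fun q hq => h1.trans (h3 q hq)⟩, h3, h4⟩

section Chain

variable {E : Type*} [MeasurableSpace E] {A : (E → ℝ) → E → ℝ} {U : Set E} {R : ℝ}
  {μ : Measure E}

/-- `T_{t₁-s} Φ₁ T_{t₂-t₁} Φ₂ ⋯ T_{tₙ-tₙ₋₁} Φₙ 1_U` for `l = [(t₁,Φ₁), …, (tₙ,Φₙ)]`. -/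
noncomputable def chain (A : (E → ℝ) → E → ℝ) (U : Set E) : ℝ → List (ℝ × (E → ℝ)) → E → ℝ
  | _, [] => U.indicator 1
  | s, p :: l => expSeries A (p.1 - s) (p.2 * chain A U p.1 l)

/-- All functions occurring in `l` are bounded and supported in `U`. -/
def AllLevel (U : Set E) (l : List (ℝ × (E → ℝ))) : Prop := ∀ p ∈ l, ∃ C, LevelFun U C p.2

theorem allLevel_cons {p : ℝ × (E → ℝ)} {l : List (ℝ × (E → ℝ))} :
    AllLevel U (p :: l) ↔ (∃ C, LevelFun U C p.2) ∧ AllLevel U l := List.forall_mem_cons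

theorem levelFun_chain (hA : IsLevelOperator A U R μ) (l : List (ℝ × (E → ℝ))) :
    ∀ s, TimesFrom s l → AllLevel U l → ∃ C, LevelFun U C (chain A U s l) := by
  induction l with
  | nil => exact fun s _ _ => ⟨1, hA.indicator⟩
  | cons p l ih =>
    intro s hs hl
    obtain ⟨h1, h2⟩ := timesFrom_cons.1 hs
    obtain ⟨⟨C, hC⟩, h4⟩ := allLevel_cons.1 hl
    obtain ⟨C', hC'⟩ := ih p.1 h2 h4
    exact ⟨_, hA.expSeries (hC.mul hC') (sub_nonneg.2 h1)⟩

theorem LevelFun.mul_indicator {C : ℝ} {Φ : E → ℝ} (hΦ : LevelFun U C Φ) (z : E) :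
    Φ z * U.indicator 1 z = Φ z := by
  by_cases hz : z ∈ U
  · simp [hz]
  · simp [hΦ.supp z hz]

/-- Invariance of μ: symmetry tested against the indicator of `U`, which the semigroup fixes. -/
theorem integral_expSeries [IsFiniteMeasure μ] (hA : IsLevelOperator A U R μ) {C : ℝ}
    {Φ : E → ℝ} (hΦ : LevelFun U C Φ) {h : ℝ} (hh : 0 ≤ h) :
    ∫ z, expSeries A h Φ z ∂μ = ∫ z, Φ z ∂μ := by
  have := hA.expSeries_symm hA.indicator hΦ hh
  rw [hA.expSeries_indicator] at this
  simp_rw [hΦ.mul_indicator, (hA.expSeries hΦ hh).mul_indicator] at this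
  exact this.symm

/-- The left factor accumulates the times already reversed. Symmetry moves the outermost semigroup
of the right-hand chain to the left factor, where it becomes the outermost semigroup of the reversed
chain; the elapsed time agrees since (T - s) - (T - t) = t - s. -/
theorem integral_chain_reverse [IsFiniteMeasure μ] (hA : IsLevelOperator A U R μ) {T : ℝ}
    (l : List (ℝ × (E → ℝ))) : ∀ (s : ℝ) (Φ : E → ℝ) (L : List (ℝ × (E → ℝ))),
      0 ≤ s → s ≤ T → (∃ C, LevelFun U C Φ) → TimesFrom s l → (∀ p ∈ l, p.1 ≤ T) → AllLevel U l →
      TimesFrom (T - s) L → AllLevel U L →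
      ∫ z, Φ z * chain A U (T - s) L z * chain A U s l z ∂μ =
        ∫ z, chain A U 0
          ((l.map fun p => (T - p.1, p.2)).reverse ++ (T - s, Φ) :: L) z ∂μ := by
  induction l with
  | nil =>
    rintro s Φ L hs hsT ⟨C, hC⟩ - - - hL hL'
    obtain ⟨C', hC'⟩ := levelFun_chain hA L _ hL hL'
    simp only [List.map_nil, List.reverse_nil, List.nil_append, chain]
    -- With nothing left on the right, invariance of μ accounts for the semigroup between time 0 and
    -- the first reversed time.
    rw [integral_expSeries hA (hC.mul hC') (by linarith)]
    exact integral_congr_ae (Filter.Eventually.of_forall fun z => (hC.mul hC').mul_indicator z)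
  | cons p l ih =>
    rintro s Φ L hs hsT ⟨C, hC⟩ hl hlT hl' hL hL'
    obtain ⟨h1, h2⟩ := timesFrom_cons.1 hl
    obtain ⟨⟨D, hD⟩, h4⟩ := allLevel_cons.1 hl'
    obtain ⟨hpT, hlT⟩ := List.forall_mem_cons.1 hlT
    obtain ⟨C', hC'⟩ := levelFun_chain hA L _ hL hL'
    obtain ⟨D', hD'⟩ := levelFun_chain hA l _ h2 h4
    have := ih p.1 p.2 ((T - s, Φ) :: L) (hs.trans h1) hpT ⟨D, hD⟩ h2 hlT h4
      (timesFrom_cons.2 ⟨sub_le_sub_left h1 T, hL⟩) (allLevel_cons.2 ⟨⟨C, hC⟩, hL'⟩)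
    rw [List.map_cons, List.reverse_cons, List.append_assoc, List.singleton_append, ← this]
    simp only [chain]
    have key := hA.expSeries_symm (hD.mul hD') (hC.mul hC') (sub_nonneg.2 h1)
    simp only [Pi.mul_apply] at key
    rw [key]
    congr 1
    funext z
    rw [show T - s - (T - p.1) = p.1 - s by ring]
    ring

theorem integral_chain_eq_reverse [IsFiniteMeasure μ] (hA : IsLevelOperator A U R μ) {T : ℝ}
    {l : List (ℝ × (E → ℝ))} (hl : TimesFrom 0 l) (hlT : ∀ p ∈ l, p.1 ≤ T) (hl' : AllLevel U l) :
    ∫ z, chain A U 0 l z ∂μ =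
      ∫ z, chain A U 0 ((l.map fun p => (T - p.1, p.2)).reverse) z ∂μ := by
  cases l with
  | nil => rfl
  | cons p l =>
    obtain ⟨h1, h2⟩ := timesFrom_cons.1 hl
    obtain ⟨⟨D, hD⟩, h4⟩ := allLevel_cons.1 hl'
    obtain ⟨hpT, hlT⟩ := List.forall_mem_cons.1 hlT
    obtain ⟨D', hD'⟩ := levelFun_chain hA l _ h2 h4
    rw [List.map_cons, List.reverse_cons, ← integral_chain_reverse hA l p.1 p.2 [] h1 hpT ⟨D, hD⟩
      h2 hlT h4 ⟨by simp, by simp⟩ (by simp [AllLevel])]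
    simp only [chain]
    rw [integral_expSeries hA (hD.mul hD') (by linarith)]
    congr 1
    funext z
    rw [hD.mul_indicator]
    rfl

end Chain

section Reversal

variable {A : (Omega → ℝ) → Omega → ℝ} {U : Set Omega} {R : ℝ} {μ : Measure Omega}
  {S : Type u} [mS : MeasurableSpace S] {P : Measure S} {Z : ℝ≥0 → S → Omega}

/-- Times are peeled off one by one, and factors already evaluated are absorbed in `g`, which stays
measurable with respect to the past. The final indicator is carried to the fixed time `T`, so that
the same event `Z T ∈ U` appears for a family of times and for its reversal. -/
theorem expectation_chain [IsProbabilityMeasure P] (hA : IsLevelOperator A U R μ)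
    (hZ : Measurable fun p : ℝ≥0 × S => Z p.1 p.2) {ℱ : Filtration ℝ≥0 mS}
    (hadapt : ∀ t, Measurable[ℱ t] (Z t))
    (hmart : ∀ Φ : Omega → ℝ, BddBorel Φ → BddBorel (A Φ) →
      Martingale (fun (t : ℝ≥0) (ω : S) => Φ (Z t ω) - Φ (Z 0 ω) -
        ∫ s in (0 : ℝ)..t, A Φ (Z s.toNNReal ω)) ℱ P) {T : ℝ≥0}
    (l : List (ℝ × (Omega → ℝ))) : ∀ (s : ℝ≥0) (c : ℝ) (g : S → ℝ), s ≤ T →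
      Measurable[ℱ s] g → (∀ ω, |g ω| ≤ c) → TimesFrom (s : ℝ) l → (∀ p ∈ l, p.1 ≤ T) →
      AllLevel U l →
      ∫ ω, g ω * chain A U s l (Z s ω) ∂P =
        ∫ ω, g ω * ((l.map fun p => p.2 (Z p.1.toNNReal ω)).prod *
          U.indicator 1 (Z T ω)) ∂P := by
  induction l with
  | nil =>
    intro s c g hsT hg hc _ _ _
    simp only [chain, List.map_nil, List.prod_nil, one_mul]
    rw [expectation_expSeries hA hZ hmart hsT hg hc hA.indicator, hA.expSeries_indicator]
  | cons p l ih =>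
    intro s c g hsT hg hc hl hlT hl'
    obtain ⟨h1, h2⟩ := timesFrom_cons.1 hl
    obtain ⟨⟨D, hD⟩, h4⟩ := allLevel_cons.1 hl'
    obtain ⟨hpT, hlT⟩ := List.forall_mem_cons.1 hlT
    obtain ⟨D', hD'⟩ := levelFun_chain hA l _ h2 h4
    obtain ⟨t, ht⟩ : ∃ t : ℝ≥0, (t : ℝ) = p.1 := ⟨⟨p.1, s.2.trans h1⟩, rfl⟩
    have hst : s ≤ t := by rw [← NNReal.coe_le_coe, ht]; exact h1
    simp only [chain, List.map_cons, List.prod_cons]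
    rw [← ht, Real.toNNReal_coe,
      ← expectation_expSeries hA hZ hmart hst hg hc (ht ▸ hD.mul hD')]
    have := ih t (c * D) (fun ω => g ω * p.2 (Z t ω)) (by rw [← NNReal.coe_le_coe, ht]; exact hpT)
      ((hg.mono (ℱ.mono hst) le_rfl).mul (hD.measurable.comp (hadapt t)))
      (fun ω => abs_mul_levelFun_le hD hc _ ω) (ht ▸ h2) hlT h4
    simp only [Pi.mul_apply, ← mul_assoc] at this ⊢
    exact this

theorem measurable_path (hZ : Measurable fun p : ℝ≥0 × S => Z p.1 p.2) {n : ℕ} (t : Fin n → ℝ≥0) :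
    Measurable fun ω i => Z (t i) ω := measurable_pi_lambda _ fun i => measurable_eval hZ (t i)

/-- A martingale problem that restricts, on an exhausting sequence of level sets, to bounded
operators symmetric with respect to `μ` has reversible solutions when started from `μ`. -/
theorem isReversible_of_levelOperators {V : ℕ → Set Omega} (hV : Monotone V)
    (hVu : ⋃ m, V m = Set.univ) (hA : ∀ m, ∃ R, IsLevelOperator A (V m) R μ) :
    IsReversible.{u} A μ := by
  intro S _ P _ Z ⟨hZ, ℱ, hadapt, hmart⟩ hμ n T t ht
  have : IsProbabilityMeasure μ := by
    rw [← hμ]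
    exact Measure.isProbabilityMeasure_map (measurable_eval hZ 0).aemeasurable
  have hVm : ∀ m, MeasurableSet (V m) := fun m => (hA m).choose_spec.measurableSet
  have hprob : ∀ t : Fin n → ℝ≥0, IsProbabilityMeasure (P.map fun ω i => Z (t i) ω) := fun t =>
    Measure.isProbabilityMeasure_map (measurable_path hZ t).aemeasurable
  have hlist : ∀ (m : ℕ) (l : List (ℝ × (Omega → ℝ))), TimesFrom 0 l → (∀ p ∈ l, p.1 ≤ T) →
      AllLevel (V m) l → ∫ z, chain A (V m) 0 l z ∂μ =
        ∫ ω, ((l.map fun p => p.2 (Z p.1.toNNReal ω)).prod * (V m).indicator 1 (Z T ω)) ∂P := by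
    intro m l hl hlT hl'
    obtain ⟨R, hR⟩ := hA m
    obtain ⟨C, hC⟩ := levelFun_chain hR l _ hl hl'
    rw [← hμ, integral_map (measurable_eval hZ 0).aemeasurable hC.measurable.aestronglyMeasurable]
    have := expectation_chain hR hZ hadapt hmart (T := T) l 0 1 (fun _ => 1) (zero_le)
      measurable_const (by simp) (by simpa using hl) hlT hl'
    simpa using this
  -- the identity of the probabilities of rectangles inside the level sets
  have hrect : ∀ (m : ℕ) (B : Fin n → Set Omega), (∀ i, MeasurableSet (B i)) →
      P ({ω | ∀ i, Z (t i) ω ∈ B i ∩ V m} ∩ {ω | Z T ω ∈ V m}) =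
        P ({ω | ∀ i, Z (T - t i) ω ∈ B i ∩ V m} ∩ {ω | Z T ω ∈ V m}) := by
    intro m B hB
    obtain ⟨R, hR⟩ := hA m
    -- Chains need ordered times. Once the times are sorted, the reversed list is sorted too, and
    -- the products over all indices do not see the order.
    set σ := Tuple.sort t
    set l : List (ℝ × (Omega → ℝ)) :=
      List.ofFn fun i => ((t (σ i) : ℝ), (B (σ i) ∩ V m).indicator 1) with hl
    have h1 : TimesFrom 0 l := by
      refine ⟨?_, ?_⟩
      · simp [hl, List.mem_ofFn']
      · rw [hl, List.pairwise_ofFn]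
        intro i j hij
        exact_mod_cast Tuple.monotone_sort t hij.le
    have h2 : ∀ p ∈ l, p.1 ≤ T := by
      simp only [hl, List.mem_ofFn', Set.mem_range, forall_exists_index]
      rintro _ i rfl
      exact_mod_cast ht _
    have h3 : AllLevel (V m) l := by
      intro p hp
      simp only [hl, List.mem_ofFn', Set.mem_range] at hp
      obtain ⟨i, rfl⟩ := hp
      exact ⟨1, levelFun_indicator ((hB _).inter (hVm m)) Set.inter_subset_right⟩
    have h4 := integral_chain_eq_reverse hR h1 h2 h3
    rw [hlist m l h1 h2 h3, hlist m] at h4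
    · have key : ∀ r : Fin n → ℝ≥0,
          ∫ ω, (∏ i, (B (σ i) ∩ V m).indicator (1 : Omega → ℝ) (Z (r (σ i)) ω)) *
            (V m).indicator 1 (Z T ω) ∂P =
          (P ({ω | ∀ i, Z (r i) ω ∈ B i ∩ V m} ∩ {ω | Z T ω ∈ V m})).toReal := fun r => by
        rw [← Measure.real, ← integral_indicator_one]
        · congr 1
          funext ω
          rw [Equiv.prod_comp σ fun i => (B i ∩ V m).indicator (1 : Omega → ℝ) (Z (r i) ω)]
          by_cases hT : Z T ω ∈ V m
          · by_cases h : ∀ i, Z (r i) ω ∈ B i ∩ V m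
            · have : ω ∈ {ω | ∀ i, Z (r i) ω ∈ B i ∩ V m} ∩ {ω | Z T ω ∈ V m} := ⟨h, hT⟩
              rw [Set.indicator_of_mem this, Set.indicator_of_mem hT,
                Finset.prod_eq_one fun i _ => Set.indicator_of_mem (h i) _]
              simp
            · have : ω ∉ {ω | ∀ i, Z (r i) ω ∈ B i ∩ V m} ∩ {ω | Z T ω ∈ V m} := fun h' => h h'.1
              rw [Set.indicator_of_notMem this]
              push Not at h
              obtain ⟨i, hi⟩ := h
              rw [Finset.prod_eq_zero (Finset.mem_univ i) (Set.indicator_of_notMem hi _), zero_mul]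
          · have : ω ∉ {ω | ∀ i, Z (r i) ω ∈ B i ∩ V m} ∩ {ω | Z T ω ∈ V m} := fun h' => hT h'.2
            rw [Set.indicator_of_notMem this, Set.indicator_of_notMem hT, mul_zero]
        · refine MeasurableSet.inter ?_ (measurable_eval hZ T (hVm m))
          rw [Set.ofPred_forall]
          exact MeasurableSet.iInter fun i => measurable_eval hZ (r i) ((hB i).inter (hVm m))
      have e1 := key t
      have e2 := key fun i => T - t i
      rw [← ENNReal.toReal_eq_toReal_iff' (measure_ne_top _ _) (measure_ne_top _ _), ← e1, ← e2]
      simp only [List.map_reverse, List.prod_reverse, hl, List.map_ofFn, List.prod_ofFn,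
        Function.comp_def, Real.toNNReal_coe] at h4
      refine h4.trans ?_
      have e3 : ∀ i, ((T : ℝ) - t (σ i)).toNNReal = T - t (σ i) := fun i => by
        rw [← NNReal.coe_sub (ht _), Real.toNNReal_coe]
      simp_rw [e3]
    · refine ⟨?_, ?_⟩
      · simp only [List.mem_reverse, List.mem_map]
        rintro _ ⟨p, hp, rfl⟩
        exact sub_nonneg.2 (h2 p hp)
      · rw [List.pairwise_reverse, List.pairwise_map]
        exact h1.2.imp fun h => sub_le_sub_left h _
    · simp only [List.mem_reverse, List.mem_map]
      rintro _ ⟨p, hp, rfl⟩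
      simpa using h1.1 p hp
    · simp only [AllLevel, List.mem_reverse, List.mem_map]
      rintro _ ⟨p, hp, rfl⟩
      exact h3 p hp
  have := hprob t
  refine ext_of_generate_finite _ generateFrom_pi.symm isPiSystem_pi ?_ ?_
  · rintro _ ⟨B, hB, rfl⟩
    have hB : ∀ i, MeasurableSet (B i) := fun i => hB i trivial
    -- Finitely many states lie in a common level set, so the restrictions to `V m` disappear as m
    -- grows.
    have hlim : ∀ r : Fin n → ℝ≥0, (P.map fun ω i => Z (r i) ω) (Set.pi Set.univ B) =
        ⨆ m, P ({ω | ∀ i, Z (r i) ω ∈ B i ∩ V m} ∩ {ω | Z T ω ∈ V m}) := fun r => by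
      rw [Measure.map_apply (measurable_path hZ r) (MeasurableSet.univ_pi hB),
        ← Monotone.measure_iUnion]
      · congr 1
        ext ω
        simp only [Set.mem_preimage, Set.mem_pi, Set.mem_univ, true_implies, Set.mem_iUnion,
          Set.mem_inter_iff, Set.mem_ofPred_eq]
        constructor
        · intro h
          have hex : ∀ z, ∃ m, z ∈ V m := fun z => by
            simpa using (hVu ▸ Set.mem_univ z : z ∈ ⋃ m, V m)
          choose N hN using hex
          refine ⟨(Finset.univ.sup fun i => N (Z (r i) ω)) + N (Z T ω), fun i => ⟨h i, ?_⟩, ?_⟩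
          · exact hV ((Finset.le_sup (f := fun i => N (Z (r i) ω)) (Finset.mem_univ i)).trans
              (Nat.le_add_right _ _)) (hN _)
          · exact hV (Nat.le_add_left _ _) (hN _)
        · rintro ⟨m, h, -⟩ i
          exact (h i).1
      · intro a b hab ω h
        exact ⟨fun i => ⟨(h.1 i).1, hV hab (h.1 i).2⟩, hV hab h.2⟩
    rw [hlim t, hlim fun i => T - t i]
    exact iSup_congr fun m => hrect m B hB
  · have := hprob fun i => T - t i
    rw [measure_univ, measure_univ]

end Reversal

end CoagFrag

/-! ## Ranked sequences and point configurations -/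

namespace CoagFrag

theorem tsum_ite_lt_eq_encard (w : ℕ → ℝ) (t : ℝ) :
    ∑' i, (Set.Iio (w i)).indicator (1 : ℝ → ℝ≥0∞) t = (({i | t < w i}.encard : ℕ∞) : ℝ≥0∞) := by
  have h : ∀ i, (Set.Iio (w i)).indicator (1 : ℝ → ℝ≥0∞) t =
      ({i | t < w i}).indicator (fun _ => (1 : ℝ≥0∞)) i := by
    intro i
    by_cases h : t < w i <;> simp [h]
  simp_rw [h]
  rw [← tsum_subtype]
  simp

theorem measurable_decr {α : Type*} [MeasurableSpace α] {w : α → ℕ → ℝ}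
    (hw : ∀ i, Measurable fun a => w a i) (h0 : ∀ a i, 0 ≤ w a i) (hs : ∀ a, Summable (w a))
    (n : ℕ) : Measurable fun a => decr (w a) n := by
  refine measurable_of_Ioi fun t => ?_
  rcases lt_or_ge t 0 with ht | ht
  · convert MeasurableSet.univ
    ext a
    simpa using ht.trans_le (decr_nonneg _ _)
  · have h1 : Measurable fun a => ∑' i, (Set.Iio (w a i)).indicator (1 : ℝ → ℝ≥0∞) t := by
      refine Measurable.tsum fun i => ?_
      have : (fun a => (Set.Iio (w a i)).indicator (1 : ℝ → ℝ≥0∞) t) =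
          {a | t < w a i}.indicator 1 := by
        funext a
        by_cases h : t < w a i <;> simp [h]
      rw [this]
      exact measurable_one.indicator (measurableSet_lt measurable_const (hw i))
    convert h1 (measurableSet_Ioi (a := (n : ℝ≥0∞))) using 1
    ext a
    simp only [Set.mem_preimage, Set.mem_Ioi]
    rw [lt_decr_iff (h0 a) (hs a) n ht, tsum_ite_lt_eq_encard, ← ENat.toENNReal_coe,
      ENat.toENNReal_lt]

theorem eq_of_forall_lt_iff {a b : ℝ} (ha : 0 ≤ a) (hb : 0 ≤ b)
    (h : ∀ t, 0 ≤ t → (t < a ↔ t < b)) : a = b := by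
  refine le_antisymm (not_lt.1 fun hlt => ?_) (not_lt.1 fun hlt => ?_)
  · exact lt_irrefl _ ((h b hb).1 hlt)
  · exact lt_irrefl _ ((h a ha).2 hlt)

/-- For a nonincreasing sequence, the indices of the entries above t form an initial segment. -/
theorem decr_eq_self {z : ℕ → ℝ} (hz : Antitone z) (h0 : ∀ i, 0 ≤ z i) (hs : Summable z) :
    decr z = z := by
  funext n
  refine eq_of_forall_lt_iff (decr_nonneg _ _) (h0 n) fun t ht => ?_
  rw [lt_decr_iff h0 hs n ht]
  constructor
  · intro h
    by_contra hn
    have hsub : {i | t < z i} ⊆ ((Finset.range n : Finset ℕ) : Set ℕ) := fun i hi => by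
      rw [Finset.mem_coe, Finset.mem_range]
      by_contra hin
      exact hn (lt_of_lt_of_le hi (hz (not_lt.1 hin)))
    have := (Set.encard_le_encard hsub)
    rw [Set.encard_coe_eq_coe_finsetCard, Finset.card_range] at this
    exact absurd h (not_lt.2 this)
  · intro h
    have hsub : ((Finset.range (n + 1) : Finset ℕ) : Set ℕ) ⊆ {i | t < z i} := fun i hi => by
      rw [Finset.mem_coe, Finset.mem_range] at hi
      exact lt_of_lt_of_le h (hz (Nat.lt_succ_iff.1 hi))
    have := (Set.encard_le_encard hsub)
    rw [Set.encard_coe_eq_coe_finsetCard, Finset.card_range] at this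
    exact lt_of_lt_of_le (by exact_mod_cast Nat.lt_succ_self n) this

theorem decr_omega (z : Omega) : decr z.1 = z.1 := decr_eq_self z.2.1 z.2.2.1 z.2.2.2.1

open Classical in
/-- The counting measure `∑_{wᵢ > 0} δ_{wᵢ}` of the positive entries of a sequence. -/
noncomputable def pointMeasure (w : ℕ → ℝ) : Measure ℝ :=
  Measure.sum fun i => if 0 < w i then Measure.dirac (w i) else 0

theorem Xi_val (z : Omega) : (Xi z).1 = pointMeasure z.1 := rfl

theorem lintegral_pointMeasure (w : ℕ → ℝ) (f : ℝ → ℝ≥0∞) :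
    ∫⁻ x, f x ∂pointMeasure w = ∑' i, (Set.Ioi 0).indicator f (w i) := by
  rw [pointMeasure, lintegral_sum_measure]
  refine tsum_congr fun i => ?_
  split_ifs with h <;> simp [h]

theorem pointMeasure_apply (w : ℕ → ℝ) {B : Set ℝ} (hB : MeasurableSet B) :
    pointMeasure w B = ∑' i, (Set.Ioi 0).indicator (B.indicator 1) (w i) := by
  rw [← lintegral_indicator_one hB, lintegral_pointMeasure]

theorem pointMeasure_Iic (w : ℕ → ℝ) : pointMeasure w (Set.Iic 0) = 0 := by
  rw [pointMeasure_apply _ measurableSet_Iic, ENNReal.tsum_eq_zero]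
  intro i
  by_cases h : 0 < w i <;> simp [h]

theorem pointMeasure_Ioi (w : ℕ → ℝ) {t : ℝ} (ht : 0 ≤ t) :
    pointMeasure w (Set.Ioi t) = (({i | t < w i}.encard : ℕ∞) : ℝ≥0∞) := by
  rw [pointMeasure_apply _ measurableSet_Ioi, ← tsum_ite_lt_eq_encard]
  refine tsum_congr fun i => ?_
  by_cases h : t < w i
  · simp [h, ht.trans_lt h]
  · by_cases h' : 0 < w i <;> simp [h, h']

theorem encard_lt_ne_top {w : ℕ → ℝ} (hs : Summable w) {t : ℝ} (ht : 0 < t) :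
    {i | t < w i}.encard ≠ ⊤ := by
  have h1 : ∀ᶠ i in Filter.cofinite, w i < t := hs.tendsto_cofinite_zero.eventually_lt_const ht
  rw [Set.encard_ne_top_iff]
  refine Set.Finite.subset (Filter.eventually_cofinite.1 h1) fun i hi => ?_
  exact not_lt.2 (le_of_lt hi)

theorem pointMeasure_Ioi_ne_top {w : ℕ → ℝ} (hs : Summable w) {t : ℝ} (ht : 0 < t) :
    pointMeasure w (Set.Ioi t) ≠ ∞ := by
  rw [pointMeasure_Ioi w ht.le]
  simpa using encard_lt_ne_top hs ht

/-- Measures on `(0,∞)` that are finite away from `0` are determined by their values on the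
intervals `(q,∞)` with rational `q`. -/
theorem measure_ext_Ioi {η ζ : Measure ℝ} (hη : η (Set.Iic 0) = 0) (hζ : ζ (Set.Iic 0) = 0)
    (hfin : ∀ t, 0 < t → ζ (Set.Ioi t) ≠ ∞)
    (h : ∀ q : ℚ, 0 < q → η (Set.Ioi (q : ℝ)) = ζ (Set.Ioi (q : ℝ))) : η = ζ := by
  -- Away from 0 the measures are finite, and the rational half-lines form a generating π-system.
  have hres : ∀ q : ℚ, 0 < q → η.restrict (Set.Ioi (q : ℝ)) = ζ.restrict (Set.Ioi (q : ℝ)) := by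
    intro q hq
    have hq' : (0 : ℝ) < q := by exact_mod_cast hq
    have : IsFiniteMeasure (η.restrict (Set.Ioi (q : ℝ))) :=
      ⟨by rw [Measure.restrict_apply_univ, h q hq]; exact (hfin _ hq').lt_top⟩
    refine ext_of_generate_finite _ Real.borel_eq_generateFrom_Ioi_rat
      Real.isPiSystem_Ioi_rat ?_ ?_
    · intro s hs
      obtain ⟨r, rfl⟩ := Set.mem_iUnion.1 hs
      rw [Measure.restrict_apply measurableSet_Ioi, Measure.restrict_apply measurableSet_Ioi,
        Set.Ioi_inter_Ioi]
      have := h (r ⊔ q) (lt_of_lt_of_le hq le_sup_right)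
      push_cast at this
      exact this
    · rw [Measure.restrict_apply_univ, Measure.restrict_apply_univ, h q hq]
  have hU : (⋃ k : ℕ, Set.Ioi (((1 / (k + 1) : ℚ)) : ℝ)) = Set.Ioi 0 := by
    ext x
    simp only [Set.mem_iUnion, Set.mem_Ioi]
    constructor
    · rintro ⟨k, hk⟩
      exact lt_trans (by push_cast; positivity) hk
    · intro hx
      obtain ⟨k, hk⟩ := exists_nat_one_div_lt hx
      exact ⟨k, by push_cast; exact hk⟩
  have hpos : η.restrict (Set.Ioi 0) = ζ.restrict (Set.Ioi 0) := by
    rw [← hU]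
    exact Measure.restrict_iUnion_congr.2 fun k => hres _ (by positivity)
  ext B hB
  have hsplit : ∀ ν : Measure ℝ, ν (Set.Iic 0) = 0 → ν B = ν.restrict (Set.Ioi 0) B := by
    intro ν hν
    rw [Measure.restrict_apply hB]
    refine le_antisymm ?_ (measure_mono Set.inter_subset_left)
    calc ν B ≤ ν (B ∩ Set.Ioi 0) + ν (Set.Iic 0) := by
          refine (measure_mono fun x hx => ?_).trans (measure_union_le _ _)
          rcases lt_or_ge 0 x with h | h
          · exact Or.inl ⟨hx, h⟩
          · exact Or.inr h
      _ = _ := by rw [hν, add_zero]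
  rw [hsplit η hη, hsplit ζ hζ, hpos]

/-- Ranking preserves the number of entries above each level, and these numbers determine the
configuration. -/
theorem pointMeasure_decr {w : ℕ → ℝ} (h0 : ∀ i, 0 ≤ w i) (hs : Summable w) :
    pointMeasure (decr w) = pointMeasure w := by
  refine measure_ext_Ioi (pointMeasure_Iic _) (pointMeasure_Iic _)
    (fun t ht => pointMeasure_Ioi_ne_top hs ht) fun q hq => ?_
  have hq' : (0 : ℝ) ≤ q := by exact_mod_cast hq.le
  rw [pointMeasure_Ioi _ hq', pointMeasure_Ioi _ hq']
  have : {n : ℕ | (q : ℝ) < decr w n} = {n : ℕ | (n : ℕ∞) < {i : ℕ | (q : ℝ) < w i}.encard} := by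
    ext n
    exact lt_decr_iff h0 hs n hq'
  rw [this, encard_lt_set]

theorem decr_eq_of_pointMeasure {w w' : ℕ → ℝ} (h0 : ∀ i, 0 ≤ w i) (hs : Summable w)
    (h0' : ∀ i, 0 ≤ w' i) (hs' : Summable w') (h : pointMeasure w = pointMeasure w') :
    decr w = decr w' := by
  funext n
  refine eq_of_forall_lt_iff (decr_nonneg _ _) (decr_nonneg _ _) fun t ht => ?_
  rw [lt_decr_iff h0 hs n ht, lt_decr_iff h0' hs' n ht]
  have := congrArg (fun ν => ν (Set.Ioi t)) h
  simp only [pointMeasure_Ioi _ ht] at this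
  rw [ENat.toENNReal_inj.1 this]

theorem Xi_rank (w : ℕ → ℝ) (h0 : ∀ i, 0 ≤ w i) (hs : Summable w) (hp : 0 < ∑' n, w n) :
    (Xi (rank w h0 hs hp)).1 = pointMeasure w := pointMeasure_decr h0 hs

/-- An element of Ω is its own ranking, and a ranking can be read off from the configuration. Hence
identities between states may be checked on point measures. -/
theorem Xi_injective : Function.Injective Xi := by
  intro z z' h
  apply Subtype.ext
  rw [← decr_omega z, ← decr_omega z']
  exact decr_eq_of_pointMeasure z.2.2.1 z.2.2.2.1 z'.2.2.1 z'.2.2.2.1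
    (congrArg Subtype.val h)

theorem omega_ext {z z' : Omega} (h : pointMeasure z.1 = pointMeasure z'.1) : z = z' :=
  Xi_injective (Subtype.ext h)

/-- A unit mass is finite and so cancels even where the measures are infinite. Configurations are
compared by adding points on both sides rather than by removing them. -/
theorem add_dirac_cancel {η ζ : Measure ℝ} {x : ℝ}
    (h : η + Measure.dirac x = ζ + Measure.dirac x) : η = ζ := by
  ext B hB
  have := congrArg (fun ν => ν B) h
  simp only [Measure.add_apply] at this
  refine (ENNReal.add_left_inj (measure_ne_top (Measure.dirac x) B)).1 this

/-! ### Point measures of merged and split sequences -/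

/-- The additive form avoids truncated subtraction in `ℝ≥0∞`. -/
theorem tsum_update_add {β : Type*} [DecidableEq β] (f : ℝ → ℝ≥0∞) (w : β → ℝ) (i : β) (a : ℝ) :
    ∑' n, f (Function.update w i a n) + f (w i) = ∑' n, f (w n) + f a := by
  have h1 := ENNReal.tsum_eq_add_tsum_ite (f := fun n => f (Function.update w i a n)) i
  have h2 := ENNReal.tsum_eq_add_tsum_ite (f := fun n => f (w n)) i
  have h3 : ∑' n, (if n = i then 0 else f (Function.update w i a n)) =
      ∑' n, if n = i then 0 else f (w n) := tsum_congr fun n => by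
    by_cases h : n = i <;> simp [h]
  rw [h1, h2, Function.update_self]
  convert_to f a + (∑' n, if n = i then 0 else f (w n)) + f (w i) = _
  · congr 2
    convert h3
  · rw [add_comm, add_comm (f a), ← add_assoc]
    congr!

theorem pointMeasure_mergeSeq {w : ℕ → ℝ} {i j : ℕ} (hij : i ≠ j) (hi : 0 < w i) (hj : 0 < w j) :
    pointMeasure (mergeSeq w i j) + Measure.dirac (w i) + Measure.dirac (w j) =
      pointMeasure w + Measure.dirac (w i + w j) := by
  ext B hB
  simp only [Measure.add_apply, pointMeasure_apply _ hB, Measure.dirac_apply' _ hB]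
  set f : ℝ → ℝ≥0∞ := (Set.Ioi 0).indicator (B.indicator 1) with hf
  have h1 := tsum_update_add f w i (w i + w j)
  have h2 := tsum_update_add f (Function.update w i (w i + w j)) j 0
  rw [Function.update_of_ne hij.symm] at h2
  have e : ∀ x, 0 < x → B.indicator (1 : ℝ → ℝ≥0∞) x = f x := fun x hx => by
    rw [hf, Set.indicator_of_mem (show x ∈ Set.Ioi 0 from hx)]
  have e0 : f 0 = 0 := by simp [hf]
  rw [e _ hi, e _ hj, e _ (add_pos hi hj)]
  rw [e0, add_zero] at h2
  unfold mergeSeq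
  rw [add_right_comm, h2, h1]

theorem pointMeasure_splitSeq {w : ℕ → ℝ} {i : ℕ} {y : ℝ} (hy : 0 < y) (hyi : y < w i) :
    pointMeasure (splitSeq w i y) + Measure.dirac (w i) =
      pointMeasure w + Measure.dirac y + Measure.dirac (w i - y) := by
  ext B hB
  simp only [Measure.add_apply, pointMeasure_apply _ hB, Measure.dirac_apply' _ hB]
  set f : ℝ → ℝ≥0∞ := (Set.Ioi 0).indicator (B.indicator 1) with hf
  have h1 := tsum_update_add f w i y
  have e : ∀ x, 0 < x → B.indicator (1 : ℝ → ℝ≥0∞) x = f x := fun x hx => by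
    rw [hf, Set.indicator_of_mem (show x ∈ Set.Ioi 0 from hx)]
  rw [e _ hy, e _ (hy.trans hyi), e _ (sub_pos.2 hyi), ← h1,
    tsum_eq_zero_add' (f := fun n => f (splitSeq w i y n)) ENNReal.summable]
  simp only [splitSeq]
  ring

/-- The default case is covered as well, since ranking fixes elements of Ω; a single formula for all
arguments gives measurability. -/
theorem merge_val (z : Omega) (i j : ℕ) :
    (merge z i j).1 = decr (if i ≠ j then mergeSeq z.1 i j else z.1) := by
  unfold merge
  split_ifs
  · rfl
  · exact (decr_omega z).symm

open Classical in
theorem split_val (z : Omega) (i : ℕ) (y : ℝ) :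
    (split z i y).1 = decr (if 0 ≤ y ∧ y ≤ z.1 i then splitSeq z.1 i y else z.1) := by
  unfold split
  split_ifs
  · rfl
  · exact (decr_omega z).symm

theorem Xi_merge {z : Omega} {i j : ℕ} (hij : i ≠ j) (hi : 0 < z.1 i) (hj : 0 < z.1 j) :
    pointMeasure (merge z i j).1 + Measure.dirac (z.1 i) + Measure.dirac (z.1 j) =
      pointMeasure z.1 + Measure.dirac (z.1 i + z.1 j) := by
  rw [← pointMeasure_mergeSeq hij hi hj, ← Xi_val, merge, dif_pos hij, Xi_rank]

theorem Xi_split {z : Omega} {i : ℕ} {y : ℝ} (hy : 0 < y) (hyi : y < z.1 i) :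
    pointMeasure (split z i y).1 + Measure.dirac (z.1 i) =
      pointMeasure z.1 + Measure.dirac y + Measure.dirac (z.1 i - y) := by
  rw [← pointMeasure_splitSeq hy hyi, ← Xi_val, split, dif_pos ⟨hy.le, hyi.le⟩, Xi_rank]

theorem mass_merge (z : Omega) (i j : ℕ) : mass (merge z i j) = mass z := by
  unfold merge
  split_ifs with h
  · rw [mass_rank]
    exact (hasSum_mergeSeq z.2.2.2.1.hasSum h).tsum_eq
  · rfl

theorem mass_split (z : Omega) (i : ℕ) (y : ℝ) : mass (split z i y) = mass z := by
  unfold split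
  split_ifs with h
  · rw [mass_rank]
    exact (hasSum_splitSeq z.2.2.2.1.hasSum i y).tsum_eq
  · rfl

theorem exists_entry_of_dirac {w : ℕ → ℝ} {x : ℝ} {η : Measure ℝ}
    (h : pointMeasure w = η + Measure.dirac x) : ∃ i, w i = x := by
  by_contra hn
  push Not at hn
  have h1 : pointMeasure w {x} = 0 := by
    rw [pointMeasure_apply _ (measurableSet_singleton x), ENNReal.tsum_eq_zero]
    intro i
    by_cases h : 0 < w i <;> simp [h, hn i]
  rw [h, Measure.add_apply, Measure.dirac_apply_of_mem (Set.mem_singleton x)] at h1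
  simp at h1

/-- If the configuration of `z` is `η + δ_x + δ_y`, then `x` and `y` are entries of `z` with
different indices. -/
theorem exists_entries_of_dirac {w : ℕ → ℝ} {x y : ℝ} (hx : 0 < x) {η : Measure ℝ}
    (h : pointMeasure w = η + Measure.dirac x + Measure.dirac y) :
    ∃ i j, i ≠ j ∧ w i = x ∧ w j = y := by
  obtain ⟨i, hi⟩ : ∃ i, w i = x := exists_entry_of_dirac (by rw [h, add_right_comm])
  -- Overwriting one entry by 0 removes exactly one point, so the index found next differs from `i`
  -- even when `x = y`.
  have h2 : pointMeasure (Function.update w i 0) = η + Measure.dirac y := by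
    apply add_dirac_cancel (x := x)
    rw [add_right_comm, ← h]
    ext B hB
    simp only [Measure.add_apply, pointMeasure_apply _ hB, Measure.dirac_apply' _ hB]
    have h1 := tsum_update_add ((Set.Ioi 0).indicator (B.indicator 1) : ℝ → ℝ≥0∞) w i 0
    rw [hi, Set.indicator_of_mem (show x ∈ Set.Ioi 0 from hx)] at h1
    rw [h1]
    simp
  by_cases hy : 0 < y
  · obtain ⟨j, hj⟩ := exists_entry_of_dirac h2
    have hij : i ≠ j := by
      rintro rfl
      rw [Function.update_self] at hj
      exact hy.ne hj
    exact ⟨i, j, hij, hi, by rwa [Function.update_of_ne hij.symm] at hj⟩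
  -- A point measure does not charge (-∞, 0], so `y ≤ 0` is impossible.
  · exfalso
    have h3 := pointMeasure_Iic w
    rw [h, Measure.add_apply, Measure.dirac_apply_of_mem (show y ∈ Set.Iic 0 from not_lt.1 hy)]
      at h3
    simp at h3

/-! ### Measurability -/

theorem measurable_entry (i : ℕ) : Measurable fun z : Omega => z.1 i :=
  (measurable_pi_apply i).comp measurable_subtype_coe

theorem measurable_to_omega {α : Type*} [MeasurableSpace α] {f : α → Omega}
    (h : ∀ i, Measurable fun a => (f a).1 i) : Measurable f :=
  (measurable_pi_lambda _ h).subtype_mk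

theorem measurable_merge (i j : ℕ) : Measurable fun z : Omega => merge z i j := by
  refine measurable_to_omega fun n => ?_
  simp_rw [merge_val]
  by_cases hij : i = j
  · subst hij
    simp only [ne_eq, not_true_eq_false, if_false]
    simp_rw [decr_omega]
    exact measurable_entry n
  · simp only [ne_eq, hij, not_false_eq_true, if_true]
    refine measurable_decr (fun k => ?_) (fun z k => ?_) (fun z => ?_) n
    · unfold mergeSeq
      simp only [Function.update_apply]
      split_ifs
      · exact measurable_const
      · exact (measurable_entry i).add (measurable_entry j)
      · exact measurable_entry k
    · unfold mergeSeq
      simp only [Function.update_apply]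
      split_ifs
      · exact le_rfl
      · exact add_nonneg (z.2.2.1 i) (z.2.2.1 j)
      · exact z.2.2.1 k
    · exact (hasSum_mergeSeq z.2.2.2.1.hasSum hij).summable

theorem measurable_split (i : ℕ) : Measurable fun p : Omega × ℝ => split p.1 i p.2 := by
  classical
  refine measurable_to_omega fun n => ?_
  simp_rw [split_val]
  have hc : MeasurableSet {p : Omega × ℝ | 0 ≤ p.2 ∧ p.2 ≤ p.1.1 i} :=
    (measurableSet_le measurable_const measurable_snd).inter
      (measurableSet_le measurable_snd ((measurable_entry i).comp measurable_fst))
  refine measurable_decr (w := fun p : Omega × ℝ =>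
    if 0 ≤ p.2 ∧ p.2 ≤ p.1.1 i then splitSeq p.1.1 i p.2 else p.1.1)
    (fun k => ?_) (fun z k => ?_) (fun z => ?_) n
  · simp only [apply_ite (fun w : ℕ → ℝ => w k)]
    refine Measurable.ite hc ?_ ((measurable_entry k).comp measurable_fst)
    cases k with
    | zero => exact ((measurable_entry i).comp measurable_fst).sub measurable_snd
    | succ k =>
      simp only [splitSeq, Function.update_apply]
      split_ifs
      · exact measurable_snd
      · exact (measurable_entry k).comp measurable_fst
  · split_ifs with hy
    · cases k with
      | zero => exact sub_nonneg.2 hy.2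
      | succ k =>
        simp only [splitSeq, Function.update_apply]
        split_ifs
        · exact hy.1
        · exact z.1.2.2.1 k
    · exact z.1.2.2.1 k
  · split_ifs with hy
    · exact (hasSum_splitSeq z.1.2.2.2.1.hasSum i z.2).summable
    · exact z.1.2.2.2.1

theorem measurable_mass : Measurable mass := by
  have : mass = fun z : Omega => (∑' n, ENNReal.ofReal (z.1 n)).toReal := by
    funext z
    rw [← ENNReal.ofReal_tsum_of_nonneg z.2.2.1 z.2.2.2.1,
      ENNReal.toReal_ofReal (tsum_nonneg z.2.2.1)]
    rfl
  rw [this]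
  exact (Measurable.tsum fun i => (measurable_entry i).ennreal_ofReal).ennreal_toReal

theorem measurable_Xi : Measurable Xi := by
  refine Measurable.subtype_mk (Measure.measurable_of_measurable_coe _ fun B hB => ?_)
  change Measurable fun z : Omega => pointMeasure z.1 B
  simp_rw [pointMeasure_apply _ hB]
  exact Measurable.tsum fun i => ((measurable_one.indicator hB).indicator
    measurableSet_Ioi).comp (measurable_entry i)

theorem measurable_config_apply {B : Set ℝ} (hB : MeasurableSet B) :
    Measurable fun η : Config => η.1 B :=
  (Measure.measurable_coe hB).comp measurable_subtype_coe

open Classical in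
theorem addPoint_val {η : Config} {x : ℝ} (hx : 0 < x) :
    (addPoint η x).1 = η.1 + Measure.dirac x := by
  unfold addPoint
  rw [dif_pos hx]

theorem measurable_addPoint : Measurable fun p : Config × ℝ => addPoint p.1 p.2 := by
  classical
  refine Measurable.subtype_mk (f := fun p : Config × ℝ => (addPoint p.1 p.2).1)
    (Measure.measurable_of_measurable_coe _ fun B hB => ?_)
  have : (fun p : Config × ℝ => (addPoint p.1 p.2).1 B) =
      fun p => p.1.1 B + (Set.Ioi 0).indicator (B.indicator 1) p.2 := by
    funext p
    by_cases hx : 0 < p.2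
    · rw [addPoint_val hx, Measure.add_apply, Measure.dirac_apply' _ hB,
        Set.indicator_of_mem (show p.2 ∈ Set.Ioi 0 from hx)]
    · rw [addPoint, dif_neg hx, Set.indicator_of_notMem (show p.2 ∉ Set.Ioi 0 from hx), add_zero]
  rw [this]
  exact ((measurable_config_apply hB).comp measurable_fst).add
    (((measurable_one.indicator hB).indicator measurableSet_Ioi).comp measurable_snd)

theorem summable_iff_tsum_ofReal {z : ℕ → ℝ} (h0 : ∀ n, 0 ≤ z n) :
    Summable z ↔ ∑' n, ENNReal.ofReal (z n) ≠ ∞ := by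
  constructor
  · intro h
    rw [← ENNReal.ofReal_tsum_of_nonneg h0 h]
    exact ENNReal.ofReal_ne_top
  · intro h
    simpa only [ENNReal.toReal_ofReal (h0 _)] using ENNReal.summable_toReal h

/-- Monotonicity and positivity are countably many inequalities; the conditions on the sum are
restated for the sum in `ℝ≥0∞`, which is measurable on all sequences. -/
theorem measurableSet_omega : MeasurableSet
    {z : ℕ → ℝ | Antitone z ∧ (∀ n, 0 ≤ z n) ∧ Summable z ∧ 0 < ∑' n, z n} := by
  have hm : Measurable fun z : ℕ → ℝ => ∑' n, ENNReal.ofReal (z n) :=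
    Measurable.tsum fun n => (measurable_pi_apply n).ennreal_ofReal
  have h1 : MeasurableSet {z : ℕ → ℝ | ∀ n, z (n + 1) ≤ z n} := by
    rw [Set.ofPred_forall]
    exact MeasurableSet.iInter fun n =>
      measurableSet_le (measurable_pi_apply _) (measurable_pi_apply _)
  have h2 : MeasurableSet {z : ℕ → ℝ | ∀ n, 0 ≤ z n} := by
    rw [Set.ofPred_forall]
    exact MeasurableSet.iInter fun n => measurableSet_le measurable_const (measurable_pi_apply _)
  have h3 : MeasurableSet {z : ℕ → ℝ | ∑' n, ENNReal.ofReal (z n) ≠ ∞ ∧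
      0 < ∑' n, ENNReal.ofReal (z n)} :=
    (hm (measurableSet_singleton ∞).compl).inter (hm measurableSet_Ioi)
  convert h1.inter (h2.inter h3) using 1
  ext z
  constructor
  · rintro ⟨ha, h0, hs, hp⟩
    refine ⟨fun n => ha (Nat.le_succ n), h0, (summable_iff_tsum_ofReal h0).1 hs, ?_⟩
    rw [← ENNReal.ofReal_tsum_of_nonneg h0 hs]
    exact ENNReal.ofReal_pos.2 hp
  · rintro ⟨ha, h0, hs, hp⟩
    have hs' := (summable_iff_tsum_ofReal h0).2 hs
    refine ⟨antitone_nat_of_succ_le ha, h0, hs', ?_⟩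
    rw [← ENNReal.ofReal_tsum_of_nonneg h0 hs'] at hp
    exact ENNReal.ofReal_pos.1 hp

theorem exists_measurable_retraction :
    ∃ f : (ℕ → ℝ) → Omega, Measurable f ∧ ∀ z : Omega, f z.1 = z :=
  measurableSet_omega.exists_measurable_proj ⟨unitPoint.1.1, unitPoint.1.2⟩

/-- Since t < zₙ exactly when more than n points lie beyond t, each entry factors measurably through
`Xi`. A measurable retraction onto Ω then assigns some state to configurations that come from none.
-/
theorem exists_measurable_leftInverse_Xi :
    ∃ ρ : Config → Omega, Measurable ρ ∧ ∀ z, ρ (Xi z) = z := by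
  have h1 : ∀ n : ℕ, ∃ h : Config → ℝ, Measurable h ∧ (fun z : Omega => z.1 n) = h ∘ Xi := by
    intro n
    refine Measurable.exists_eq_measurable_comp (measurable_of_Ioi fun t => ?_)
    rcases lt_or_ge t 0 with ht | ht
    · refine ⟨Set.univ, MeasurableSet.univ, ?_⟩
      ext z
      simpa using ht.trans_le (z.2.2.1 n)
    · refine ⟨{η | (n : ℝ≥0∞) < η.1 (Set.Ioi t)},
        measurable_config_apply measurableSet_Ioi measurableSet_Ioi, ?_⟩
      ext z
      change (n : ℝ≥0∞) < pointMeasure z.1 (Set.Ioi t) ↔ t < z.1 n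
      rw [pointMeasure_Ioi _ ht, ← decr_omega z, lt_decr_iff z.2.2.1 z.2.2.2.1 n ht,
        decr_omega z, ← ENat.toENNReal_coe, ENat.toENNReal_lt]
  choose h hm hh using h1
  obtain ⟨f, hf, hf'⟩ := exists_measurable_retraction
  refine ⟨fun η => f fun n => h n η, hf.comp (measurable_pi_lambda _ hm), fun z => ?_⟩
  have h2 : (fun n => h n (Xi z)) = z.1 := funext fun n => (congrFun (hh n) z).symm
  change f (fun n => h n (Xi z)) = z
  rw [h2, hf']

/-- The configurations that come from elements of `Ω` form a measurable set. -/
theorem measurableSet_range_Xi : MeasurableSet (Set.range Xi) := by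
  obtain ⟨ρ, hρ, hρ'⟩ := exists_measurable_leftInverse_Xi
  -- A configuration is in the range iff it is that of its image under `ρ`, and countably many
  -- half-lines suffice to test this.
  have h : Set.range Xi = ⋂ q : ℚ, {η : Config | 0 < q →
      η.1 (Set.Ioi (q : ℝ)) = (Xi (ρ η)).1 (Set.Ioi (q : ℝ))} := by
    ext η
    simp only [Set.mem_range, Set.mem_iInter]
    constructor
    · rintro ⟨z, rfl⟩ q _
      rw [hρ']
    · intro h
      refine ⟨ρ η, Subtype.ext ?_⟩
      exact (measure_ext_Ioi η.2.1 (Xi (ρ η)).2.1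
        (fun t ht => pointMeasure_Ioi_ne_top (ρ η).2.2.2.1 ht) h).symm
  rw [h]
  refine MeasurableSet.iInter fun q => ?_
  by_cases hq : 0 < q
  · simp only [hq, true_implies]
    exact measurableSet_eq_fun (measurable_config_apply measurableSet_Ioi)
      ((measurable_config_apply measurableSet_Ioi).comp (measurable_Xi.comp hρ))
  · simp [hq]

end CoagFrag

/-! ## Jump kernels of the generator and detailed balance -/

namespace CoagFrag

/-- By `hsymm` the measure μ ⊗ κ is invariant under exchange of coordinates. The integral of Ψ · AΦ
is the difference of the integrals of Ψ(z)Φ(z') and Ψ(z)Φ(z) against it, hence symmetric in Φ and Ψ.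
Jumps end in `U`, so the indicator of `U` is annihilated. -/
theorem isLevelOperator_of_kernel {E : Type*} [MeasurableSpace E] {A : (E → ℝ) → E → ℝ}
    {U : Set E} {μ : Measure E} [IsFiniteMeasure μ] (κ : Kernel E E) [IsFiniteKernel κ]
    (hU : MeasurableSet U) (h0 : ∀ z, z ∉ U → κ z = 0) (h1 : ∀ z, κ z Uᶜ = 0)
    (hA : ∀ C Φ, LevelFun U C Φ → ∀ z, A Φ z = ∫ z', (Φ z' - Φ z) ∂κ z)
    (hsymm : ∀ f : E × E → ℝ≥0∞, Measurable f →
      ∫⁻ z, ∫⁻ z', f (z, z') ∂κ z ∂μ = ∫⁻ z, ∫⁻ z', f (z', z) ∂κ z ∂μ) :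
    ∃ R, IsLevelOperator A U R μ := by
  have hJ : (μ ⊗ₘ κ).map Prod.swap = μ ⊗ₘ κ := by
    refine Measure.ext_of_lintegral _ fun f hf => ?_
    have hf' : Measurable fun p : E × E => f p.swap := hf.comp measurable_swap
    rw [lintegral_map hf measurable_swap, Measure.lintegral_compProd hf',
      Measure.lintegral_compProd hf]
    exact (hsymm f hf).symm
  have hm : ∀ C Φ, LevelFun U C Φ → Measurable fun z => ∫ z', (Φ z' - Φ z) ∂κ z := by
    intro C Φ hΦ
    have : StronglyMeasurable (Function.uncurry fun z z' : E => Φ z' - Φ z) :=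
      ((hΦ.measurable.comp measurable_snd).sub
        (hΦ.measurable.comp measurable_fst)).stronglyMeasurable
    exact (StronglyMeasurable.integral_kernel_prod_right this).measurable
  have hκ : ∀ z, (κ z).real Set.univ ≤ κ.bound.toReal := fun z =>
    ENNReal.toReal_mono κ.bound_ne_top (Kernel.measure_le_bound κ z _)
  refine ⟨2 * κ.bound.toReal, hU, by positivity, fun C Φ hΦ => ⟨?_, fun z => ?_, fun z hz => ?_⟩,
    ?_, fun C C' Φ Ψ hΦ hΨ => ?_⟩
  · rw [show A Φ = fun z => ∫ z', (Φ z' - Φ z) ∂κ z from funext (hA C Φ hΦ)]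
    exact hm C Φ hΦ
  · rw [hA C Φ hΦ, ← Real.norm_eq_abs]
    have hC : 0 ≤ C := (abs_nonneg _).trans (hΦ.bound z)
    refine (norm_integral_le_of_norm_le_const (C := C + C) (Filter.Eventually.of_forall fun z' =>
      (norm_sub_le _ _).trans (add_le_add (hΦ.bound _) (hΦ.bound _)))).trans ?_
    calc (C + C) * (κ z).real Set.univ ≤ (C + C) * κ.bound.toReal := by
          gcongr
          exact hκ z
      _ = _ := by ring
  · rw [hA C Φ hΦ, h0 z hz, integral_zero_measure]
  · funext z
    rw [hA 1 _ (levelFun_indicator hU subset_rfl)]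
    by_cases hz : z ∈ U
    · refine integral_eq_zero_of_ae ?_
      have : ∀ᵐ z' ∂κ z, z' ∈ U := h1 z
      filter_upwards [this] with z' hz'
      simp [hz, hz']
    · rw [h0 z hz, integral_zero_measure, Pi.zero_apply]
  · have hb : ∀ (F : E × E → ℝ), Measurable F → (∃ D, ∀ p, |F p| ≤ D) →
        Integrable F (μ ⊗ₘ κ) := fun F hF ⟨D, hD⟩ =>
      Integrable.of_bound hF.aestronglyMeasurable D (Filter.Eventually.of_forall hD)
    have bd : ∀ {C C' : ℝ} {Φ Ψ : E → ℝ}, LevelFun U C Φ → LevelFun U C' Ψ → ∀ z z',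
        |Φ z * Ψ z'| ≤ C * C' := fun hΦ hΨ z z' => by
      rw [abs_mul]
      exact mul_le_mul (hΦ.bound z) (hΨ.bound z') (abs_nonneg _)
        ((abs_nonneg _).trans (hΦ.bound z))
    have key : ∀ {C C' : ℝ} {Φ Ψ : E → ℝ}, LevelFun U C Φ → LevelFun U C' Ψ →
        ∫ z, Ψ z * A Φ z ∂μ =
          ∫ p, Ψ p.1 * Φ p.2 ∂(μ ⊗ₘ κ) - ∫ p, Ψ p.1 * Φ p.1 ∂(μ ⊗ₘ κ) := by
      intro C C' Φ Ψ hΦ hΨ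
      have m1 : Measurable fun p : E × E => Ψ p.1 * Φ p.2 :=
        (hΨ.measurable.comp measurable_fst).mul (hΦ.measurable.comp measurable_snd)
      have m2 : Measurable fun p : E × E => Ψ p.1 * Φ p.1 :=
        (hΨ.measurable.comp measurable_fst).mul (hΦ.measurable.comp measurable_fst)
      have i1 := hb _ m1 ⟨_, fun p => bd hΨ hΦ _ _⟩
      have i2 := hb _ m2 ⟨_, fun p => bd hΨ hΦ _ _⟩
      have i3 : Integrable (fun p : E × E => Ψ p.1 * Φ p.2 - Ψ p.1 * Φ p.1) (μ ⊗ₘ κ) := i1.sub i2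
      rw [← integral_sub i1 i2, Measure.integral_compProd i3]
      congr 1
      funext z
      rw [hA _ _ hΦ, ← integral_const_mul]
      congr 1
      funext z'
      ring
    rw [key hΦ hΨ]
    simp_rw [mul_comm (A Ψ _)]
    rw [key hΨ hΦ]
    congr 1
    · conv_lhs => rw [← hJ]
      have m1 : Measurable fun p : E × E => Ψ p.1 * Φ p.2 :=
        (hΨ.measurable.comp measurable_fst).mul (hΦ.measurable.comp measurable_snd)
      rw [integral_map measurable_swap.aemeasurable m1.aestronglyMeasurable]
      congr 1
      funext p
      exact mul_comm _ _
    · congr 1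
      funext p
      exact mul_comm _ _

/-! ### Merger and splitting flows, and the jump kernel below a mass level. -/

/-- A rate function on `(0,∞)²`, extended by zero. -/
noncomputable def quadRate (K : ℝ → ℝ → ℝ) : ℝ × ℝ → ℝ≥0∞ :=
  (Set.Ioi 0 ×ˢ Set.Ioi 0).indicator fun p => ENNReal.ofReal (K p.1 p.2)

theorem quadRate_of_pos (K : ℝ → ℝ → ℝ) {x y : ℝ} (hx : 0 < x) (hy : 0 < y) :
    quadRate K (x, y) = ENNReal.ofReal (K x y) :=
  Set.indicator_of_mem (show (x, y) ∈ Set.Ioi (0 : ℝ) ×ˢ Set.Ioi (0 : ℝ) from ⟨hx, hy⟩) _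

theorem quadRate_of_not_pos (K : ℝ → ℝ → ℝ) {x y : ℝ} (h : ¬ (0 < x ∧ 0 < y)) :
    quadRate K (x, y) = 0 :=
  Set.indicator_of_notMem (s := Set.Ioi (0 : ℝ) ×ˢ Set.Ioi (0 : ℝ)) (fun h' => h h') _

/-- The sum of `k(zᵢ,zⱼ) g(M_{ij} z)` over `i ≠ j`. -/
noncomputable def mergeSum (k : ℝ × ℝ → ℝ≥0∞) (g : Omega → ℝ≥0∞) (z : Omega) : ℝ≥0∞ :=
  ∑' p : ℕ × ℕ, (if p.1 ≠ p.2 then k (z.1 p.1, z.1 p.2) else 0) * g (merge z p.1 p.2)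

/-- The sum over `i` of `∫ f(y, zᵢ - y) g(S_i^{(y)} z) dy`. -/
noncomputable def splitSum (f : ℝ × ℝ → ℝ≥0∞) (g : Omega → ℝ≥0∞) (z : Omega) : ℝ≥0∞ :=
  ∑' i : ℕ, ∫⁻ y, f (y, z.1 i - y) * g (split z i y)

/-- The flow of mergers out of `dz` into `dz'` balances the flow of splittings back. -/
def DetailedBalance (k f : ℝ × ℝ → ℝ≥0∞) (μ : Measure Omega) : Prop :=
  ∀ g : Omega × Omega → ℝ≥0∞, Measurable g →
    ∫⁻ z, mergeSum k (fun z' => g (z, z')) z ∂μ = ∫⁻ z, splitSum f (fun z' => g (z', z)) z ∂μ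

variable {k f : ℝ × ℝ → ℝ≥0∞}

theorem measurable_mergeSum (hk : Measurable k) {g : Omega × Omega → ℝ≥0∞} (hg : Measurable g) :
    Measurable fun z => mergeSum k (fun z' => g (z, z')) z := by
  refine Measurable.tsum fun p => Measurable.mul ?_
    (hg.comp (measurable_id.prodMk (measurable_merge _ _)))
  split_ifs
  · exact hk.comp ((measurable_entry _).prodMk (measurable_entry _))
  · exact measurable_const

theorem measurable_splitSum (hf : Measurable f) {g : Omega × Omega → ℝ≥0∞} (hg : Measurable g) :
    Measurable fun z => splitSum f (fun z' => g (z', z)) z := by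
  refine Measurable.tsum fun i => ?_
  refine Measurable.lintegral_prod_right' (f := fun p : Omega × ℝ =>
    f (p.2, p.1.1 i - p.2) * g (split p.1 i p.2, p.1)) ?_
  exact (hf.comp (measurable_snd.prodMk
    (((measurable_entry i).comp measurable_fst).sub measurable_snd))).mul
    (hg.comp ((measurable_split i).prodMk measurable_fst))

/-- The jump measure of mergers from `z`. -/
noncomputable def mergeMeasure (k : ℝ × ℝ → ℝ≥0∞) (z : Omega) : Measure Omega :=
  Measure.sum fun p : ℕ × ℕ => (if p.1 ≠ p.2 then k (z.1 p.1, z.1 p.2) else 0) •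
    Measure.dirac (merge z p.1 p.2)

/-- The jump measure of splittings from `z`. -/
noncomputable def splitMeasure (f : ℝ × ℝ → ℝ≥0∞) (z : Omega) : Measure Omega :=
  Measure.sum fun i : ℕ => (volume.withDensity fun y => f (y, z.1 i - y)).map (split z i)

theorem lintegral_mergeMeasure (g : Omega → ℝ≥0∞) (z : Omega) :
    ∫⁻ z', g z' ∂mergeMeasure k z = mergeSum k g z := by
  rw [mergeMeasure, lintegral_sum_measure]
  refine tsum_congr fun p => ?_
  rw [lintegral_smul_measure, lintegral_dirac, smul_eq_mul]

theorem measurable_splitRate (hf : Measurable f) (a : ℝ) : Measurable fun y => f (y, a - y) :=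
  hf.comp (measurable_id.prodMk (measurable_const.sub measurable_id))

theorem measurable_split_right (z : Omega) (i : ℕ) : Measurable (split z i) :=
  (measurable_split i).comp (measurable_const.prodMk measurable_id)

theorem lintegral_splitMeasure (hf : Measurable f) {g : Omega → ℝ≥0∞} (hg : Measurable g)
    (z : Omega) : ∫⁻ z', g z' ∂splitMeasure f z = splitSum f g z := by
  rw [splitMeasure, lintegral_sum_measure]
  refine tsum_congr fun i => ?_
  have hg' : Measurable fun y => g (split z i y) := hg.comp (measurable_split_right z i)
  rw [lintegral_map hg (measurable_split_right z i),
    lintegral_withDensity_eq_lintegral_mul _ (measurable_splitRate hf _) hg']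
  rfl

open Classical in
/-- The jump kernel restricted to `{|z| ≤ m}`. -/
noncomputable def levelKernel (hk : Measurable k) (hf : Measurable f) (m : ℝ) :
    Kernel Omega Omega where
  toFun z := if mass z ≤ m then (1 / 2 : ℝ≥0∞) • (mergeMeasure k z + splitMeasure f z) else 0
  measurable' := by
    refine Measurable.ite (measurableSet_le measurable_mass measurable_const) ?_ measurable_const
    refine Measure.measurable_of_measurable_coe _ fun B hB => ?_
    have hg : Measurable (B.indicator (1 : Omega → ℝ≥0∞)) := measurable_one.indicator hB
    have : (fun z => ((1 / 2 : ℝ≥0∞) • (mergeMeasure k z + splitMeasure f z)) B) = fun z =>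
        (1 / 2 : ℝ≥0∞) * (mergeSum k (B.indicator 1) z + splitSum f (B.indicator 1) z) := by
      funext z
      rw [Measure.smul_apply, Measure.add_apply, ← lintegral_indicator_one hB,
        ← lintegral_indicator_one hB, lintegral_mergeMeasure, lintegral_splitMeasure hf hg,
        smul_eq_mul]
    rw [this]
    exact ((measurable_mergeSum hk (hg.comp measurable_snd)).add
      (measurable_splitSum hf (hg.comp measurable_fst))).const_mul _

theorem levelKernel_of_le (hk : Measurable k) (hf : Measurable f) {m : ℝ} {z : Omega}
    (hz : mass z ≤ m) : levelKernel hk hf m z =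
      (1 / 2 : ℝ≥0∞) • (mergeMeasure k z + splitMeasure f z) := if_pos hz

theorem levelKernel_of_not_le (hk : Measurable k) (hf : Measurable f) {m : ℝ} {z : Omega}
    (hz : ¬ mass z ≤ m) : levelKernel hk hf m z = 0 := if_neg hz

/-- The cutoff is placed inside the test function, on the coordinate of the starting point. Each
pair is ordered as (state before the merger, state after it), the form to which `DetailedBalance`
applies. -/
theorem lintegral_levelKernel (hk : Measurable k) (hf : Measurable f) (m : ℝ)
    {g : Omega × Omega → ℝ≥0∞} (hg : Measurable g) (z : Omega) :
    ∫⁻ z', g (z, z') ∂levelKernel hk hf m z =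
      (1 / 2) * (mergeSum k (fun z' => {p : Omega × Omega | mass p.1 ≤ m}.indicator g (z, z')) z +
        splitSum f (fun z' => {p : Omega × Omega | mass p.2 ≤ m}.indicator
          (g ∘ Prod.swap) (z', z)) z) := by
  have hg' : Measurable fun z' => g (z, z') := hg.comp (measurable_const.prodMk measurable_id)
  by_cases hz : mass z ≤ m
  · rw [levelKernel_of_le hk hf hz, lintegral_smul_measure, lintegral_add_measure,
      lintegral_mergeMeasure, lintegral_splitMeasure hf hg', smul_eq_mul]
    simp [Set.indicator, hz]
  · rw [levelKernel_of_not_le hk hf hz, lintegral_zero_measure]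
    simp [mergeSum, splitSum, Set.indicator, hz]

theorem mergeSum_congr_mass {g g' : Omega → ℝ≥0∞} {z : Omega}
    (h : ∀ z', mass z' = mass z → g z' = g' z') : mergeSum k g z = mergeSum k g' z :=
  tsum_congr fun p => by rw [h _ (mass_merge z _ _)]

/-- Detailed balance turns the splitting term for g into a merger term for g with exchanged
arguments, and the resulting total is symmetric under that exchange. Conservation of mass moves the
cutoff from one end of a jump to the other. -/
theorem levelKernel_symm (hk : Measurable k) (hf : Measurable f) (m : ℝ) {μ : Measure Omega}
    (hdb : DetailedBalance k f μ) {g : Omega × Omega → ℝ≥0∞} (hg : Measurable g) :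
    ∫⁻ z, ∫⁻ z', g (z, z') ∂levelKernel hk hf m z ∂μ =
      ∫⁻ z, ∫⁻ z', g (z', z) ∂levelKernel hk hf m z ∂μ := by
  have hm1 : MeasurableSet {p : Omega × Omega | mass p.1 ≤ m} :=
    measurableSet_le (measurable_mass.comp measurable_fst) measurable_const
  have hm2 : MeasurableSet {p : Omega × Omega | mass p.2 ≤ m} :=
    measurableSet_le (measurable_mass.comp measurable_snd) measurable_const
  have key : ∀ g : Omega × Omega → ℝ≥0∞, Measurable g →
      ∫⁻ z, ∫⁻ z', g (z, z') ∂levelKernel hk hf m z ∂μ = (1 / 2) *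
        (∫⁻ z, mergeSum k (fun z' => {p : Omega × Omega | mass p.1 ≤ m}.indicator g (z, z')) z ∂μ +
        ∫⁻ z, mergeSum k (fun z' => {p : Omega × Omega | mass p.1 ≤ m}.indicator
          (g ∘ Prod.swap) (z, z')) z ∂μ) := by
    intro g hg
    simp_rw [lintegral_levelKernel hk hf m hg]
    have hg' : Measurable (g ∘ Prod.swap) := hg.comp measurable_swap
    rw [lintegral_const_mul, lintegral_add_left,
      ← hdb ({p : Omega × Omega | mass p.2 ≤ m}.indicator (g ∘ Prod.swap)) (hg'.indicator hm2)]
    · congr 3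
      funext z
      refine mergeSum_congr_mass fun z' hz' => ?_
      by_cases h : mass z ≤ m <;> simp [Set.indicator, hz', h]
    · exact measurable_mergeSum hk (hg.indicator hm1)
    · exact (measurable_mergeSum hk (hg.indicator hm1)).add
        (measurable_splitSum hf (hg'.indicator hm2))
  rw [key g hg, key (fun p => g (p.2, p.1)) (hg.comp measurable_swap), add_comm]
  rfl

theorem isFiniteKernel_levelKernel (hk : Measurable k) (hf : Measurable f) {m : ℝ} {C : ℝ≥0∞}
    (hC : C ≠ ∞) (hkC : ∀ z : Omega, mass z ≤ m → mergeSum k 1 z ≤ C)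
    (hfC : ∀ z : Omega, mass z ≤ m → splitSum f 1 z ≤ C) :
    IsFiniteKernel (levelKernel hk hf m) := by
  refine ⟨⟨(1 / 2) * (C + C), ENNReal.mul_lt_top (by simp) (by simp [hC.lt_top]), fun z => ?_⟩⟩
  by_cases hz : mass z ≤ m
  · rw [levelKernel_of_le hk hf hz, Measure.smul_apply, Measure.add_apply, ← lintegral_one,
      ← lintegral_one, smul_eq_mul]
    have h1 := lintegral_mergeMeasure (k := k) 1 z
    have h2 := lintegral_splitMeasure hf (g := 1) measurable_one z
    simp only [Pi.one_apply] at h1 h2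
    rw [h1, h2]
    gcongr
    exacts [hkC z hz, hfC z hz]
  · rw [levelKernel_of_not_le hk hf hz]
    simp

theorem levelKernel_compl (hk : Measurable k) (hf : Measurable f) (m : ℝ) (z : Omega) :
    levelKernel hk hf m z {z | mass z ≤ m}ᶜ = 0 := by
  have hms : MeasurableSet {z : Omega | mass z ≤ m} :=
    measurableSet_le measurable_mass measurable_const
  rw [← lintegral_indicator_one hms.compl,
    lintegral_levelKernel hk hf m (g := fun p => {z | mass z ≤ m}ᶜ.indicator 1 p.2)
      ((measurable_one.indicator hms.compl).comp measurable_snd)]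
  by_cases hz : mass z ≤ m <;>
    simp [mergeSum, splitSum, Set.indicator, hz, not_lt.2, mass_merge, mass_split]

/-- On functions supported in `{|z| ≤ m}`, the operator `L` is the jump operator of the level
kernel. -/
theorem genL_eq_integral_levelKernel {K F : ℝ → ℝ → ℝ}
    (hK : Measurable (quadRate K)) (hF : Measurable (quadRate F))
    (hK0 : ∀ x y, 0 < x → 0 < y → 0 ≤ K x y) (hF0 : ∀ x y, 0 < x → 0 < y → 0 ≤ F x y)
    {m : ℝ} {C : ℝ≥0∞} (hC : C ≠ ∞)
    (hkC : ∀ z : Omega, mass z ≤ m → mergeSum (quadRate K) 1 z ≤ C)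
    (hfC : ∀ z : Omega, mass z ≤ m → splitSum (quadRate F) 1 z ≤ C) {D : ℝ} {Φ : Omega → ℝ}
    (hΦ : LevelFun {z | mass z ≤ m} D Φ) (z : Omega) :
    genL K F Φ z = ∫ z', (Φ z' - Φ z) ∂levelKernel hK hF m z := by
  classical
  have hΦm : Measurable fun z' => Φ z' - Φ z := hΦ.measurable.sub measurable_const
  by_cases hz : mass z ≤ m
  · have fin1 : IsFiniteMeasure (mergeMeasure (quadRate K) z) := ⟨by
      rw [← lintegral_one]
      have h1 := lintegral_mergeMeasure (k := quadRate K) 1 z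
      simp only [Pi.one_apply] at h1
      rw [h1]
      exact (hkC z hz).trans_lt hC.lt_top⟩
    have fin2 : IsFiniteMeasure (splitMeasure (quadRate F) z) := ⟨by
      rw [← lintegral_one]
      have h1 := lintegral_splitMeasure hF (g := 1) measurable_one z
      simp only [Pi.one_apply] at h1
      rw [h1]
      exact (hfC z hz).trans_lt hC.lt_top⟩
    have int : ∀ (ν : Measure Omega) [IsFiniteMeasure ν], Integrable (fun z' => Φ z' - Φ z) ν :=
      fun ν _ => Integrable.of_bound hΦm.aestronglyMeasurable (D + D)
        (Filter.Eventually.of_forall fun z' =>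
          (norm_sub_le _ _).trans (add_le_add (hΦ.bound _) (hΦ.bound _)))
    rw [levelKernel_of_le hK hF hz, integral_smul_measure,
      integral_add_measure (int _) (int _), genL, smul_eq_mul, mul_add]
    have half : (1 / 2 : ℝ≥0∞).toReal = 1 / 2 := by simp
    rw [half]
    congr 2
    · rw [mergeMeasure, integral_sum_measure (by rw [← mergeMeasure]; exact int _)]
      refine tsum_congr fun p => ?_
      rw [integral_smul_measure, integral_dirac, smul_eq_mul]
      by_cases hp : p.1 ≠ p.2
      · by_cases hpos : 0 < z.1 p.1 ∧ 0 < z.1 p.2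
        · rw [if_pos ⟨hp, hpos⟩, if_pos hp, quadRate_of_pos K hpos.1 hpos.2,
            ENNReal.toReal_ofReal (hK0 _ _ hpos.1 hpos.2)]
        · rw [if_neg (fun h => hpos h.2), if_pos hp, quadRate_of_not_pos K hpos,
            ENNReal.toReal_zero, zero_mul]
      · rw [if_neg (fun h => hp h.1), if_neg hp, ENNReal.toReal_zero, zero_mul]
    · rw [splitMeasure, integral_sum_measure (by rw [← splitMeasure]; exact int _)]
      refine tsum_congr fun i => ?_
      rw [integral_map (measurable_split_right z i).aemeasurable hΦm.aestronglyMeasurable]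
      have hrate : ∀ y, quadRate F (y, z.1 i - y) < ∞ := fun y =>
        lt_of_le_of_lt (Set.indicator_le_self _ _ _) ENNReal.ofReal_lt_top
      rw [integral_withDensity_eq_integral_toReal_smul (measurable_splitRate hF _)
        (Filter.Eventually.of_forall hrate)]
      -- The extended rate vanishes unless 0 < y < zᵢ, which restores the range of integration; for
      -- zᵢ = 0 this range is empty.
      have hind : (fun y => (quadRate F (y, z.1 i - y)).toReal • (Φ (split z i y) - Φ z)) =
          (Set.Ioo 0 (z.1 i)).indicator
            fun y => F y (z.1 i - y) * (Φ (split z i y) - Φ z) := by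
        funext y
        by_cases hy : y ∈ Set.Ioo 0 (z.1 i)
        · rw [Set.indicator_of_mem hy, quadRate_of_pos F hy.1 (sub_pos.2 hy.2),
            ENNReal.toReal_ofReal (hF0 _ _ hy.1 (sub_pos.2 hy.2)), smul_eq_mul]
        · rw [Set.indicator_of_notMem hy, quadRate_of_not_pos F
            (fun h => hy ⟨h.1, sub_pos.1 h.2⟩), ENNReal.toReal_zero, zero_smul]
      rw [hind, integral_indicator measurableSet_Ioo]
      split_ifs with hi
      · rfl
      · rw [Set.Ioo_eq_empty hi, setIntegral_empty]
  -- Above the level, Φ vanishes at z and, by conservation of mass, at every state reached from z.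
  · have e1 : ∀ z', mass z' = mass z → Φ z' = 0 := fun z' hz' =>
      hΦ.supp z' (fun h => hz (hz' ▸ h))
    rw [levelKernel_of_not_le hK hF hz, integral_zero_measure, genL]
    simp [e1 _ (mass_merge z _ _), e1 _ (mass_split z _ _), e1 z rfl]

/-- Detailed balance implies reversibility of the coagulation-fragmentation process. -/
theorem isReversible_genL {K F : ℝ → ℝ → ℝ}
    (hK : Measurable (quadRate K)) (hF : Measurable (quadRate F))
    (hK0 : ∀ x y, 0 < x → 0 < y → 0 ≤ K x y) (hF0 : ∀ x y, 0 < x → 0 < y → 0 ≤ F x y)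
    (hbd : ∀ m : ℕ, ∃ C : ℝ≥0∞, C ≠ ∞ ∧
      (∀ z : Omega, mass z ≤ m → mergeSum (quadRate K) 1 z ≤ C) ∧
      (∀ z : Omega, mass z ≤ m → splitSum (quadRate F) 1 z ≤ C))
    {μ : Measure Omega} [IsFiniteMeasure μ] (hdb : DetailedBalance (quadRate K) (quadRate F) μ) :
    IsReversible.{u} (genL K F) μ := by
  refine isReversible_of_levelOperators (V := fun m : ℕ => {z | mass z ≤ m})
    (fun a b hab z hz => show mass z ≤ b from
      le_trans (show mass z ≤ a from hz) (by exact_mod_cast hab)) ?_ fun m => ?_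
  · refine Set.eq_univ_of_forall fun z => ?_
    obtain ⟨m, hm⟩ := exists_nat_ge (mass z)
    exact Set.mem_iUnion.2 ⟨m, hm⟩
  · obtain ⟨C, hC, hkC, hfC⟩ := hbd m
    have := isFiniteKernel_levelKernel hK hF hC hkC hfC
    exact isLevelOperator_of_kernel (levelKernel hK hF m)
      (measurableSet_le measurable_mass measurable_const)
      (fun z hz => levelKernel_of_not_le hK hF hz) (levelKernel_compl hK hF m)
      (fun D Φ hΦ z => genL_eq_integral_levelKernel hK hF hK0 hF0 hC hkC hfC hΦ z)
      (fun g hg => levelKernel_symm hK hF m hdb hg)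

end CoagFrag

/-! ## Homogeneous rates -/

namespace CoagFrag

variable {lam : ℝ} {H : ℝ → ℝ → ℝ}

theorem measurable_quadRate_coagRate (hH : IsHomogeneousKernel lam H) :
    Measurable (quadRate (coagRate H)) := by
  have : quadRate (coagRate H) = fun p => ENNReal.ofReal (p.1 * p.2 *
      (Set.Ioi (0 : ℝ) ×ˢ Set.Ioi (0 : ℝ)).indicator (fun p => H p.1 p.2) p) := by
    funext p
    by_cases hp : p ∈ Set.Ioi (0 : ℝ) ×ˢ Set.Ioi (0 : ℝ)
    · simp only [quadRate, Set.indicator_of_mem hp, coagRate]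
    · simp only [quadRate, Set.indicator_of_notMem hp, mul_zero, ENNReal.ofReal_zero]
  rw [this]
  exact ((measurable_fst.mul measurable_snd).mul hH.measurable).ennreal_ofReal

theorem measurable_quadRate_fragRate (hH : IsHomogeneousKernel lam H) :
    Measurable (quadRate (fragRate H)) := by
  have : quadRate (fragRate H) = fun p => ENNReal.ofReal ((p.1 + p.2) *
      (Set.Ioi (0 : ℝ) ×ˢ Set.Ioi (0 : ℝ)).indicator (fun p => H p.1 p.2) p) := by
    funext p
    by_cases hp : p ∈ Set.Ioi (0 : ℝ) ×ˢ Set.Ioi (0 : ℝ)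
    · simp only [quadRate, Set.indicator_of_mem hp, fragRate]
    · simp only [quadRate, Set.indicator_of_notMem hp, mul_zero, ENNReal.ofReal_zero]
  rw [this]
  exact ((measurable_fst.add measurable_snd).mul hH.measurable).ennreal_ofReal

theorem entry_le_mass (z : Omega) (i : ℕ) : z.1 i ≤ mass z :=
  z.2.2.2.1.le_tsum i fun j _ => z.2.2.1 j

theorem tsum_ofReal_entry (z : Omega) : ∑' i, ENNReal.ofReal (z.1 i) = ENNReal.ofReal (mass z) :=
  (ENNReal.ofReal_tsum_of_nonneg z.2.2.1 z.2.2.2.1).symm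

/-- The total rate of mergers is bounded on `{|z| ≤ m}`. -/
theorem mergeSum_coagRate_le (hlam : 0 ≤ lam) (hH : IsHomogeneousKernel lam H) (h1 : CondH1 H)
    {m : ℝ} {z : Omega} (hz : mass z ≤ m) :
    mergeSum (quadRate (coagRate H)) 1 z ≤
      ENNReal.ofReal (sSup ((fun u => H u (1 - u)) '' Set.Ioo 0 1) * (m + m) ^ lam) *
        (ENNReal.ofReal m * ENNReal.ofReal m) := by
  set B := sSup ((fun u => H u (1 - u)) '' Set.Ioo 0 1)
  have hB : 0 < B := h1.2
  have hm : 0 < m := z.2.2.2.2.trans_le hz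
  have hterm : ∀ p : ℕ × ℕ, (if p.1 ≠ p.2 then quadRate (coagRate H) (z.1 p.1, z.1 p.2) else 0) *
      (1 : Omega → ℝ≥0∞) (merge z p.1 p.2) ≤ ENNReal.ofReal (B * (m + m) ^ lam) *
        (ENNReal.ofReal (z.1 p.1) * ENNReal.ofReal (z.1 p.2)) := by
    intro p
    rw [Pi.one_apply, mul_one]
    split_ifs with hp
    · by_cases hpos : 0 < z.1 p.1 ∧ 0 < z.1 p.2
      · obtain ⟨hx, hy⟩ := hpos
        rw [quadRate_of_pos _ hx hy, ← ENNReal.ofReal_mul hx.le,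
          ← ENNReal.ofReal_mul (by positivity)]
        refine ENNReal.ofReal_le_ofReal ?_
        set x := z.1 p.1
        set y := z.1 p.2
        have hxy : 0 < x + y := add_pos hx hy
        have hu : x / (x + y) ∈ Set.Ioo (0 : ℝ) 1 :=
          ⟨div_pos hx hxy, (div_lt_one hxy).2 (by linarith)⟩
        -- Homogeneity reduces `H` to its values at (u, 1 - u), bounded by `B`. Each entry is at
        -- most m, so the prefactor is at most (m + m)^λ because λ ≥ 0.
        have e : H x y = (x + y) ^ lam * H (x / (x + y)) (1 - x / (x + y)) := by
          rw [← hH.homogeneous _ _ _ hxy hu.1 (sub_pos.2 hu.2)]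
          congr 1 <;> field_simp
          ring
        have hb : H (x / (x + y)) (1 - x / (x + y)) ≤ B := le_csSup h1.1 ⟨_, hu, rfl⟩
        have hpow : (x + y) ^ lam ≤ (m + m) ^ lam := Real.rpow_le_rpow hxy.le
          (add_le_add ((entry_le_mass z _).trans hz) ((entry_le_mass z _).trans hz)) hlam
        rw [coagRate, e]
        calc x * y * ((x + y) ^ lam * H (x / (x + y)) (1 - x / (x + y)))
            ≤ x * y * ((m + m) ^ lam * B) := by
              gcongr
              exact hH.nonneg _ _ hu.1 (sub_pos.2 hu.2)
          _ = _ := by ring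
      · rw [quadRate_of_not_pos _ hpos]
        exact zero_le
    · exact zero_le
  refine (ENNReal.tsum_le_tsum hterm).trans ?_
  rw [ENNReal.tsum_mul_left, ENNReal.tsum_prod (f := fun i j : ℕ =>
    ENNReal.ofReal (z.1 i) * ENNReal.ofReal (z.1 j))]
  simp_rw [ENNReal.tsum_mul_left, ENNReal.tsum_mul_right, tsum_ofReal_entry]
  gcongr

theorem lintegral_eq_mul_lintegral_comp_mul {a : ℝ} (ha : 0 < a) (g : ℝ → ℝ≥0∞) :
    ∫⁻ y, g y = ENNReal.ofReal a * ∫⁻ u, g (a * u) := by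
  have h := Real.smul_map_volume_mul_left ha.ne'
  have e : MeasurableEmbedding fun u : ℝ => a * u :=
    (Homeomorph.mulLeft₀ a ha.ne').measurableEmbedding
  conv_lhs => rw [← h]
  rw [lintegral_smul_measure, e.lintegral_map, abs_of_pos ha, smul_eq_mul]

/-- Substitute y = a u: the Jacobian gives a, the factor x + y of the rate another a, and
homogeneity a^λ. -/
theorem lintegral_fragRate (hH : IsHomogeneousKernel lam H) {a : ℝ} (ha : 0 < a) :
    ∫⁻ y, quadRate (fragRate H) (y, a - y) = ENNReal.ofReal a * (ENNReal.ofReal (a * a ^ lam) *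
      ∫⁻ u in Set.Ioo (0 : ℝ) 1, ENNReal.ofReal (H u (1 - u))) := by
  rw [lintegral_eq_mul_lintegral_comp_mul ha, ← lintegral_indicator measurableSet_Ioo]
  congr 1
  rw [← lintegral_const_mul' _ _ ENNReal.ofReal_ne_top]
  congr 1
  funext u
  by_cases hu : u ∈ Set.Ioo (0 : ℝ) 1
  · have h1 : 0 < 1 - u := sub_pos.2 hu.2
    rw [Set.indicator_of_mem hu, show a - a * u = a * (1 - u) by ring,
      quadRate_of_pos _ (mul_pos ha hu.1) (mul_pos ha h1),
      ← ENNReal.ofReal_mul (by positivity), fragRate, hH.homogeneous a _ _ ha hu.1 h1]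
    congr 1
    ring
  · rw [Set.indicator_of_notMem hu, mul_zero, quadRate_of_not_pos]
    rintro ⟨h1, h2⟩
    exact hu ⟨by simpa [ha] using h1, by nlinarith⟩

/-- The total rate of splittings is bounded on `{|z| ≤ m}`. -/
theorem splitSum_fragRate_le (hlam : 0 ≤ lam) (hH : IsHomogeneousKernel lam H)
    {m : ℝ} {z : Omega} (hz : mass z ≤ m) :
    splitSum (quadRate (fragRate H)) 1 z ≤ ENNReal.ofReal m * (ENNReal.ofReal (m * m ^ lam) *
      ∫⁻ u in Set.Ioo (0 : ℝ) 1, ENNReal.ofReal (H u (1 - u))) := by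
  have hm : 0 < m := z.2.2.2.2.trans_le hz
  have hterm : ∀ i : ℕ, ∫⁻ y, quadRate (fragRate H) (y, z.1 i - y) *
      (1 : Omega → ℝ≥0∞) (split z i y) ≤ ENNReal.ofReal (z.1 i) * (ENNReal.ofReal (m * m ^ lam) *
        ∫⁻ u in Set.Ioo (0 : ℝ) 1, ENNReal.ofReal (H u (1 - u))) := by
    intro i
    simp only [Pi.one_apply, mul_one]
    rcases (z.2.2.1 i).eq_or_lt with h0 | h0
    · rw [lintegral_eq_zero_of_ae_eq_zero]
      · exact zero_le
      · refine Filter.Eventually.of_forall fun y => quadRate_of_not_pos _ ?_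
        rintro ⟨h1, h2⟩
        linarith
    · rw [lintegral_fragRate hH h0]
      have hle := (entry_le_mass z i).trans hz
      gcongr
  refine (ENNReal.tsum_le_tsum hterm).trans ?_
  rw [ENNReal.tsum_mul_right, tsum_ofReal_entry]
  gcongr

/-- Detailed balance for homogeneous rates of finite total intensity implies reversibility. -/
theorem isReversible_homogeneous {Hhat Hcheck : ℝ → ℝ → ℝ} (hlam : 0 ≤ lam)
    (h1 : IsHomogeneousKernel lam Hhat) (h1' : CondH1 Hhat) (h2 : IsHomogeneousKernel lam Hcheck)
    (h2' : ∫⁻ u in Set.Ioo (0 : ℝ) 1, ENNReal.ofReal (Hcheck u (1 - u)) ≠ ∞)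
    {μ : Measure Omega} [IsFiniteMeasure μ]
    (hdb : DetailedBalance (quadRate (coagRate Hhat)) (quadRate (fragRate Hcheck)) μ) :
    IsReversible.{u} (genL (coagRate Hhat) (fragRate Hcheck)) μ := by
  refine isReversible_genL (measurable_quadRate_coagRate h1) (measurable_quadRate_fragRate h2)
    (fun x y hx hy => mul_nonneg (mul_pos hx hy).le (h1.nonneg x y hx hy))
    (fun x y hx hy => mul_nonneg (add_pos hx hy).le (h2.nonneg x y hx hy)) (fun m => ?_) hdb
  refine ⟨_, ?_, fun z hz => (mergeSum_coagRate_le hlam h1 h1' hz).trans (le_max_left _ _),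
    fun z hz => (splitSum_fragRate_le hlam h2 hz).trans (le_max_right _ _)⟩
  refine (max_lt ?_ ?_).ne
  · exact ENNReal.mul_lt_top ENNReal.ofReal_lt_top
      (ENNReal.mul_lt_top ENNReal.ofReal_lt_top ENNReal.ofReal_lt_top)
  · exact ENNReal.mul_lt_top ENNReal.ofReal_lt_top
      (ENNReal.mul_lt_top ENNReal.ofReal_lt_top h2'.lt_top)

theorem CondH2.lintegral_ne_top (hH : CondH2 H) :
    ∫⁻ u in Set.Ioo (0 : ℝ) 1, ENNReal.ofReal (H u (1 - u)) ≠ ∞ :=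
  (Integrable.lintegral_lt_top hH.1).ne

/-- For `genHθ`, one supremum bound controls mergers and splittings alike, since the unit interval
has finite length. -/
theorem CondH1.lintegral_ne_top (hH : CondH1 H) {θ : ℝ} (hθ : 0 ≤ θ) :
    ∫⁻ u in Set.Ioo (0 : ℝ) 1, ENNReal.ofReal (θ * H u (1 - u)) ≠ ∞ := by
  refine ne_top_of_le_ne_top (b := ∫⁻ u in Set.Ioo (0 : ℝ) 1, ENNReal.ofReal
    (θ * sSup ((fun u => H u (1 - u)) '' Set.Ioo 0 1))) (by simp) ?_
  refine setLIntegral_mono' measurableSet_Ioo fun u hu => ENNReal.ofReal_le_ofReal ?_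
  exact mul_le_mul_of_nonneg_left (le_csSup hH.1 ⟨u, hu, rfl⟩) hθ

end CoagFrag

/-! ## Coagulation and fragmentation in terms of the values of the entries -/

namespace CoagFrag

theorem merge_unique {z z' : Omega} {i j : ℕ} (hij : i ≠ j) (hi : 0 < z.1 i) (hj : 0 < z.1 j)
    (h : pointMeasure z'.1 + Measure.dirac (z.1 i) + Measure.dirac (z.1 j) =
      pointMeasure z.1 + Measure.dirac (z.1 i + z.1 j)) : z' = merge z i j := by
  rw [← Xi_merge hij hi hj] at h
  exact omega_ext (add_dirac_cancel (add_dirac_cancel h))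

theorem split_unique {z z' : Omega} {i : ℕ} {y : ℝ} (hy : 0 < y) (hyi : y < z.1 i)
    (h : pointMeasure z'.1 + Measure.dirac (z.1 i) =
      pointMeasure z.1 + Measure.dirac y + Measure.dirac (z.1 i - y)) : z' = split z i y := by
  rw [← Xi_split hy hyi] at h
  exact omega_ext (add_dirac_cancel h)

/-- Palm formulas and size-biased sampling see the values of entries and not their indices;
transitions therefore have to be recognized as functions of the values. -/
theorem merge_eq_merge {z : Omega} {i j i' j' : ℕ} (hij : i ≠ j) (hij' : i' ≠ j')
    (hi : 0 < z.1 i) (hj : 0 < z.1 j) (hi' : z.1 i' = z.1 i) (hj' : z.1 j' = z.1 j) :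
    merge z i' j' = merge z i j := by
  refine merge_unique hij hi hj ?_
  rw [← hi', ← hj']
  exact Xi_merge hij' (hi' ▸ hi) (hj' ▸ hj)

theorem split_eq_split {z : Omega} {i i' : ℕ} {y : ℝ} (hy : 0 < y) (hyi : y < z.1 i)
    (hi' : z.1 i' = z.1 i) : split z i' y = split z i y := by
  refine split_unique hy hyi ?_
  rw [← hi']
  exact Xi_split hy (hi' ▸ hyi)

/-- Merging can be undone by splitting. -/
theorem exists_split_merge {z : Omega} {i j : ℕ} (hij : i ≠ j) (hi : 0 < z.1 i) (hj : 0 < z.1 j) :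
    ∃ l, (merge z i j).1 l = z.1 i + z.1 j ∧ split (merge z i j) l (z.1 i) = z := by
  have h := Xi_merge hij hi hj
  -- The witness is the configuration with both entries overwritten by 0; the merged state has just
  -- one point more.
  obtain ⟨η, hη⟩ : ∃ η : Measure ℝ, pointMeasure z.1 =
      η + Measure.dirac (z.1 i) + Measure.dirac (z.1 j) := by
    refine ⟨pointMeasure (Function.update (Function.update z.1 i 0) j 0), ?_⟩
    have e := pointMeasure_mergeSeq hij hi hj
    have e1 := fun (B : Set ℝ) => tsum_update_add
      ((Set.Ioi 0).indicator (B.indicator 1) : ℝ → ℝ≥0∞) z.1 i 0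
    have e2 := fun (B : Set ℝ) => tsum_update_add
      ((Set.Ioi 0).indicator (B.indicator 1) : ℝ → ℝ≥0∞) (Function.update z.1 i 0) j 0
    ext B hB
    have d : ∀ x, 0 < x → Measure.dirac x B =
        ((Set.Ioi 0).indicator (B.indicator 1) : ℝ → ℝ≥0∞) x := fun x hx => by
      rw [Measure.dirac_apply' _ hB, Set.indicator_of_mem (show x ∈ Set.Ioi 0 from hx)]
    have d0 : ((Set.Ioi 0).indicator (B.indicator 1) : ℝ → ℝ≥0∞) 0 = 0 := by simp
    have e1 := e1 B
    have e2 := e2 B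
    rw [Function.update_of_ne hij.symm] at e2
    rw [d0, add_zero] at e1 e2
    simp only [Measure.add_apply, pointMeasure_apply _ hB, d _ hi, d _ hj]
    rw [add_right_comm, e2, e1]
  have hm : pointMeasure (merge z i j).1 = η + Measure.dirac (z.1 i + z.1 j) := by
    apply add_dirac_cancel (x := z.1 i)
    apply add_dirac_cancel (x := z.1 j)
    rw [h, hη]
    abel
  obtain ⟨l, hl⟩ := exists_entry_of_dirac hm
  refine ⟨l, hl, (split_unique hi (by rw [hl]; linarith) ?_).symm⟩
  rw [hl, hm, add_sub_cancel_left, hη]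
  abel

open Classical in
/-- The value of `g(z, M_{ij} z)` for any `i ≠ j` with `(zᵢ, zⱼ) = x`. -/
noncomputable def mergeAt (g : Omega × Omega → ℝ≥0∞) (x : ℝ × ℝ) (z : Omega) : ℝ≥0∞ :=
  ⨆ p : ℕ × ℕ, if p.1 ≠ p.2 ∧ z.1 p.1 = x.1 ∧ z.1 p.2 = x.2 then g (z, merge z p.1 p.2) else 0

open Classical in
/-- The value of `g(S_i^{(y)} z, z)` for any `i` with `zᵢ = w`. -/
noncomputable def splitAt (g : Omega × Omega → ℝ≥0∞) (w y : ℝ) (z : Omega) : ℝ≥0∞ :=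
  ⨆ i : ℕ, if z.1 i = w then g (split z i y, z) else 0

variable {g : Omega × Omega → ℝ≥0∞}

theorem measurable_mergeAt (hg : Measurable g) :
    Measurable fun p : (ℝ × ℝ) × Omega => mergeAt g p.1 p.2 := by
  refine Measurable.iSup fun p => Measurable.ite ?_ ?_ measurable_const
  · refine MeasurableSet.inter (MeasurableSet.const _) (MeasurableSet.inter ?_ ?_)
    · exact measurableSet_eq_fun ((measurable_entry _).comp measurable_snd)
        (measurable_fst.comp measurable_fst)
    · exact measurableSet_eq_fun ((measurable_entry _).comp measurable_snd)
        (measurable_snd.comp measurable_fst)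
  · exact hg.comp (measurable_snd.prodMk ((measurable_merge _ _).comp measurable_snd))

theorem measurable_splitAt (hg : Measurable g) :
    Measurable fun p : (ℝ × ℝ) × Omega => splitAt g p.1.1 p.1.2 p.2 := by
  refine Measurable.iSup fun i => Measurable.ite ?_ ?_ measurable_const
  · exact measurableSet_eq_fun ((measurable_entry _).comp measurable_snd)
      (measurable_fst.comp measurable_fst)
  · exact hg.comp (((measurable_split i).comp (measurable_snd.prodMk
      (measurable_snd.comp measurable_fst))).prodMk measurable_snd)

theorem mergeAt_eq (g : Omega × Omega → ℝ≥0∞) {z : Omega} {i j : ℕ} (hij : i ≠ j)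
    (hi : 0 < z.1 i) (hj : 0 < z.1 j) : mergeAt g (z.1 i, z.1 j) z = g (z, merge z i j) := by
  refine le_antisymm (iSup_le fun p => ?_) ?_
  · split_ifs with h
    · rw [merge_eq_merge hij h.1 hi hj h.2.1 h.2.2]
    · exact zero_le
  · refine le_trans ?_ (le_iSup _ (i, j))
    rw [if_pos ⟨hij, rfl, rfl⟩]

theorem splitAt_eq (g : Omega × Omega → ℝ≥0∞) {z : Omega} {i : ℕ} {y : ℝ} (hy : 0 < y)
    (hyi : y < z.1 i) : splitAt g (z.1 i) y z = g (split z i y, z) := by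
  refine le_antisymm (iSup_le fun p => ?_) ?_
  · split_ifs with h
    · rw [split_eq_split hy hyi h]
    · exact zero_le
  · refine le_trans ?_ (le_iSup _ i)
    rw [if_pos rfl]

/-- The pointwise core of detailed balance: a merger and the splitting that undoes it carry the same
pair of states. -/
theorem splitAt_merge (g : Omega × Omega → ℝ≥0∞) {z : Omega} {i j : ℕ} (hij : i ≠ j)
    (hi : 0 < z.1 i) (hj : 0 < z.1 j) :
    splitAt g (z.1 i + z.1 j) (z.1 i) (merge z i j) = g (z, merge z i j) := by
  obtain ⟨l, hl, hs⟩ := exists_split_merge hij hi hj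
  rw [← hl, splitAt_eq g hi (by rw [hl]; linarith), hs]

/-- Integration over `{(y, w) : y < w}` in the coordinates `(y, w - y)`. -/
theorem lintegral_lintegral_sub {ψ : ℝ × ℝ → ℝ≥0∞} (hψ : Measurable ψ) :
    ∫⁻ w : ℝ, ∫⁻ y : ℝ, ψ (y, w - y) = ∫⁻ p, ψ p := by
  have hm : Measurable fun p : ℝ × ℝ => ψ (p.2, p.1 - p.2) :=
    hψ.comp (measurable_snd.prodMk (measurable_fst.sub measurable_snd))
  rw [lintegral_lintegral_swap (f := fun w y => ψ (y, w - y)) hm.aemeasurable,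
    Measure.volume_eq_prod, lintegral_prod _ hψ.aemeasurable]
  refine lintegral_congr fun y => ?_
  exact lintegral_sub_right_eq_self (fun x => ψ (y, x)) y

variable {S : Type v} [MeasurableSpace S] {P : Measure S} {Z : S → Omega}

/-- The second-order Palm formula rewrites the merger flow, the first-order one the splitting flow.
After the change of coordinates (y, w - y), both are integrals over the quadrant against the
measures identified by `hbal`. What remains is that the integrands agree: splitting η + δ_{x₁+x₂} at
x₁ undoes the merger of x₁ and x₂ in η + δ_{x₁} + δ_{x₂}. -/
theorem palm_detailedBalance (hZ : Measurable Z) {K F : ℝ → ℝ → ℝ}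
    (hK : Measurable (quadRate K)) (hF : Measurable (quadRate F)) {r₁ : ℝ → ℝ≥0∞}
    {r₂ : ℝ × ℝ → ℝ≥0∞} {P₁ : Kernel ℝ Config} [IsMarkovKernel P₁]
    {P₂ : Kernel (ℝ × ℝ) Config} [IsMarkovKernel P₂]
    (hr₁ : Measurable r₁) (hr₂ : Measurable r₂)
    (h₁ : IsPalm₁ P Z r₁ P₁) (h₂ : IsPalm₂ P Z r₂ P₂)
    (hbal : ∀ᵐ z : ℝ × ℝ ∂(volume.restrict (Set.Ioi 0 ×ˢ Set.Ioi 0)),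
      (ENNReal.ofReal (K z.1 z.2) * r₂ z) • P₂ z =
        (ENNReal.ofReal (F z.1 z.2) * r₁ (z.1 + z.2)) • P₁ (z.1 + z.2)) :
    DetailedBalance (quadRate K) (quadRate F) (P.map Z) := by
  classical
  intro g hg
  obtain ⟨ρ, hρ, hρ'⟩ := exists_measurable_leftInverse_Xi
  have hQ : MeasurableSet (Set.Ioi (0 : ℝ) ×ˢ Set.Ioi (0 : ℝ)) :=
    measurableSet_Ioi.prod measurableSet_Ioi
  have hadd1 : Measurable fun p : (ℝ × ℝ) × Config => addPoint p.2 p.1.1 :=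
    measurable_addPoint.comp (measurable_snd.prodMk (measurable_fst.comp measurable_fst))
  have hadd2 : Measurable fun p : (ℝ × ℝ) × Config =>
      addPoint (addPoint p.2 p.1.1) p.1.2 :=
    measurable_addPoint.comp (hadd1.prodMk (measurable_snd.comp measurable_fst))
  rw [lintegral_map (measurable_mergeSum hK hg) hZ, lintegral_map (measurable_splitSum hF hg) hZ]
  -- the merger side
  have hm : Measurable fun p : (ℝ × ℝ) × Config => mergeAt g p.1 (ρ p.2) :=
    (measurable_mergeAt hg).comp (measurable_fst.prodMk (hρ.comp measurable_snd))
  have hL : ∫⁻ ω, mergeSum (quadRate K) (fun z' => g (Z ω, z')) (Z ω) ∂P =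
      ∫⁻ x in Set.Ioi 0 ×ˢ Set.Ioi 0, ∫⁻ η,
        mergeAt g x (ρ (addPoint (addPoint η x.1) x.2)) ∂((quadRate K x * r₂ x) • P₂ x) := by
    -- `ρ` recovers the state from its configuration, so the summand becomes a function of two
    -- values and the configuration.
    have := h₂ (fun p => quadRate K p.1 * mergeAt g p.1 (ρ p.2)) ((hK.comp measurable_fst).mul hm)
    refine Eq.trans ?_ (this.trans ?_)
    · refine lintegral_congr fun ω => tsum_congr fun p => ?_
      by_cases hp : p.1 ≠ p.2
      · by_cases hpos : 0 < (Z ω).1 p.1 ∧ 0 < (Z ω).1 p.2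
        · rw [if_pos hp, if_pos ⟨hp, hpos⟩, hρ', mergeAt_eq g hp hpos.1 hpos.2]
        · rw [if_pos hp, if_neg fun h => hpos h.2, quadRate_of_not_pos K hpos, zero_mul]
      · rw [if_neg hp, if_neg fun h => hp h.1, zero_mul]
    · refine lintegral_congr fun x => ?_
      have hmx : Measurable fun η => mergeAt g x (ρ (addPoint (addPoint η x.1) x.2)) :=
        (hm.comp (measurable_fst.prodMk hadd2)).comp
          ((measurable_const (a := x)).prodMk measurable_id)
      dsimp only
      rw [lintegral_smul_measure, smul_eq_mul, lintegral_const_mul _ hmx]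
      ring
  -- the splitting side
  have hs : Measurable fun p : (ℝ × ℝ) × Config => splitAt g p.1.1 p.1.2 (ρ p.2) :=
    (measurable_splitAt hg).comp (measurable_fst.prodMk (hρ.comp measurable_snd))
  have hs1 : Measurable fun p : (ℝ × ℝ) × Config =>
      splitAt g p.1.1 p.1.2 (ρ (addPoint p.2 p.1.1)) := hs.comp (measurable_fst.prodMk hadd1)
  have hI : Measurable fun p : ℝ × ℝ => ∫⁻ η, splitAt g p.1 p.2 (ρ (addPoint η p.1)) ∂P₁ p.1 := by
    have := Measurable.lintegral_kernel_prod_right'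
      (κ := P₁.comap Prod.fst (measurable_fst : Measurable (Prod.fst : ℝ × ℝ → ℝ))) hs1
    simpa only [Kernel.comap_apply] using this
  have hR : ∫⁻ ω, splitSum (quadRate F) (fun z' => g (z', Z ω)) (Z ω) ∂P =
      ∫⁻ x in Set.Ioi 0 ×ˢ Set.Ioi 0, ∫⁻ η,
        splitAt g (x.1 + x.2) x.1 (ρ (addPoint η (x.1 + x.2)))
          ∂((quadRate F x * r₁ (x.1 + x.2)) • P₁ (x.1 + x.2)) := by
    have hrate : Measurable fun p : ℝ × ℝ => quadRate F (p.2, p.1 - p.2) :=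
      hF.comp (measurable_snd.prodMk (measurable_fst.sub measurable_snd))
    have hG : Measurable fun p : ℝ × Config =>
        ∫⁻ y, quadRate F (y, p.1 - y) * splitAt g p.1 y (ρ p.2) := by
      refine Measurable.lintegral_prod_right' (f := fun q : (ℝ × Config) × ℝ =>
        quadRate F (q.2, q.1.1 - q.2) * splitAt g q.1.1 q.2 (ρ q.1.2)) ?_
      exact (hrate.comp ((measurable_fst.comp measurable_fst).prodMk measurable_snd)).mul
        (hs.comp (((measurable_fst.comp measurable_fst).prodMk measurable_snd).prodMk
          (measurable_snd.comp measurable_fst)))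
    have := h₁ _ hG
    refine Eq.trans ?_ (this.trans ?_)
    · refine lintegral_congr fun ω => tsum_congr fun i => ?_
      have hz : ∀ y, quadRate F (y, (Z ω).1 i - y) * g (split (Z ω) i y, Z ω) =
          quadRate F (y, (Z ω).1 i - y) * splitAt g ((Z ω).1 i) y (ρ (Xi (Z ω))) := fun y => by
        by_cases hy : 0 < y ∧ 0 < (Z ω).1 i - y
        · rw [hρ', splitAt_eq g hy.1 (sub_pos.1 hy.2)]
        · rw [quadRate_of_not_pos F hy, zero_mul, zero_mul]
      simp_rw [hz]
      split_ifs with hi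
      · rfl
      · refine lintegral_eq_zero_of_ae_eq_zero (Filter.Eventually.of_forall fun y => ?_)
        have : quadRate F (y, (Z ω).1 i - y) = 0 :=
          quadRate_of_not_pos F fun h => hi (by linarith [h.1, h.2])
        simp [this]
    · set ψ : ℝ × ℝ → ℝ≥0∞ := fun x => quadRate F x * r₁ (x.1 + x.2) *
        ∫⁻ η, splitAt g (x.1 + x.2) x.1 (ρ (addPoint η (x.1 + x.2))) ∂P₁ (x.1 + x.2) with hψ
      have hψm : Measurable ψ := (hF.mul (hr₁.comp (measurable_fst.add measurable_snd))).mul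
        (hI.comp ((measurable_fst.add measurable_snd).prodMk measurable_fst))
      have e1 : ∀ w, r₁ w * ∫⁻ η, (∫⁻ y, quadRate F (y, w - y) *
          splitAt g w y (ρ (addPoint η w))) ∂P₁ w = ∫⁻ y, ψ (y, w - y) := fun w => by
        have hsw : Measurable fun p : Config × ℝ =>
            quadRate F (p.2, w - p.2) * splitAt g w p.2 (ρ (addPoint p.1 w)) :=
          (hrate.comp (measurable_const.prodMk measurable_snd)).mul
            (hs1.comp ((measurable_const.prodMk measurable_snd).prodMk measurable_fst))
        have hsw' : ∀ y, Measurable fun η : Config => splitAt g w y (ρ (addPoint η w)) := fun y =>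
          hs1.comp ((measurable_const (a := ((w, y) : ℝ × ℝ))).prodMk measurable_id)
        rw [lintegral_lintegral_swap (f := fun η y => quadRate F (y, w - y) *
          splitAt g w y (ρ (addPoint η w))) hsw.aemeasurable, ← lintegral_const_mul]
        · refine lintegral_congr fun y => ?_
          simp only [hψ]
          rw [lintegral_const_mul _ (hsw' y), add_sub_cancel]
          ring
        · exact Measurable.lintegral_prod_left' hsw
      simp_rw [e1]
      -- The integrand vanishes for w ≤ 0, so the half-line may be replaced by ℝ before changing
      -- coordinates.
      have e2 : ∀ w ∉ Set.Ioi (0 : ℝ), ∫⁻ y, ψ (y, w - y) = 0 := fun w hw => by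
        refine lintegral_eq_zero_of_ae_eq_zero (Filter.Eventually.of_forall fun y => ?_)
        have : quadRate F (y, w - y) = 0 :=
          quadRate_of_not_pos F fun h => hw (Set.mem_Ioi.2 (by linarith [h.1, h.2]))
        simp [hψ, this]
      rw [← lintegral_indicator measurableSet_Ioi, Set.indicator_eq_self.2
        (fun w hw => by_contra fun h => hw (e2 w h)), lintegral_lintegral_sub hψm,
        ← lintegral_indicator hQ]
      refine lintegral_congr fun x => ?_
      by_cases hx : x ∈ Set.Ioi (0 : ℝ) ×ˢ Set.Ioi (0 : ℝ)
      · rw [Set.indicator_of_mem hx, lintegral_smul_measure, smul_eq_mul]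
      · rw [Set.indicator_of_notMem hx]
        have : quadRate F x = 0 := quadRate_of_not_pos F hx
        simp [hψ, this]
  rw [hL, hR]
  -- almost all configurations come from `Ω`
  have hgood : ∀ᵐ x ∂(volume.restrict (Set.Ioi (0 : ℝ) ×ˢ Set.Ioi (0 : ℝ))),
      r₂ x * P₂ x {η | addPoint (addPoint η x.1) x.2 ∉ Set.range Xi} = 0 := by
    have hB : MeasurableSet (Set.range Xi)ᶜ := measurableSet_range_Xi.compl
    have hBm : Measurable fun p : (ℝ × ℝ) × Config =>
        (Set.range Xi)ᶜ.indicator (1 : Config → ℝ≥0∞) p.2 :=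
      (measurable_one.indicator hB).comp measurable_snd
    -- The left side of this Palm formula is zero, because `Xi (Z ω)` always lies in the range.
    have := h₂ _ hBm
    simp only [Set.indicator_of_notMem (fun h => h (Set.mem_range_self _) :
      Xi _ ∉ (Set.range Xi)ᶜ), ite_self, tsum_zero, lintegral_zero] at this
    have hmeas : Measurable fun x : ℝ × ℝ => r₂ x * ∫⁻ η,
        (Set.range Xi)ᶜ.indicator (1 : Config → ℝ≥0∞) (addPoint (addPoint η x.1) x.2) ∂P₂ x :=
      hr₂.mul (Measurable.lintegral_kernel_prod_right'
        ((measurable_one.indicator hB).comp hadd2))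
    have hae := (lintegral_eq_zero_iff hmeas).1 this.symm
    filter_upwards [hae] with x hx
    have hset : MeasurableSet {η | addPoint (addPoint η x.1) x.2 ∉ Set.range Xi} :=
      (hadd2.comp (measurable_const.prodMk measurable_id)) hB
    rw [← lintegral_indicator_one hset]
    exact hx
  refine lintegral_congr_ae ?_
  filter_upwards [hgood, hbal, ae_restrict_mem hQ] with x hx hxb hxQ
  obtain ⟨hx1, hx2⟩ : 0 < x.1 ∧ 0 < x.2 := hxQ
  have hk : quadRate K x = ENNReal.ofReal (K x.1 x.2) := quadRate_of_pos K hx1 hx2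
  have hf : quadRate F x = ENNReal.ofReal (F x.1 x.2) := quadRate_of_pos F hx1 hx2
  rw [hf, ← hxb, ← hk]
  refine lintegral_congr_ae ?_
  have hnull : ((quadRate K x * r₂ x) • P₂ x)
      {η | addPoint (addPoint η x.1) x.2 ∉ Set.range Xi} = 0 := by
    rw [Measure.smul_apply, smul_eq_mul, mul_assoc, hx, mul_zero]
  have hnull' : ∀ᵐ η ∂((quadRate K x * r₂ x) • P₂ x),
      addPoint (addPoint η x.1) x.2 ∈ Set.range Xi := hnull
  filter_upwards [hnull'] with η hη
  obtain ⟨z, hz⟩ := hη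
  have hzm : pointMeasure z.1 = η.1 + Measure.dirac x.1 + Measure.dirac x.2 := by
    rw [← addPoint_val hx1, ← addPoint_val hx2, ← hz]
    rfl
  obtain ⟨i, j, hij, hi, hj⟩ := exists_entries_of_dirac hx1 hzm
  have hi0 : 0 < z.1 i := hi.symm ▸ hx1
  have hj0 : 0 < z.1 j := hj.symm ▸ hx2
  -- Thus the configuration with the merged point comes from Ω too, and `ρ` may be evaluated on it.
  have hme : Xi (merge z i j) = addPoint η (x.1 + x.2) := by
    apply Subtype.ext
    rw [addPoint_val (add_pos hx1 hx2)]
    apply add_dirac_cancel (x := x.1)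
    apply add_dirac_cancel (x := x.2)
    have := Xi_merge hij hi0 hj0
    rw [hi, hj, hzm] at this
    rw [Xi_val, this]
    abel
  rw [← hz, hρ', ← hme, hρ', show x = (z.1 i, z.1 j) by rw [hi, hj], mergeAt_eq g hij hi0 hj0]
  exact (splitAt_merge g hij hi0 hj0).symm

theorem isReversible_of_palm {lam : ℝ} {Hhat Hcheck : ℝ → ℝ → ℝ} (hlam : 0 ≤ lam)
    (h1 : IsHomogeneousKernel lam Hhat) (h1' : CondH1 Hhat) (h2 : IsHomogeneousKernel lam Hcheck)
    (h2' : CondH2 Hcheck) [IsProbabilityMeasure P] (hZ : Measurable Z) {r₁ : ℝ → ℝ≥0∞}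
    {r₂ : ℝ × ℝ → ℝ≥0∞} {P₁ : Kernel ℝ Config} [IsMarkovKernel P₁]
    {P₂ : Kernel (ℝ × ℝ) Config} [IsMarkovKernel P₂]
    (hr₁ : Measurable r₁) (hr₂ : Measurable r₂)
    (hp₁ : IsPalm₁ P Z r₁ P₁) (hp₂ : IsPalm₂ P Z r₂ P₂)
    (hbal : ∀ᵐ z : ℝ × ℝ ∂(volume.restrict (Set.Ioi 0 ×ˢ Set.Ioi 0)),
      (ENNReal.ofReal (coagRate Hhat z.1 z.2) * r₂ z) • P₂ z =
        (ENNReal.ofReal (fragRate Hcheck z.1 z.2) * r₁ (z.1 + z.2)) • P₁ (z.1 + z.2)) :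
    IsReversible.{u} (genL (coagRate Hhat) (fragRate Hcheck)) (P.map Z) :=
  isReversible_homogeneous hlam h1 h1' h2 h2'.lintegral_ne_top
    (palm_detailedBalance hZ (measurable_quadRate_coagRate h1) (measurable_quadRate_fragRate h2)
      hr₁ hr₂ hp₁ hp₂ hbal)

end CoagFrag

/-! ## Stick breaking -/

namespace CoagFrag

/-- Prepend an entry to a sequence. -/
def scons (a : ℝ) (w : ℕ → ℝ) : ℕ → ℝ
  | 0 => a
  | n + 1 => w n

/-- Break off the fraction `a` from a unit stick and distribute the rest according to `w`. -/
def breakOff (a : ℝ) (w : ℕ → ℝ) : ℕ → ℝ := scons a fun n => (1 - a) * w n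

theorem measurable_scons {α : Type*} [MeasurableSpace α] {f : α → ℝ} {g : α → ℕ → ℝ}
    (hf : Measurable f) (hg : Measurable g) : Measurable fun x => scons (f x) (g x) := by
  refine measurable_pi_lambda _ fun n => ?_
  cases n with
  | zero => exact hf
  | succ n => exact (measurable_pi_apply n).comp hg

theorem measurable_mul_seq {α : Type*} [MeasurableSpace α] {f : α → ℝ} {g : α → ℕ → ℝ}
    (hf : Measurable f) (hg : Measurable g) : Measurable fun x n => f x * g x n :=
  measurable_pi_lambda _ fun n => hf.mul ((measurable_pi_apply n).comp hg)

theorem measurable_breakOff {α : Type*} [MeasurableSpace α] {f : α → ℝ} {g : α → ℕ → ℝ}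
    (hf : Measurable f) (hg : Measurable g) : Measurable fun x => breakOff (f x) (g x) :=
  measurable_scons hf (measurable_mul_seq (measurable_const.sub hf) hg)

theorem measurable_stick : Measurable stick := by
  refine measurable_pi_lambda _ fun n => ?_
  exact (measurable_pi_apply n).mul (Finset.measurable_fun_prod _ fun j _ =>
    measurable_const.sub (measurable_pi_apply j))

theorem stick_scons (a : ℝ) (b : ℕ → ℝ) : stick (scons a b) = breakOff a (stick b) := by
  funext n
  cases n with
  | zero => simp [stick, scons, breakOff]
  | succ n =>
    simp only [stick, breakOff, scons, Finset.prod_range_succ']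
    ring

/-- It suffices to compare cylinders. Their coordinates are enlarged to an initial segment, with
trivial constraints, so that coordinate 0 can be separated from the rest. -/
theorem infinitePi_eq_map_scons (ν : Measure ℝ) [IsProbabilityMeasure ν] :
    Measure.infinitePi (fun _ : ℕ => ν) =
      (ν.prod (Measure.infinitePi fun _ : ℕ => ν)).map fun p => scons p.1 p.2 := by
  classical
  symm
  refine Measure.eq_infinitePi _ fun s t ht => ?_
  obtain ⟨N, hN⟩ : ∃ N, s ⊆ Finset.range (N + 1) := by
    refine ⟨s.sup id, fun i hi => Finset.mem_range.2 (Nat.lt_succ_of_le ?_)⟩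
    exact Finset.le_sup (f := id) hi
  set t' : ℕ → Set ℝ := fun i => if i ∈ s then t i else Set.univ with ht'
  have ht'm : ∀ i, MeasurableSet (t' i) := fun i => by
    rw [ht']
    dsimp only
    split_ifs
    exacts [ht i, MeasurableSet.univ]
  have e1 : Set.pi (s : Set ℕ) t = Set.pi (Finset.range (N + 1) : Set ℕ) t' := by
    ext w
    simp only [Set.mem_pi, ht']
    constructor
    · intro h i _
      split_ifs with hi
      exacts [h i hi, Set.mem_univ _]
    · intro h i hi
      have := h i (hN hi)
      rwa [if_pos (Finset.mem_coe.1 hi)] at this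
  have e2 : ∏ i ∈ s, ν (t i) = ∏ i ∈ Finset.range (N + 1), ν (t' i) := by
    rw [← Finset.prod_subset hN fun i _ hi => by simp [ht', hi]]
    exact Finset.prod_congr rfl fun i hi => by simp [ht', hi]
  have e3 : (fun p : ℝ × (ℕ → ℝ) => scons p.1 p.2) ⁻¹' Set.pi (Finset.range (N + 1) : Set ℕ) t' =
      t' 0 ×ˢ Set.pi (Finset.range N : Set ℕ) fun i => t' (i + 1) := by
    ext p
    simp only [Set.mem_preimage, Set.mem_pi, Finset.coe_range, Set.mem_Iio, Set.mem_prod]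
    constructor
    · intro h
      exact ⟨h 0 (Nat.succ_pos N), fun i hi => h (i + 1) (Nat.succ_lt_succ hi)⟩
    · rintro ⟨h0, h⟩ i hi
      cases i with
      | zero => exact h0
      | succ i => exact h i (Nat.lt_of_succ_lt_succ hi)
  rw [e1, e2, Measure.map_apply (measurable_scons measurable_fst measurable_snd)
    (MeasurableSet.pi (Finset.countable_toSet _) fun i _ => ht'm i), e3, Measure.prod_prod,
    Measure.infinitePi_pi _ (fun i _ => ht'm (i + 1)), Finset.prod_range_succ', mul_comm]

/-- A law on sequences that is invariant under breaking off a Beta(1,θ) fraction. -/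
structure IsGEM (θ : ℝ) (γ : Measure (ℕ → ℝ)) : Prop where
  isProb : IsProbabilityMeasure γ
  eq_map : γ = ((betaMeasure 1 θ).prod γ).map fun p => breakOff p.1 p.2

/-- The later fractions, independent of the first, build a copy of the whole sequence inside the
remaining stick. The size-biasing arguments use only this fixed-point equation. -/
theorem isGEM_stick {θ : ℝ} (hθ : 0 < θ) :
    IsGEM θ ((Measure.infinitePi fun _ : ℕ => betaMeasure 1 θ).map stick) := by
  have := isProbabilityMeasureBeta one_pos hθ
  refine ⟨Measure.isProbabilityMeasure_map measurable_stick.aemeasurable, ?_⟩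
  have h : Measure.map (fun p : ℝ × (ℕ → ℝ) => (p.1, stick p.2)) ((betaMeasure 1 θ).prod
      (Measure.infinitePi fun _ : ℕ => betaMeasure 1 θ)) =
      (betaMeasure 1 θ).prod ((Measure.infinitePi fun _ : ℕ => betaMeasure 1 θ).map stick) := by
    have := Measure.map_prod_map (betaMeasure 1 θ)
      (Measure.infinitePi fun _ : ℕ => betaMeasure 1 θ) measurable_id measurable_stick
    rw [Measure.map_id] at this
    exact this.symm
  have hm : Measurable fun p : ℝ × (ℕ → ℝ) => (p.1, stick p.2) :=
    measurable_fst.prodMk (measurable_stick.comp measurable_snd)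
  conv_lhs => rw [infinitePi_eq_map_scons]
  rw [← h, Measure.map_map measurable_stick (measurable_scons measurable_fst measurable_snd),
    Measure.map_map (measurable_breakOff measurable_fst measurable_snd) hm]
  congr 1
  funext p
  exact stick_scons p.1 p.2

/-! ### The Beta(1,θ) density and the mass that remains after finitely many breaks. -/

theorem betaPDF_one {θ : ℝ} (hθ : 0 < θ) (x : ℝ) : betaPDF 1 θ x =
    (Set.Ioo (0 : ℝ) 1).indicator (fun x => ENNReal.ofReal (θ * (1 - x) ^ (θ - 1))) x := by
  have hb : beta 1 θ = 1 / θ := by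
    rw [beta, Real.Gamma_one, add_comm, Real.Gamma_add_one hθ.ne', one_mul]
    have := (Real.Gamma_pos_of_pos hθ).ne'
    field_simp
  by_cases hx : x ∈ Set.Ioo (0 : ℝ) 1
  · rw [Set.indicator_of_mem hx, betaPDF_of_pos_lt_one hx.1 hx.2, hb]
    simp
  · rw [Set.indicator_of_notMem hx, betaPDF_eq,
      if_neg (show ¬(0 < x ∧ x < 1) from hx), ENNReal.ofReal_zero]

theorem lintegral_betaMeasure_one {θ : ℝ} (hθ : 0 < θ) {f : ℝ → ℝ≥0∞} (hf : Measurable f) :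
    ∫⁻ x, f x ∂betaMeasure 1 θ =
      ∫⁻ x in Set.Ioo (0 : ℝ) 1, ENNReal.ofReal (θ * (1 - x) ^ (θ - 1)) * f x := by
  have hm : Measurable (betaPDF 1 θ) := (measurable_betaPDFReal 1 θ).ennreal_ofReal
  rw [betaMeasure, lintegral_withDensity_eq_lintegral_mul _ hm hf,
    ← lintegral_indicator measurableSet_Ioo]
  refine lintegral_congr fun x => ?_
  rw [Pi.mul_apply, betaPDF_one hθ]
  by_cases hx : x ∈ Set.Ioo (0 : ℝ) 1 <;> simp [hx]

theorem ae_betaMeasure_one {θ : ℝ} (hθ : 0 < θ) :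
    ∀ᵐ x ∂betaMeasure 1 θ, x ∈ Set.Ioo (0 : ℝ) 1 := by
  have h := lintegral_betaMeasure_one hθ
    (f := (Set.Ioo (0 : ℝ) 1)ᶜ.indicator 1) (measurable_one.indicator measurableSet_Ioo.compl)
  rw [lintegral_indicator_one measurableSet_Ioo.compl] at h
  refine h.trans ?_
  rw [setLIntegral_congr_fun (g := fun _ => 0) measurableSet_Ioo fun x hx => by simp [hx]]
  simp

section GEM

variable {θ : ℝ} {γ : Measure (ℕ → ℝ)}

theorem IsGEM.lintegral_eq (hθ : 0 < θ) (hγ : IsGEM θ γ) {f : (ℕ → ℝ) → ℝ≥0∞}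
    (hf : Measurable f) :
    ∫⁻ w, f w ∂γ = ∫⁻ a, ∫⁻ w, f (breakOff a w) ∂γ ∂betaMeasure 1 θ := by
  have := hγ.isProb
  have := isProbabilityMeasureBeta one_pos hθ
  have hm : Measurable fun p : ℝ × (ℕ → ℝ) => breakOff p.1 p.2 :=
    measurable_breakOff measurable_fst measurable_snd
  conv_lhs => rw [hγ.eq_map]
  rw [lintegral_map hf hm]
  exact lintegral_prod _ (hf.comp hm).aemeasurable

theorem IsGEM.ae_of (hθ : 0 < θ) (hγ : IsGEM θ γ) {p : (ℕ → ℝ) → Prop}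
    (hp : MeasurableSet {w | p w}) (h : ∀ a ∈ Set.Ioo (0 : ℝ) 1, ∀ᵐ w ∂γ, p (breakOff a w)) :
    ∀ᵐ w ∂γ, p w := by
  have h1 := hγ.lintegral_eq hθ (f := {w | p w}ᶜ.indicator 1) (measurable_one.indicator hp.compl)
  rw [lintegral_indicator_one hp.compl] at h1
  refine h1.trans (lintegral_eq_zero_of_ae_eq_zero ?_)
  filter_upwards [ae_betaMeasure_one hθ] with a ha
  refine lintegral_eq_zero_of_ae_eq_zero ?_
  filter_upwards [h a ha] with w hw
  exact Set.indicator_of_notMem (Set.notMem_compl_iff.2 hw) _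

/-- The length of the stick that remains after breaking off the first `n` pieces. -/
def residual (n : ℕ) (w : ℕ → ℝ) : ℝ := 1 - ∑ i ∈ Finset.range n, w i

theorem measurable_residual (n : ℕ) : Measurable (residual n) :=
  measurable_const.sub (Finset.measurable_fun_sum _ fun i _ => measurable_pi_apply i)

theorem residual_breakOff (n : ℕ) (a : ℝ) (w : ℕ → ℝ) :
    residual (n + 1) (breakOff a w) = (1 - a) * residual n w := by
  simp only [residual, Finset.sum_range_succ', breakOff, scons, ← Finset.mul_sum]
  ring

theorem residual_succ (n : ℕ) (w : ℕ → ℝ) : residual n w = w n + residual (n + 1) w := by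
  simp only [residual, Finset.sum_range_succ]
  ring

theorem IsGEM.ae_pos (hθ : 0 < θ) (hγ : IsGEM θ γ) (n : ℕ) :
    ∀ᵐ w ∂γ, 0 < w n ∧ 0 ≤ residual n w := by
  have hm : ∀ n, MeasurableSet {w : ℕ → ℝ | 0 < w n ∧ 0 ≤ residual n w} := fun n =>
    (measurableSet_lt measurable_const (measurable_pi_apply n)).inter
      (measurableSet_le measurable_const (measurable_residual n))
  induction n with
  | zero =>
    refine hγ.ae_of hθ (hm 0) fun a ha => Filter.Eventually.of_forall fun w => ⟨ha.1, ?_⟩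
    simp [residual]
  | succ n ih =>
    refine hγ.ae_of hθ (hm (n + 1)) fun a ha => ?_
    filter_upwards [ih] with w hw
    have h1 : 0 < 1 - a := sub_pos.2 ha.2
    exact ⟨mul_pos h1 hw.1, by rw [residual_breakOff]; exact mul_nonneg h1.le hw.2⟩

theorem lintegral_one_sub_lt_one (hθ : 0 < θ) :
    ∫⁻ a, ENNReal.ofReal (1 - a) ∂betaMeasure 1 θ < 1 := by
  have := isProbabilityMeasureBeta one_pos hθ
  have hle : ∀ᵐ a ∂betaMeasure 1 θ, ENNReal.ofReal (1 - a) < 1 := by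
    filter_upwards [ae_betaMeasure_one hθ] with a ha
    rw [ENNReal.ofReal_lt_one]
    linarith [ha.1]
  have hone : ∫⁻ _, (1 : ℝ≥0∞) ∂betaMeasure 1 θ = 1 := by simp
  conv_rhs => rw [← hone]
  refine lintegral_strict_mono (IsProbabilityMeasure.ne_zero _) measurable_const.aemeasurable
    ?_ hle
  refine ne_top_of_le_ne_top (b := 1) (by simp) ?_
  conv_rhs => rw [← hone]
  exact lintegral_mono_ae (hle.mono fun a ha => ha.le)

/-- Each break multiplies the remaining mass by an independent factor 1 - a. -/
theorem IsGEM.lintegral_residual (hθ : 0 < θ) (hγ : IsGEM θ γ) (n : ℕ) :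
    ∫⁻ w, ENNReal.ofReal (residual n w) ∂γ =
      (∫⁻ a, ENNReal.ofReal (1 - a) ∂betaMeasure 1 θ) ^ n := by
  have := hγ.isProb
  induction n with
  | zero => simp [residual]
  | succ n ih =>
    rw [hγ.lintegral_eq hθ (measurable_residual _).ennreal_ofReal, pow_succ', ← ih,
      ← lintegral_mul_const _ (by fun_prop)]
    refine lintegral_congr_ae ?_
    filter_upwards [ae_betaMeasure_one hθ] with a ha
    simp_rw [residual_breakOff, ENNReal.ofReal_mul (sub_nonneg.2 ha.2.le)]
    exact lintegral_const_mul _ (measurable_residual n).ennreal_ofReal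

theorem IsGEM.tendsto_lintegral_residual (hθ : 0 < θ) (hγ : IsGEM θ γ) :
    Filter.Tendsto (fun n => ∫⁻ w, ENNReal.ofReal (residual n w) ∂γ) Filter.atTop (nhds 0) := by
  simp_rw [hγ.lintegral_residual hθ]
  exact ENNReal.tendsto_pow_atTop_nhds_zero_of_lt_one (lintegral_one_sub_lt_one hθ)

/-- The remaining masses decrease and their means tend to 0, so they tend to 0 almost surely. -/
theorem IsGEM.ae_hasSum (hθ : 0 < θ) (hγ : IsGEM θ γ) :
    ∀ᵐ w ∂γ, (∀ n, 0 < w n) ∧ HasSum w 1 := by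
  have hpos : ∀ᵐ w ∂γ, ∀ n, 0 < w n ∧ 0 ≤ residual n w :=
    ae_all_iff.2 fun n => hγ.ae_pos hθ n
  have hinf : ∀ᵐ w ∂γ, ⨅ n, ENNReal.ofReal (residual n w) = 0 := by
    have hm : Measurable fun w : ℕ → ℝ => ⨅ n, ENNReal.ofReal (residual n w) :=
      Measurable.iInf fun n => (measurable_residual n).ennreal_ofReal
    refine (lintegral_eq_zero_iff hm).1 (le_antisymm ?_ zero_le)
    refine ge_of_tendsto' (hγ.tendsto_lintegral_residual hθ) fun n => ?_
    exact lintegral_mono fun w => iInf_le _ n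
  filter_upwards [hpos, hinf] with w hw hi
  have h0 : ∀ n, 0 ≤ w n := fun n => (hw n).1.le
  refine ⟨fun n => (hw n).1, (hasSum_iff_tendsto_nat_of_nonneg h0 1).2 ?_⟩
  have hanti : Antitone fun n => ENNReal.ofReal (residual n w) :=
    antitone_nat_of_succ_le fun n => ENNReal.ofReal_le_ofReal (by
      rw [residual_succ n]
      linarith [h0 n])
  have h1 := tendsto_atTop_iInf hanti
  rw [hi] at h1
  have h2 := (ENNReal.tendsto_toReal ENNReal.zero_ne_top).comp h1
  have h3 : Filter.Tendsto (fun n => residual n w) Filter.atTop (nhds 0) := by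
    refine h2.congr fun n => ?_
    exact ENNReal.toReal_ofReal (hw n).2
  have h4 := h3.const_sub 1
  simpa [residual] using h4

end GEM

end CoagFrag

/-! ## Size-biased picks from stick-breaking sequences -/

namespace CoagFrag

/-- The sequence starting with `a`, `y` and continuing with `w` scaled to total mass
`1 - a - y`. -/
def twoSticks (a y : ℝ) (w : ℕ → ℝ) : ℕ → ℝ := scons a (scons y fun n => (1 - a - y) * w n)

theorem breakOff_breakOff (a u : ℝ) (w : ℕ → ℝ) :
    breakOff a (breakOff u w) = twoSticks a ((1 - a) * u) w := by
  funext n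
  rcases n with _ | _ | n
  · rfl
  · rfl
  · simp only [breakOff, twoSticks, scons]
    ring

theorem measurable_twoSticks {α : Type*} [MeasurableSpace α] {f g : α → ℝ} {h : α → ℕ → ℝ}
    (hf : Measurable f) (hg : Measurable g) (hh : Measurable h) :
    Measurable fun x => twoSticks (f x) (g x) (h x) :=
  measurable_scons hf (measurable_scons hg
    (measurable_mul_seq ((measurable_const.sub hf).sub hg) hh))

/-- Exchange the entries with indices `n` and `n + 1`. -/
def swapAdj (n : ℕ) (w : ℕ → ℝ) : ℕ → ℝ := w ∘ Equiv.swap n (n + 1)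

theorem measurable_swapAdj (n : ℕ) : Measurable (swapAdj n) :=
  measurable_pi_lambda _ fun _ => measurable_pi_apply _

theorem swapAdj_twoSticks (a y : ℝ) (w : ℕ → ℝ) :
    swapAdj 0 (twoSticks a y w) = twoSticks y a w := by
  funext n
  rcases n with _ | _ | n
  · simp [swapAdj, twoSticks, scons]
  · simp [swapAdj, twoSticks, scons]
  · have : Equiv.swap 0 (0 + 1) (n + 1 + 1) = n + 1 + 1 :=
      Equiv.swap_apply_of_ne_of_ne (by omega) (by omega)
    simp only [swapAdj, Function.comp_apply, this, twoSticks, scons]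
    ring

theorem swapAdj_breakOff (n : ℕ) (a : ℝ) (w : ℕ → ℝ) :
    swapAdj (n + 1) (breakOff a w) = breakOff a (swapAdj n w) := by
  funext k
  rcases k with _ | k
  · have : Equiv.swap (n + 1) (n + 1 + 1) 0 = 0 :=
      Equiv.swap_apply_of_ne_of_ne (by omega) (by omega)
    simp only [swapAdj, Function.comp_apply, this, breakOff, scons]
  · have : Equiv.swap (n + 1) (n + 1 + 1) (k + 1) = Equiv.swap n (n + 1) k + 1 := by
      simp only [Equiv.swap_apply_def]
      split_ifs <;> omega
    simp only [swapAdj, Function.comp_apply, this, breakOff, scons]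

/-- The size-biased density of the first two pieces of the stick. -/
noncomputable def twoDensity (θ : ℝ) : ℝ × ℝ → ℝ≥0∞ :=
  {p : ℝ × ℝ | 0 < p.1 ∧ 0 < p.2 ∧ p.1 + p.2 < 1}.indicator
    fun p => ENNReal.ofReal (θ ^ 2 * (1 - p.1 - p.2) ^ (θ - 1))

theorem measurable_twoDensity (θ : ℝ) : Measurable (twoDensity θ) := by
  refine Measurable.indicator (by fun_prop) ?_
  exact (measurableSet_lt measurable_const measurable_fst).inter
    ((measurableSet_lt measurable_const measurable_snd).inter
      (measurableSet_lt (measurable_fst.add measurable_snd) measurable_const))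

theorem twoDensity_swap (θ : ℝ) (p : ℝ × ℝ) : twoDensity θ p.swap = twoDensity θ p := by
  unfold twoDensity
  by_cases h : 0 < p.1 ∧ 0 < p.2 ∧ p.1 + p.2 < 1
  · rw [Set.indicator_of_mem (show p ∈ {p : ℝ × ℝ | 0 < p.1 ∧ 0 < p.2 ∧ p.1 + p.2 < 1} from h),
      Set.indicator_of_mem (show p.swap ∈ {p : ℝ × ℝ | 0 < p.1 ∧ 0 < p.2 ∧ p.1 + p.2 < 1} from
        ⟨h.2.1, h.1, by rw [Prod.fst_swap, Prod.snd_swap, add_comm]; exact h.2.2⟩)]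
    congr 3
    simp only [Prod.fst_swap, Prod.snd_swap]
    ring
  · rw [Set.indicator_of_notMem
        (show p ∉ {p : ℝ × ℝ | 0 < p.1 ∧ 0 < p.2 ∧ p.1 + p.2 < 1} from h),
      Set.indicator_of_notMem
        (show p.swap ∉ {p : ℝ × ℝ | 0 < p.1 ∧ 0 < p.2 ∧ p.1 + p.2 < 1} from
        fun h' => h ⟨h'.2.1, h'.1, by rw [add_comm]; exact h'.2.2⟩)]

/-- The weight 1 - a cancels the Jacobian of y = (1 - a)u, and (1 - a)(1 - u) = 1 - a - y. The
resulting density is symmetric in a and y, which is the source of all exchangeability below. -/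
theorem lintegral_two_betas {θ : ℝ} (hθ : 0 < θ) {φ : ℝ × ℝ → ℝ≥0∞} (hφ : Measurable φ) :
    ∫⁻ a, ENNReal.ofReal (1 - a) * ∫⁻ u, φ (a, (1 - a) * u) ∂betaMeasure 1 θ ∂betaMeasure 1 θ =
      ∫⁻ p, twoDensity θ p * φ p := by
  have := isProbabilityMeasureBeta one_pos hθ
  have hm : Measurable fun p : ℝ × ℝ => φ (p.1, (1 - p.1) * p.2) :=
    hφ.comp (measurable_fst.prodMk ((measurable_const.sub measurable_fst).mul measurable_snd))
  have hin : Measurable fun a : ℝ =>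
      ENNReal.ofReal (1 - a) * ∫⁻ u, φ (a, (1 - a) * u) ∂betaMeasure 1 θ :=
    (measurable_const.sub measurable_id).ennreal_ofReal.mul hm.lintegral_prod_right'
  have hout : Measurable fun p : ℝ × ℝ => twoDensity θ p * φ p := (measurable_twoDensity θ).mul hφ
  rw [lintegral_betaMeasure_one hθ hin, Measure.volume_eq_prod,
    lintegral_prod _ hout.aemeasurable,
    ← lintegral_indicator measurableSet_Ioo]
  refine lintegral_congr fun a => ?_
  by_cases ha : a ∈ Set.Ioo (0 : ℝ) 1
  · have h1 : 0 < 1 - a := sub_pos.2 ha.2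
    have hma : Measurable fun u => φ (a, (1 - a) * u) := hm.comp measurable_prodMk_left
    rw [Set.indicator_of_mem ha, lintegral_eq_mul_lintegral_comp_mul h1,
      lintegral_betaMeasure_one hθ hma,
      mul_left_comm, ← lintegral_indicator measurableSet_Ioo]
    congr 1
    rw [← lintegral_const_mul' _ _ ENNReal.ofReal_ne_top]
    refine lintegral_congr fun u => ?_
    by_cases hu : u ∈ Set.Ioo (0 : ℝ) 1
    · have h2 : 0 < 1 - u := sub_pos.2 hu.2
      have hmem : (a, (1 - a) * u) ∈ {p : ℝ × ℝ | 0 < p.1 ∧ 0 < p.2 ∧ p.1 + p.2 < 1} := by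
        refine ⟨ha.1, mul_pos h1 hu.1, ?_⟩
        change a + (1 - a) * u < 1
        nlinarith
      rw [Set.indicator_of_mem hu, twoDensity, Set.indicator_of_mem hmem, ← mul_assoc,
        ← ENNReal.ofReal_mul (by positivity)]
      congr 2
      rw [show 1 - (a, (1 - a) * u).1 - (a, (1 - a) * u).2 = (1 - a) * (1 - u) by ring,
        Real.mul_rpow h1.le h2.le]
      ring
    · rw [Set.indicator_of_notMem hu, mul_zero, twoDensity, Set.indicator_of_notMem, zero_mul]
      rintro ⟨-, h3, h4⟩
      change 0 < (1 - a) * u at h3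
      change a + (1 - a) * u < 1 at h4
      have h5 : 0 < u := (mul_pos_iff_of_pos_left h1).1 h3
      exact hu ⟨h5, by nlinarith⟩
  · rw [Set.indicator_of_notMem ha]
    refine (lintegral_eq_zero_of_ae_eq_zero (Filter.Eventually.of_forall fun y => ?_)).symm
    rw [twoDensity, Set.indicator_of_notMem]
    · simp
    · rintro ⟨h3, h4, h5⟩
      exact ha ⟨h3, by linarith [show a + y < 1 from h5, show 0 < y from h4]⟩

section GEM

variable {θ : ℝ} {γ : Measure (ℕ → ℝ)}

theorem IsGEM.lintegral_two (hθ : 0 < θ) (hγ : IsGEM θ γ) {f : (ℕ → ℝ) → ℝ≥0∞}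
    (hf : Measurable f) :
    ∫⁻ a, ENNReal.ofReal (1 - a) * ∫⁻ w, f (breakOff a w) ∂γ ∂betaMeasure 1 θ =
      ∫⁻ p, twoDensity θ p * ∫⁻ w, f (twoSticks p.1 p.2 w) ∂γ := by
  have := hγ.isProb
  have hm : Measurable fun q : (ℝ × ℝ) × (ℕ → ℝ) => f (twoSticks q.1.1 q.1.2 q.2) :=
    hf.comp (measurable_twoSticks (measurable_fst.comp measurable_fst)
      (measurable_snd.comp measurable_fst) measurable_snd)
  rw [← lintegral_two_betas hθ hm.lintegral_prod_right']
  refine lintegral_congr fun a => ?_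
  rw [hγ.lintegral_eq hθ (f := fun w => f (breakOff a w))
    (hf.comp (measurable_breakOff measurable_const measurable_id))]
  simp_rw [breakOff_breakOff]

/-- Exchanging two consecutive pieces, size-biased by the mass that remains after the first of
them. -/
theorem IsGEM.lintegral_swapAdj (hθ : 0 < θ) (hγ : IsGEM θ γ) (n : ℕ) :
    ∀ {f : (ℕ → ℝ) → ℝ≥0∞}, Measurable f →
      ∫⁻ w, ENNReal.ofReal (residual (n + 1) w) * f (swapAdj n w) ∂γ =
        ∫⁻ w, ENNReal.ofReal (residual (n + 1) w) * f w ∂γ := by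
  have := hγ.isProb
  -- Separating the first piece turns the mass left after n + 1 pieces into 1 - a times the mass
  -- left after n, which drives the induction.
  have hstep : ∀ (n : ℕ) (f : (ℕ → ℝ) → ℝ≥0∞), Measurable f →
      ∫⁻ w, ENNReal.ofReal (residual (n + 1) w) * f w ∂γ = ∫⁻ a, ENNReal.ofReal (1 - a) *
        ∫⁻ w, ENNReal.ofReal (residual n w) * f (breakOff a w) ∂γ ∂betaMeasure 1 θ := by
    intro n f hf
    have hm : Measurable fun w => ENNReal.ofReal (residual (n + 1) w) * f w :=
      (measurable_residual _).ennreal_ofReal.mul hf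
    rw [hγ.lintegral_eq hθ hm]
    refine lintegral_congr_ae ?_
    filter_upwards [ae_betaMeasure_one hθ] with a ha
    rw [← lintegral_const_mul' _ _ ENNReal.ofReal_ne_top]
    refine lintegral_congr fun w => ?_
    rw [residual_breakOff, ENNReal.ofReal_mul (sub_nonneg.2 ha.2.le), mul_assoc]
  induction n with
  | zero =>
    intro f hf
    have hf' : Measurable fun w => f (swapAdj 0 w) := hf.comp (measurable_swapAdj 0)
    rw [hstep 0 _ hf', hstep 0 _ hf]
    have h0 : ∀ w : ℕ → ℝ, residual 0 w = 1 := fun w => by simp [residual]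
    simp only [h0, ENNReal.ofReal_one, one_mul]
    -- Base case: exchanging the first two pieces is a reflection of their symmetric weighted
    -- density.
    rw [hγ.lintegral_two hθ hf', hγ.lintegral_two hθ hf]
    have hsw := (Measure.measurePreserving_swap (μ := (volume : Measure ℝ))
      (ν := (volume : Measure ℝ))).lintegral_comp_emb
      MeasurableEquiv.prodComm.measurableEmbedding
      (fun p : ℝ × ℝ => twoDensity θ p * ∫⁻ w, f (twoSticks p.1 p.2 w) ∂γ)
    rw [← Measure.volume_eq_prod] at hsw
    rw [← hsw]
    refine lintegral_congr fun p => ?_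
    simp only [twoDensity_swap, swapAdj_twoSticks, Prod.fst_swap, Prod.snd_swap]
  | succ n ih =>
    intro f hf
    have hf' : Measurable fun w => f (swapAdj (n + 1) w) := hf.comp (measurable_swapAdj _)
    rw [hstep (n + 1) _ hf', hstep (n + 1) _ hf]
    refine lintegral_congr fun a => ?_
    rw [← ih (f := fun w => f (breakOff a w))
      (hf.comp (measurable_breakOff measurable_const measurable_id))]
    simp_rw [swapAdj_breakOff]

/-- Invariance under size-biased picking: the first piece of the stick is a size-biased pick. -/
theorem IsGEM.sizeBiased (hθ : 0 < θ) (hγ : IsGEM θ γ) {F : ℕ → (ℕ → ℝ) → ℝ≥0∞}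
    (hF : ∀ n, Measurable (F n)) (hswap : ∀ n w, F n (swapAdj n w) = F (n + 1) w) :
    ∫⁻ w, ∑' i, ENNReal.ofReal (w i) * F i w ∂γ = ∫⁻ w, F 0 w ∂γ := by
  have hwm : ∀ i, Measurable fun w : ℕ → ℝ => ENNReal.ofReal (w i) := fun i =>
    (measurable_pi_apply i).ennreal_ofReal
  -- Telescoping: the residual splits into wₙ plus the next residual, and exchanging pieces n and n
  -- + 1 under the latter weight replaces Fₙ by Fₙ₊₁.
  have hpart : ∀ (F : ℕ → (ℕ → ℝ) → ℝ≥0∞), (∀ n, Measurable (F n)) →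
      (∀ n w, F n (swapAdj n w) = F (n + 1) w) → ∀ n, ∫⁻ w, F 0 w ∂γ =
        ∑ i ∈ Finset.range n, ∫⁻ w, ENNReal.ofReal (w i) * F i w ∂γ +
          ∫⁻ w, ENNReal.ofReal (residual n w) * F n w ∂γ := by
    intro F hF hswap n
    have hFm : ∀ i, Measurable fun w => ENNReal.ofReal (w i) * F i w := fun i => (hwm i).mul (hF i)
    induction n with
    | zero => simp [residual]
    | succ n ih =>
      rw [ih, Finset.sum_range_succ, add_assoc]
      congr 1
      have h1 := hγ.lintegral_swapAdj hθ n (hF n)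
      simp_rw [hswap n] at h1
      rw [h1, ← lintegral_add_left (hFm n)]
      refine lintegral_congr_ae ?_
      filter_upwards [hγ.ae_pos hθ n, hγ.ae_pos hθ (n + 1)] with w hw hw'
      rw [residual_succ n w, ENNReal.ofReal_add hw.1.le hw'.2, add_mul]
  have hFm : ∀ i, Measurable fun w => ENNReal.ofReal (w i) * F i w := fun i => (hwm i).mul (hF i)
  rw [lintegral_tsum fun i => (hFm i).aemeasurable]
  refine le_antisymm ?_ ?_
  · refine ENNReal.tsum_le_of_sum_range_le fun n => ?_
    rw [hpart F hF hswap n]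
    exact le_self_add
  -- The remainder need not vanish for unbounded F. Truncated at k it is at most k times the mean
  -- residual mass; monotone convergence then removes k.
  · have htrunc : ∀ k : ℕ, ∫⁻ w, min (F 0 w) k ∂γ ≤
        ∑' i, ∫⁻ w, ENNReal.ofReal (w i) * F i w ∂γ := by
      intro k
      have hlim : Filter.Tendsto (fun n => (∑' i, ∫⁻ w, ENNReal.ofReal (w i) * F i w ∂γ) +
          (∫⁻ w, ENNReal.ofReal (residual n w) ∂γ) * k) Filter.atTop
          (nhds ((∑' i, ∫⁻ w, ENNReal.ofReal (w i) * F i w ∂γ) + 0 * k)) :=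
        (ENNReal.Tendsto.mul_const (hγ.tendsto_lintegral_residual hθ)
          (Or.inr (ENNReal.natCast_ne_top k))).const_add _
      rw [zero_mul, add_zero] at hlim
      refine ge_of_tendsto' hlim fun n => ?_
      rw [hpart (fun n w => min (F n w) k) (fun n => (hF n).min measurable_const)
        (fun n w => by simp only [hswap]) n]
      refine add_le_add ((Finset.sum_le_sum fun i _ => ?_).trans (ENNReal.sum_le_tsum _)) ?_
      · exact lintegral_mono fun w => mul_le_mul_right (min_le_left _ _) _
      · rw [← lintegral_mul_const _ (measurable_residual n).ennreal_ofReal]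
        exact lintegral_mono fun w => mul_le_mul_right (min_le_right _ _) _
    have hsup : ∀ x : ℝ≥0∞, x = ⨆ k : ℕ, min x k := fun x => by
      have : ⨆ k : ℕ, (k : ℝ≥0∞) = ∞ := ENNReal.iSup_natCast
      rw [← inf_iSup_eq, this]
      simp
    calc ∫⁻ w, F 0 w ∂γ = ∫⁻ w, ⨆ k : ℕ, min (F 0 w) k ∂γ :=
          lintegral_congr fun w => hsup _
      _ = ⨆ k : ℕ, ∫⁻ w, min (F 0 w) k ∂γ := by
          refine lintegral_iSup (fun k => (hF 0).min measurable_const) fun a b hab w => ?_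
          exact min_le_min_left _ (by exact_mod_cast hab)
      _ ≤ _ := iSup_le htrunc

end GEM

end CoagFrag

/-! ## Ranking as a map on all sequences -/

namespace CoagFrag

/-- Sequences that can be ranked to an element of `Ω`. -/
def Rankable (w : ℕ → ℝ) : Prop := (∀ n, 0 ≤ w n) ∧ Summable w ∧ 0 < ∑' n, w n

theorem measurableSet_rankable : MeasurableSet {w : ℕ → ℝ | Rankable w} := by
  have hm : Measurable fun w : ℕ → ℝ => ∑' n, ENNReal.ofReal (w n) :=
    Measurable.tsum fun n => (measurable_pi_apply n).ennreal_ofReal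
  have : {w : ℕ → ℝ | Rankable w} = {w | ∀ n, 0 ≤ w n} ∩
      ({w | ∑' n, ENNReal.ofReal (w n) < ∞} ∩ {w | 0 < ∑' n, ENNReal.ofReal (w n)}) := by
    ext w
    constructor
    · rintro ⟨h0, hs, hp⟩
      have e := ENNReal.ofReal_tsum_of_nonneg h0 hs
      refine ⟨h0, ?_, ?_⟩
      · change ∑' n, ENNReal.ofReal (w n) < ∞
        rw [← e]
        exact ENNReal.ofReal_lt_top
      · change 0 < ∑' n, ENNReal.ofReal (w n)
        rw [← e]
        exact ENNReal.ofReal_pos.2 hp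
    · rintro ⟨h0, hs, hp⟩
      have h0' : ∀ n, 0 ≤ w n := h0
      have hs' : Summable w := (summable_iff_tsum_ofReal h0').2 (ne_of_lt hs)
      refine ⟨h0', hs', ?_⟩
      have hp' : 0 < ∑' n, ENNReal.ofReal (w n) := hp
      rw [← ENNReal.ofReal_tsum_of_nonneg h0' hs'] at hp'
      exact ENNReal.ofReal_pos.1 hp'
  rw [this]
  refine MeasurableSet.inter ?_ ((measurableSet_lt hm measurable_const).inter
    (measurableSet_lt measurable_const hm))
  have : {w : ℕ → ℝ | ∀ n, 0 ≤ w n} = ⋂ n, {w | 0 ≤ w n} := by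
    ext w
    simp
  rw [this]
  exact MeasurableSet.iInter fun n => measurableSet_le measurable_const (measurable_pi_apply n)

open Classical in
/-- The decreasing rearrangement of a rankable sequence, and `(1,0,0,…)` for other sequences. -/
noncomputable def ranked (w : ℕ → ℝ) : Omega :=
  if h : Rankable w then rank w h.1 h.2.1 h.2.2 else unitPoint.1

theorem ranked_of {w : ℕ → ℝ} (h : Rankable w) : ranked w = rank w h.1 h.2.1 h.2.2 := dif_pos h

theorem measurable_ranked : Measurable ranked := by
  classical
  set T : (ℕ → ℝ) → ℕ → ℝ := fun w => if Rankable w then w else unitPoint.1.1 with hT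
  have hTm : Measurable T := Measurable.ite measurableSet_rankable measurable_id measurable_const
  have hT' : ∀ w, Rankable (T w) := fun w => by
    rw [hT]
    dsimp only
    split_ifs with h
    · exact h
    · exact unitPoint.1.2.2
  refine measurable_to_omega fun n => ?_
  have : (fun w => (ranked w).1 n) = fun w => decr (T w) n := by
    funext w
    rw [ranked, hT]
    dsimp only
    split_ifs with h
    · rfl
    · rw [decr_omega]
  rw [this]
  exact measurable_decr (fun i => (measurable_pi_apply i).comp hTm) (fun w => (hT' w).1)
    (fun w => (hT' w).2.1) n

theorem pointMeasure_ranked {w : ℕ → ℝ} (h : Rankable w) :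
    pointMeasure (ranked w).1 = pointMeasure w := by
  rw [ranked_of h]
  exact pointMeasure_decr h.1 h.2.1

theorem pointMeasure_comp_equiv (w : ℕ → ℝ) (σ : ℕ ≃ ℕ) :
    pointMeasure (w ∘ σ) = pointMeasure w := by
  ext B hB
  rw [pointMeasure_apply _ hB, pointMeasure_apply _ hB]
  exact σ.tsum_eq fun i => (Set.Ioi 0).indicator (B.indicator 1) (w i)

theorem rankable_comp_equiv {w : ℕ → ℝ} (σ : ℕ ≃ ℕ) : Rankable (w ∘ σ) ↔ Rankable w := by
  have h1 : (∀ n, 0 ≤ (w ∘ σ) n) ↔ ∀ n, 0 ≤ w n := σ.forall_congr_left.trans (by simp)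
  have h2 : Summable (w ∘ σ) ↔ Summable w := σ.summable_iff
  have h3 : ∑' n, (w ∘ σ) n = ∑' n, w n := σ.tsum_eq w
  rw [Rankable, Rankable, h1, h2, h3]

theorem ranked_comp_equiv (w : ℕ → ℝ) (σ : ℕ ≃ ℕ) : ranked (w ∘ σ) = ranked w := by
  by_cases h : Rankable w
  · apply omega_ext
    rw [pointMeasure_ranked h, pointMeasure_ranked ((rankable_comp_equiv σ).2 h),
      pointMeasure_comp_equiv]
  · rw [ranked, ranked, dif_neg h, dif_neg fun h' => h ((rankable_comp_equiv σ).1 h')]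

theorem tsum_eq_of_pointMeasure {w w' : ℕ → ℝ} (h : pointMeasure w = pointMeasure w')
    {f : ℝ → ℝ≥0∞} (hf : ∀ x, x ≤ 0 → f x = 0) : ∑' i, f (w i) = ∑' i, f (w' i) := by
  have hi : (Set.Ioi 0).indicator f = f := Set.indicator_eq_self.2 fun x hx =>
    not_le.1 fun hx' => hx (hf x hx')
  have := congrArg (fun ν => ∫⁻ x, f x ∂ν) h
  simpa only [lintegral_pointMeasure, hi] using this

theorem pointMeasure_update_zero (w : ℕ → ℝ) {i : ℕ} (hi : 0 < w i) :
    pointMeasure (Function.update w i 0) + Measure.dirac (w i) = pointMeasure w := by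
  ext B hB
  rw [Measure.add_apply, pointMeasure_apply _ hB, pointMeasure_apply _ hB,
    Measure.dirac_apply' _ hB]
  have h1 := tsum_update_add ((Set.Ioi 0).indicator (B.indicator 1)) w i 0
  rw [Set.indicator_of_notMem Set.self_notMem_Ioi, add_zero,
    Set.indicator_of_mem (show w i ∈ Set.Ioi 0 from hi)] at h1
  exact h1

open Classical in
/-- Sums over pairs of distinct entries depend on the point measure only. -/
theorem tsum_pairs_eq_of_pointMeasure {w w' : ℕ → ℝ} (h : pointMeasure w = pointMeasure w')
    {f : ℝ × ℝ → ℝ≥0∞} (hf : ∀ x y, ¬ (0 < x ∧ 0 < y) → f (x, y) = 0) :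
    ∑' i, ∑' j, (if i ≠ j then f (w i, w j) else 0) =
      ∑' i, ∑' j, (if i ≠ j then f (w' i, w' j) else 0) := by
  -- `R x` is the configuration with one point at x removed. It makes the inner sum over j ≠ i a
  -- function of the value wᵢ and the configuration.
  set R : ℝ → Measure ℝ := fun x =>
    if h : ∃ η, η + Measure.dirac x = pointMeasure w then h.choose else 0 with hR
  have key : ∀ w'' : ℕ → ℝ, pointMeasure w'' = pointMeasure w →
      ∀ i, ∑' j, (if i ≠ j then f (w'' i, w'' j) else 0) =
        (Set.Ioi 0).indicator (fun x => ∫⁻ y, f (x, y) ∂(R x)) (w'' i) := by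
    intro w'' hw'' i
    by_cases hi : 0 < w'' i
    · have h1 : pointMeasure (Function.update w'' i 0) + Measure.dirac (w'' i) =
          pointMeasure w := (pointMeasure_update_zero w'' hi).trans hw''
      have h2 : ∃ η, η + Measure.dirac (w'' i) = pointMeasure w := ⟨_, h1⟩
      have h3 : R (w'' i) = pointMeasure (Function.update w'' i 0) := by
        rw [hR]
        dsimp only
        rw [dif_pos h2]
        exact add_dirac_cancel (h2.choose_spec.trans h1.symm)
      rw [Set.indicator_of_mem (show w'' i ∈ Set.Ioi 0 from hi), h3, lintegral_pointMeasure]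
      refine tsum_congr fun j => ?_
      by_cases hij : i = j
      · subst hij
        simp
      · rw [if_pos hij, Function.update_of_ne (Ne.symm hij)]
        by_cases hj : 0 < w'' j
        · rw [Set.indicator_of_mem (show w'' j ∈ Set.Ioi 0 from hj)]
        · rw [Set.indicator_of_notMem (show w'' j ∉ Set.Ioi 0 from hj), hf _ _ fun h => hj h.2]
    · rw [Set.indicator_of_notMem (show w'' i ∉ Set.Ioi 0 from hi), ENNReal.tsum_eq_zero]
      intro j
      rw [hf _ _ fun h => hi h.1, ite_self]
  simp_rw [key w rfl, key w' h.symm, ← lintegral_pointMeasure, h]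

/-! ## Size-biased sampling of one and of two pieces -/

section GEM

variable {θ : ℝ} {γ : Measure (ℕ → ℝ)}

/-- A piece picked with probability equal to its size may be taken to be the first one, since F
ignores the order of the sequence. -/
theorem IsGEM.lintegral_one_piece (hθ : 0 < θ) (hγ : IsGEM θ γ) {F : ℝ → (ℕ → ℝ) → ℝ≥0∞}
    (hF : Measurable fun p : ℝ × (ℕ → ℝ) => F p.1 p.2)
    (hswap : ∀ n a w, F a (swapAdj n w) = F a w) :
    ∫⁻ w, ∑' i, ENNReal.ofReal (w i) * F (w i) w ∂γ =
      ∫⁻ a, ∫⁻ w, F a (breakOff a w) ∂γ ∂betaMeasure 1 θ := by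
  have hFi : ∀ i, Measurable fun w : ℕ → ℝ => F (w i) w := fun i => by
    have hp : Measurable fun w : ℕ → ℝ => (w i, w) := (measurable_pi_apply i).prodMk measurable_id
    exact hF.comp hp
  rw [hγ.sizeBiased hθ (F := fun i w => F (w i) w) hFi fun n w => ?_, hγ.lintegral_eq hθ (hFi 0)]
  · rfl
  · rw [hswap]
    simp [swapAdj]

-- Size-biased picking is applied twice: to the whole sequence, and then, given the first piece, to
-- the copy that fills the rest.
open Classical in
theorem IsGEM.lintegral_two_pieces (hθ : 0 < θ) (hγ : IsGEM θ γ)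
    {F : ℝ × ℝ → (ℕ → ℝ) → ℝ≥0∞} (hF : Measurable fun p : (ℝ × ℝ) × (ℕ → ℝ) => F p.1 p.2)
    (hswap : ∀ n a w, F a (swapAdj n w) = F a w) :
    ∫⁻ w, ∑' i, ENNReal.ofReal (w i) *
        ∑' j, (if i ≠ j then ENNReal.ofReal (w j) * F (w i, w j) w else 0) ∂γ =
      ∫⁻ p, twoDensity θ p * ∫⁻ w, F p (twoSticks p.1 p.2 w) ∂γ := by
  have hFij : ∀ i j, Measurable fun w : ℕ → ℝ => F (w i, w j) w := fun i j => by
    have hp : Measurable fun w : ℕ → ℝ => ((w i, w j), w) :=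
      ((measurable_pi_apply i).prodMk (measurable_pi_apply j)).prodMk measurable_id
    exact hF.comp hp
  set G : ℕ → (ℕ → ℝ) → ℝ≥0∞ := fun i w =>
    ∑' j, (if i ≠ j then ENNReal.ofReal (w j) * F (w i, w j) w else 0) with hG
  have hGm : ∀ i, Measurable (G i) := fun i => Measurable.tsum fun j => by
    split_ifs
    · exact (measurable_pi_apply j).ennreal_ofReal.mul (hFij i j)
    · exact measurable_const
  have hGs : ∀ n w, G n (swapAdj n w) = G (n + 1) w := fun n w => by
    simp only [hG]
    -- Reindexing by the transposition maps the excluded index n to n + 1.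
    rw [← (Equiv.swap n (n + 1)).tsum_eq]
    refine tsum_congr fun j => ?_
    have e1 : swapAdj n w n = w (n + 1) := by simp [swapAdj]
    have e2 : swapAdj n w (Equiv.swap n (n + 1) j) = w j := by simp [swapAdj]
    have e3 : n ≠ Equiv.swap n (n + 1) j ↔ n + 1 ≠ j := by
      rw [Ne, Ne, ← Equiv.swap_apply_eq_iff, Equiv.swap_apply_left]
    rw [e1, e2, hswap]
    simp only [e3]
  have h2 := hγ.lintegral_two hθ (f := fun w => F (w 0, w 1) w) (hFij 0 1)
  change _ = ∫⁻ p, twoDensity θ p * ∫⁻ w, F p (twoSticks p.1 p.2 w) ∂γ at h2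
  rw [hγ.sizeBiased hθ hGm hGs, hγ.lintegral_eq hθ (hGm 0), ← h2]
  refine lintegral_congr fun a => ?_
  have hFa : ∀ j, Measurable fun w : ℕ → ℝ => F (a, (1 - a) * w j) (breakOff a w) := fun j =>
    hF.comp ((measurable_const.prodMk (measurable_const.mul (measurable_pi_apply j))).prodMk
      (measurable_breakOff measurable_const measurable_id))
  -- The second pick is made from the remainder, where an exchange is an exchange of the whole
  -- sequence shifted by one.
  have h1 := hγ.sizeBiased hθ (F := fun j w => F (a, (1 - a) * w j) (breakOff a w)) hFa
    fun n w => by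
      rw [← swapAdj_breakOff, hswap]
      simp [swapAdj]
  change _ = ENNReal.ofReal (1 - a) * ∫⁻ w, F (a, (1 - a) * w 0) (breakOff a w) ∂γ
  rw [← h1, ← lintegral_const_mul' _ _ ENNReal.ofReal_ne_top]
  refine lintegral_congr_ae ?_
  filter_upwards [hγ.ae_hasSum hθ] with w hw
  simp only [hG]
  -- Index 0 is the first pick and is excluded; index j + 1 carries the mass (1 - a) wⱼ.
  rw [tsum_eq_zero_add' ENNReal.summable, if_neg (not_not.2 rfl), zero_add,
    ← ENNReal.tsum_mul_left]
  refine tsum_congr fun j => ?_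
  rw [if_pos (Nat.succ_ne_zero j).symm, ← mul_assoc, ← ENNReal.ofReal_mul' (hw.1 j).le]
  rfl

end GEM

end CoagFrag

/-! ## Detailed balance for dilated Poisson–Dirichlet laws -/

namespace CoagFrag

theorem pointMeasure_scons (a : ℝ) (w : ℕ → ℝ) (ha : 0 < a) :
    pointMeasure (scons a w) = pointMeasure w + Measure.dirac a := by
  ext B hB
  rw [Measure.add_apply, pointMeasure_apply _ hB, pointMeasure_apply _ hB,
    Measure.dirac_apply' _ hB, tsum_eq_zero_add' ENNReal.summable, add_comm]
  congr 1
  exact Set.indicator_of_mem (show a ∈ Set.Ioi 0 from ha) _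

theorem mul_scons (v a : ℝ) (w : ℕ → ℝ) :
    (fun n => v * scons a w n) = scons (v * a) fun n => v * w n := by
  funext n
  cases n <;> rfl

theorem hasSum_scons {w : ℕ → ℝ} {m : ℝ} (h : HasSum w m) (a : ℝ) :
    HasSum (scons a w) (a + m) := by
  have := (hasSum_nat_add_iff (f := scons a w) 1).1 h
  rwa [Finset.sum_range_one, add_comm] at this

theorem rankable_mul {v m : ℝ} (hv : 0 < v) {w : ℕ → ℝ} (h0 : ∀ n, 0 < w n) (h : HasSum w m) :
    Rankable fun n => v * w n := by
  refine ⟨fun n => (mul_pos hv (h0 n)).le, h.summable.mul_left v, ?_⟩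
  rw [tsum_mul_left]
  exact mul_pos hv (h.summable.tsum_pos (fun n => (h0 n).le) 0 (h0 0))

theorem scons_pos {a : ℝ} {w : ℕ → ℝ} (ha : 0 < a) (hw : ∀ n, 0 < w n) (n : ℕ) :
    0 < scons a w n := by
  cases n
  exacts [ha, hw _]

/-- Merging the first two pieces of the stick. -/
theorem exists_ranked_twoSticks {v a y m : ℝ} (hv : 0 < v) (ha : 0 < a) (hy : 0 < y)
    (hay : a + y < 1) {w : ℕ → ℝ} (h0 : ∀ n, 0 < w n) (h : HasSum w m) :
    ∃ i j, i ≠ j ∧ (ranked fun n => v * twoSticks a y w n).1 i = v * a ∧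
      (ranked fun n => v * twoSticks a y w n).1 j = v * y ∧
      (ranked fun n => v * breakOff (a + y) w n) =
        merge (ranked fun n => v * twoSticks a y w n) i j := by
  have hr : 0 < 1 - a - y := by linarith
  have h0' : ∀ n, 0 < (1 - a - y) * w n := fun n => mul_pos hr (h0 n)
  have hs' : HasSum (fun n => (1 - a - y) * w n) ((1 - a - y) * m) := h.mul_left _
  have r2 : Rankable fun n => v * twoSticks a y w n :=
    rankable_mul hv (scons_pos ha (scons_pos hy h0')) (hasSum_scons (hasSum_scons hs' y) a)
  -- Both sequences have the same tail and differ only in their leading points.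
  have eb : breakOff (a + y) w = scons (a + y) fun n => (1 - a - y) * w n := by
    rw [breakOff, sub_sub]
  have r1 : Rankable fun n => v * breakOff (a + y) w n := by
    rw [eb]
    exact rankable_mul hv (scons_pos (add_pos ha hy) h0') (hasSum_scons hs' _)
  have p2 := pointMeasure_ranked r2
  rw [twoSticks, mul_scons, mul_scons, pointMeasure_scons _ _ (mul_pos hv ha),
    pointMeasure_scons _ _ (mul_pos hv hy), add_right_comm] at p2
  have p1 := pointMeasure_ranked r1
  rw [eb, mul_scons, pointMeasure_scons _ _ (mul_pos hv (add_pos ha hy)), mul_add] at p1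
  obtain ⟨i, j, hij, hi, hj⟩ := exists_entries_of_dirac (mul_pos hv ha) p2
  have hi' : (ranked fun n => v * twoSticks a y w n).1 i = v * a := by
    rw [← hi, twoSticks, mul_scons, mul_scons]
  have hj' : (ranked fun n => v * twoSticks a y w n).1 j = v * y := by
    rw [← hj, twoSticks, mul_scons, mul_scons]
  refine ⟨i, j, hij, hi', hj', merge_unique hij ?_ ?_ ?_⟩
  · rw [hi']
    exact mul_pos hv ha
  · rw [hj']
    exact mul_pos hv hy
  · rw [hi', hj', eb, mul_scons, mul_add, twoSticks, mul_scons, mul_scons, p2, p1]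
    abel

section

variable {θ lam : ℝ} {γ : Measure (ℕ → ℝ)} {H : ℝ → ℝ → ℝ}

theorem IsHomogeneousKernel.measurable_quadRate (hH : IsHomogeneousKernel lam H) :
    Measurable (quadRate H) := by
  have : quadRate H = fun p => ENNReal.ofReal
      ((Set.Ioi (0 : ℝ) ×ˢ Set.Ioi (0 : ℝ)).indicator (fun p => H p.1 p.2) p) := by
    funext p
    by_cases hp : p ∈ Set.Ioi (0 : ℝ) ×ˢ Set.Ioi (0 : ℝ)
    · simp only [quadRate, Set.indicator_of_mem hp]
    · simp only [quadRate, Set.indicator_of_notMem hp, ENNReal.ofReal_zero]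
  rw [this]
  exact hH.measurable.ennreal_ofReal

theorem quadRate_coagRate_mul {v x y : ℝ} (hv : 0 < v) (hx : 0 < x) (hy : 0 < y) :
    quadRate (coagRate H) (v * x, v * y) = ENNReal.ofReal (v ^ 2) *
      (ENNReal.ofReal x * (ENNReal.ofReal y * quadRate H (v * x, v * y))) := by
  rw [quadRate_of_pos _ (mul_pos hv hx) (mul_pos hv hy),
    quadRate_of_pos _ (mul_pos hv hx) (mul_pos hv hy), ← ENNReal.ofReal_mul hy.le,
    ← ENNReal.ofReal_mul hx.le, ← ENNReal.ofReal_mul (sq_nonneg v), coagRate]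
  congr 1
  ring

theorem quadRate_fragRate_mul (hθ : 0 < θ) {v x y : ℝ} (hv : 0 < v) (hx : 0 < x) (hy : 0 < y) :
    quadRate (fragRate fun x y => θ * H x y) (v * x, v * y) = ENNReal.ofReal v *
      (ENNReal.ofReal (x + y) * (ENNReal.ofReal θ * quadRate H (v * x, v * y))) := by
  rw [quadRate_of_pos _ (mul_pos hv hx) (mul_pos hv hy),
    quadRate_of_pos _ (mul_pos hv hx) (mul_pos hv hy), ← ENNReal.ofReal_mul hθ.le,
    ← ENNReal.ofReal_mul (add_pos hx hy).le, ← ENNReal.ofReal_mul hv.le, fragRate]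
  congr 1
  ring

/-- The total rate of the mergers, as an integral over two size-biased pieces. -/
theorem IsGEM.lintegral_mergeSum (hθ : 0 < θ) (hγ : IsGEM θ γ) (hH : IsHomogeneousKernel lam H)
    {v : ℝ} (hv : 0 < v) {g : Omega × Omega → ℝ≥0∞} (hg : Measurable g) :
    ∫⁻ w, mergeSum (quadRate (coagRate H)) (fun z' => g (ranked fun n => v * w n, z'))
        (ranked fun n => v * w n) ∂γ =
      ENNReal.ofReal (v ^ 2) * ∫⁻ p, twoDensity θ p * ∫⁻ w, quadRate H (v * p.1, v * p.2) *
        mergeAt g (v * p.1, v * p.2) (ranked fun n => v * twoSticks p.1 p.2 w n) ∂γ := by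
  classical
  have hR : Measurable fun w : ℕ → ℝ => ranked fun n => v * w n :=
    measurable_ranked.comp (measurable_mul_seq measurable_const measurable_id)
  have hsc : Measurable fun p : ℝ × ℝ => (v * p.1, v * p.2) := by fun_prop
  have hF : Measurable fun p : (ℝ × ℝ) × (ℕ → ℝ) => quadRate H (v * p.1.1, v * p.1.2) *
      mergeAt g (v * p.1.1, v * p.1.2) (ranked fun n => v * p.2 n) := by
    have h1 : Measurable fun p : (ℝ × ℝ) × (ℕ → ℝ) =>
        ((v * p.1.1, v * p.1.2), ranked fun n => v * p.2 n) :=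
      (hsc.comp measurable_fst).prodMk (hR.comp measurable_snd)
    exact (hH.measurable_quadRate.comp (hsc.comp measurable_fst)).mul
      ((measurable_mergeAt hg).comp h1)
  -- The factor xy of the coagulation rate is a double size-bias; ranking supplies the required
  -- invariance under exchanges.
  have key := hγ.lintegral_two_pieces hθ (F := fun p w => quadRate H (v * p.1, v * p.2) *
      mergeAt g (v * p.1, v * p.2) (ranked fun n => v * w n)) hF fun n p w => by
    have : (fun k => v * swapAdj n w k) = (fun k => v * w k) ∘ Equiv.swap n (n + 1) := rfl
    rw [this, ranked_comp_equiv]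
  rw [← key, ← lintegral_const_mul' _ _ ENNReal.ofReal_ne_top]
  refine lintegral_congr_ae ?_
  filter_upwards [hγ.ae_hasSum hθ] with w hw
  set z := ranked fun n => v * w n with hz
  have hzw : pointMeasure z.1 = pointMeasure fun n => v * w n :=
    pointMeasure_ranked (rankable_mul hv hw.1 hw.2)
  have e1 : mergeSum (quadRate (coagRate H)) (fun z' => g (z, z')) z =
      ∑' i, ∑' j, (if i ≠ j then (fun p => quadRate (coagRate H) p * mergeAt g p z)
        (z.1 i, z.1 j) else 0) := by
    rw [mergeSum, ENNReal.tsum_prod']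
    refine tsum_congr fun i => tsum_congr fun j => ?_
    dsimp only
    split_ifs with hij
    · by_cases hp : 0 < z.1 i ∧ 0 < z.1 j
      · rw [mergeAt_eq g hij hp.1 hp.2]
      · rw [quadRate_of_not_pos _ hp, zero_mul, zero_mul]
    · rw [zero_mul]
  -- Expressed through values, the sum over ranked entries equals the sum over unranked ones.
  rw [e1, tsum_pairs_eq_of_pointMeasure hzw
    (f := fun p => quadRate (coagRate H) p * mergeAt g p z) fun x y hxy => by
    rw [quadRate_of_not_pos _ hxy, zero_mul], ← ENNReal.tsum_mul_left]
  refine tsum_congr fun i => ?_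
  rw [← ENNReal.tsum_mul_left, ← ENNReal.tsum_mul_left]
  refine tsum_congr fun j => ?_
  split_ifs with hij
  · rw [quadRate_coagRate_mul hv (hw.1 i) (hw.1 j)]
    ring
  · simp

/-- The total rate of the splittings, as an integral over two size-biased pieces. -/
theorem IsGEM.lintegral_splitSum (hθ : 0 < θ) (hγ : IsGEM θ γ) (hH : IsHomogeneousKernel lam H)
    {v : ℝ} (hv : 0 < v) {g : Omega × Omega → ℝ≥0∞} (hg : Measurable g) :
    ∫⁻ w, splitSum (quadRate (fragRate fun x y => θ * H x y))
        (fun z' => g (z', ranked fun n => v * w n)) (ranked fun n => v * w n) ∂γ =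
      ENNReal.ofReal (v ^ 2) * ∫⁻ p, twoDensity θ p * ∫⁻ w, quadRate H (v * p.1, v * p.2) *
        splitAt g (v * (p.1 + p.2)) (v * p.1) (ranked fun n => v * breakOff (p.1 + p.2) w n)
          ∂γ := by
  have := hγ.isProb
  have hR : Measurable fun w : ℕ → ℝ => ranked fun n => v * w n :=
    measurable_ranked.comp (measurable_mul_seq measurable_const measurable_id)
  have hq : Measurable fun p : ℝ × ℝ => quadRate H (v * p.2, v * (p.1 - p.2)) :=
    hH.measurable_quadRate.comp ((measurable_const.mul measurable_snd).prodMk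
      (measurable_const.mul (measurable_fst.sub measurable_snd)))
  -- the integrand, in terms of the piece that is split, its first part and the configuration
  have hG : Measurable fun p : (ℝ × ℝ) × (ℕ → ℝ) => quadRate H (v * p.1.2, v * (p.1.1 - p.1.2)) *
      splitAt g (v * p.1.1) (v * p.1.2) (ranked fun n => v * p.2 n) := by
    have h1 : Measurable fun p : (ℝ × ℝ) × (ℕ → ℝ) =>
        ((v * p.1.1, v * p.1.2), ranked fun n => v * p.2 n) :=
      ((measurable_const.mul (measurable_fst.comp measurable_fst)).prodMk
        (measurable_const.mul (measurable_snd.comp measurable_fst))).prodMk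
        (hR.comp measurable_snd)
    exact (hq.comp measurable_fst).mul ((measurable_splitAt hg).comp h1)
  have hF : Measurable fun p : ℝ × (ℕ → ℝ) => ENNReal.ofReal θ *
      ∫⁻ y, quadRate H (v * y, v * (p.1 - y)) *
        splitAt g (v * p.1) (v * y) (ranked fun n => v * p.2 n) := by
    have h1 : Measurable fun q : (ℝ × (ℕ → ℝ)) × ℝ => ((q.1.1, q.2), q.1.2) :=
      ((measurable_fst.comp measurable_fst).prodMk measurable_snd).prodMk
        (measurable_snd.comp measurable_fst)
    exact (Measurable.lintegral_prod_right' (hG.comp h1)).const_mul _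
  have key := hγ.lintegral_one_piece hθ (F := fun c w => ENNReal.ofReal θ *
      ∫⁻ y, quadRate H (v * y, v * (c - y)) *
        splitAt g (v * c) (v * y) (ranked fun n => v * w n)) hF fun n p w => by
    have : (fun k => v * swapAdj n w k) = (fun k => v * w k) ∘ Equiv.swap n (n + 1) := rfl
    rw [this, ranked_comp_equiv]
  have hL : ∫⁻ w, splitSum (quadRate (fragRate fun x y => θ * H x y))
        (fun z' => g (z', ranked fun n => v * w n)) (ranked fun n => v * w n) ∂γ =
      ENNReal.ofReal (v ^ 2) * ∫⁻ w, ∑' i, ENNReal.ofReal (w i) * (ENNReal.ofReal θ *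
        ∫⁻ y, quadRate H (v * y, v * (w i - y)) *
          splitAt g (v * w i) (v * y) (ranked fun n => v * w n)) ∂γ := by
    rw [← lintegral_const_mul' _ _ ENNReal.ofReal_ne_top]
    refine lintegral_congr_ae ?_
    filter_upwards [hγ.ae_hasSum hθ] with w hw
    set z := ranked fun n => v * w n with hz
    have hzw : pointMeasure z.1 = pointMeasure fun n => v * w n :=
      pointMeasure_ranked (rankable_mul hv hw.1 hw.2)
    set q := quadRate (fragRate fun x y => θ * H x y) with hqd
    have e1 : splitSum q (fun z' => g (z', z)) z =
        ∑' i, (fun x => ∫⁻ y, q (y, x - y) * splitAt g x y z) (z.1 i) := by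
      refine tsum_congr fun i => lintegral_congr fun y => ?_
      by_cases hp : 0 < y ∧ 0 < z.1 i - y
      · rw [splitAt_eq g hp.1 (sub_pos.1 hp.2)]
      · rw [hqd, quadRate_of_not_pos _ hp, zero_mul, zero_mul]
    rw [e1, tsum_eq_of_pointMeasure hzw
      (f := fun x => ∫⁻ y, q (y, x - y) * splitAt g x y z) fun x hx => ?_, ← ENNReal.tsum_mul_left]
    · refine tsum_congr fun i => ?_
      -- One factor v comes from this substitution, the other from the factor x + y of the splitting
      -- rate.
      rw [lintegral_eq_mul_lintegral_comp_mul hv]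
      have e2 : ∀ y, q (v * y, v * w i - v * y) * splitAt g (v * w i) (v * y) z =
          ENNReal.ofReal (v * w i * θ) *
            (quadRate H (v * y, v * (w i - y)) * splitAt g (v * w i) (v * y) z) := fun y => by
        rw [← mul_sub]
        by_cases hp : 0 < y ∧ 0 < w i - y
        · rw [hqd, quadRate_fragRate_mul hθ hv hp.1 hp.2, add_sub_cancel,
            ENNReal.ofReal_mul (mul_pos hv (hw.1 i)).le, ENNReal.ofReal_mul hv.le]
          ring
        · have hp' : ¬ (0 < v * y ∧ 0 < v * (w i - y)) := fun h =>
            hp ⟨(mul_pos_iff_of_pos_left hv).1 h.1, (mul_pos_iff_of_pos_left hv).1 h.2⟩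
          rw [hqd, quadRate_of_not_pos _ hp', quadRate_of_not_pos _ hp']
          simp
      simp_rw [e2]
      rw [lintegral_const_mul' _ _ ENNReal.ofReal_ne_top,
        ENNReal.ofReal_mul (mul_pos hv (hw.1 i)).le, ENNReal.ofReal_mul hv.le,
        ENNReal.ofReal_pow hv.le]
      ring
    · refine lintegral_eq_zero_of_ae_eq_zero (Filter.Eventually.of_forall fun y => ?_)
      have : q (y, x - y) = 0 := quadRate_of_not_pos _ fun h => by linarith [h.1, h.2]
      simp [this]
  rw [hL, key]
  congr 1
  set ψ : ℝ × ℝ → ℝ≥0∞ := fun p => twoDensity θ p * ∫⁻ w, quadRate H (v * p.1, v * p.2) *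
    splitAt g (v * (p.1 + p.2)) (v * p.1) (ranked fun n => v * breakOff (p.1 + p.2) w n) ∂γ
    with hψ
  have hψm : Measurable ψ := by
    refine (measurable_twoDensity θ).mul ?_
    have h1 : Measurable fun q : (ℝ × ℝ) × (ℕ → ℝ) =>
        ((q.1.1 + q.1.2, q.1.1), breakOff (q.1.1 + q.1.2) q.2) := by
      have ha : Measurable fun q : (ℝ × ℝ) × (ℕ → ℝ) => q.1.1 + q.1.2 := by fun_prop
      exact (ha.prodMk (measurable_fst.comp measurable_fst)).prodMk
        (measurable_breakOff ha measurable_snd)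
    have h2 := Measurable.lintegral_prod_right' (ν := γ) (hG.comp h1)
    simpa only [Function.comp_def, add_sub_cancel_left] using h2
  have hb : ∀ c, Measurable fun p : (ℕ → ℝ) × ℝ => quadRate H (v * p.2, v * (c - p.2)) *
      splitAt g (v * c) (v * p.2) (ranked fun n => v * breakOff c p.1 n) := fun c => by
    have h1 : Measurable fun p : (ℕ → ℝ) × ℝ => ((c, p.2), breakOff c p.1) :=
      (measurable_const.prodMk measurable_snd).prodMk
        (measurable_breakOff measurable_const measurable_fst)
    exact hG.comp h1
  have hout : Measurable fun c => ∫⁻ w, (ENNReal.ofReal θ *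
      ∫⁻ y, quadRate H (v * y, v * (c - y)) *
        splitAt g (v * c) (v * y) (ranked fun n => v * breakOff c w n)) ∂γ := by
    have h1 : Measurable fun q : ℝ × (ℕ → ℝ) => (q.1, breakOff q.1 q.2) :=
      measurable_fst.prodMk (measurable_breakOff measurable_fst measurable_snd)
    exact Measurable.lintegral_prod_right' (ν := γ) (hF.comp h1)
  rw [lintegral_betaMeasure_one hθ hout, ← lintegral_lintegral_sub hψm,
    ← lintegral_indicator measurableSet_Ioo]
  refine lintegral_congr fun c => ?_
  by_cases hc : c ∈ Set.Ioo (0 : ℝ) 1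
  · rw [Set.indicator_of_mem hc, lintegral_const_mul' _ _ ENNReal.ofReal_ne_top,
      lintegral_lintegral_swap (f := fun w y => quadRate H (v * y, v * (c - y)) *
        splitAt g (v * c) (v * y) (ranked fun n => v * breakOff c w n)) (hb c).aemeasurable,
      ← mul_assoc, ← lintegral_const_mul' _ _
        (ENNReal.mul_ne_top ENNReal.ofReal_ne_top ENNReal.ofReal_ne_top)]
    refine lintegral_congr fun y => ?_
    simp only [hψ, add_sub_cancel]
    by_cases hy : 0 < y ∧ 0 < c - y
    · rw [twoDensity, Set.indicator_of_mem (show (y, c - y) ∈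
        {p : ℝ × ℝ | 0 < p.1 ∧ 0 < p.2 ∧ p.1 + p.2 < 1} from
          ⟨hy.1, hy.2, by rw [add_sub_cancel]; exact hc.2⟩)]
      congr 1
      -- The Beta density at c, times the θ of the splitting rate, is the two-piece density at (y, c
      -- - y).
      rw [← ENNReal.ofReal_mul (mul_nonneg hθ.le (Real.rpow_nonneg (sub_pos.2 hc.2).le _))]
      congr 1
      rw [show 1 - (y, c - y).1 - (y, c - y).2 = 1 - c by ring]
      ring
    · have hp' : ¬ (0 < v * y ∧ 0 < v * (c - y)) := fun h =>
        hy ⟨(mul_pos_iff_of_pos_left hv).1 h.1, (mul_pos_iff_of_pos_left hv).1 h.2⟩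
      simp only [quadRate_of_not_pos _ hp', zero_mul, lintegral_zero, mul_zero]
  · rw [Set.indicator_of_notMem hc]
    refine (lintegral_eq_zero_of_ae_eq_zero (Filter.Eventually.of_forall fun y => ?_)).symm
    have : twoDensity θ (y, c - y) = 0 := Set.indicator_of_notMem (fun h => hc ⟨by
      linarith [show 0 < y from h.1, show 0 < c - y from h.2.1], by
      linarith [show y + (c - y) < 1 from h.2.2]⟩) _
    simp [hψ, this]

/-- Detailed balance for the dilations of the ranked stick-breaking sequence. -/
theorem IsGEM.lintegral_mergeSum_eq (hθ : 0 < θ) (hγ : IsGEM θ γ)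
    (hH : IsHomogeneousKernel lam H) {v : ℝ} (hv : 0 < v) {g : Omega × Omega → ℝ≥0∞}
    (hg : Measurable g) :
    ∫⁻ w, mergeSum (quadRate (coagRate H)) (fun z' => g (ranked fun n => v * w n, z'))
        (ranked fun n => v * w n) ∂γ =
      ∫⁻ w, splitSum (quadRate (fragRate fun x y => θ * H x y))
        (fun z' => g (z', ranked fun n => v * w n)) (ranked fun n => v * w n) ∂γ := by
  rw [hγ.lintegral_mergeSum hθ hH hv hg, hγ.lintegral_splitSum hθ hH hv hg]
  congr 1
  refine lintegral_congr fun p => ?_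
  by_cases hp : 0 < p.1 ∧ 0 < p.2 ∧ p.1 + p.2 < 1
  · congr 1
    refine lintegral_congr_ae ?_
    filter_upwards [hγ.ae_hasSum hθ] with w hw
    -- With the two pieces and the filling of the rest fixed, both integrands are the same value of
    -- g.
    obtain ⟨i, j, hij, hi, hj, hm⟩ := exists_ranked_twoSticks hv hp.1 hp.2.1 hp.2.2 hw.1 hw.2
    have hi0 := hi.symm ▸ mul_pos hv hp.1
    have hj0 := hj.symm ▸ mul_pos hv hp.2.1
    rw [hm, mul_add, ← hi, ← hj, mergeAt_eq g hij hi0 hj0, splitAt_merge g hij hi0 hj0]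
  · have : twoDensity θ p = 0 := Set.indicator_of_notMem
      (s := {p : ℝ × ℝ | 0 < p.1 ∧ 0 < p.2 ∧ p.1 + p.2 < 1}) (fun h => hp h) _
    rw [this, zero_mul, zero_mul]

end

end CoagFrag

/-! ## Lifted Poisson–Dirichlet laws -/

namespace CoagFrag

theorem ranked_omega (z : Omega) : ranked z.1 = z :=
  omega_ext (pointMeasure_ranked z.2.2)

theorem pointMeasure_mul {w w' : ℕ → ℝ} (h : pointMeasure w = pointMeasure w') {v : ℝ}
    (hv : 0 < v) : (pointMeasure fun n => v * w n) = pointMeasure fun n => v * w' n := by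
  ext B hB
  rw [pointMeasure_apply _ hB, pointMeasure_apply _ hB]
  refine tsum_eq_of_pointMeasure h (f := fun x => (Set.Ioi 0).indicator (B.indicator 1) (v * x))
    fun x hx => Set.indicator_of_notMem ?_ _
  exact not_lt.2 (mul_nonpos_of_nonneg_of_nonpos hv.le hx)

theorem rankable_iff_of_hasSum {w : ℕ → ℝ} :
    ((∀ n, 0 ≤ w n) ∧ HasSum w 1) ↔ Rankable w ∧ mass (ranked w) = 1 := by
  constructor
  · rintro ⟨h0, hs⟩
    have hr : Rankable w := ⟨h0, hs.summable, by rw [hs.tsum_eq]; exact one_pos⟩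
    exact ⟨hr, by rw [ranked_of hr, mass_rank, hs.tsum_eq]⟩
  · rintro ⟨hr, hm⟩
    rw [ranked_of hr, mass_rank] at hm
    exact ⟨hr.1, hm ▸ hr.2.1.hasSum⟩

theorem measurable_rankedStick : Measurable rankedStick := by
  classical
  have hgood : MeasurableSet {b : ℕ → ℝ | (∀ n, 0 ≤ stick b n) ∧ HasSum (stick b) 1} := by
    have : {b : ℕ → ℝ | (∀ n, 0 ≤ stick b n) ∧ HasSum (stick b) 1} =
        stick ⁻¹' ({w | Rankable w} ∩ {w | mass (ranked w) = 1}) := by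
      ext b
      exact rankable_iff_of_hasSum
    rw [this]
    exact measurable_stick (measurableSet_rankable.inter
      (measurableSet_eq_fun (measurable_mass.comp measurable_ranked) measurable_const))
  have : ∀ b, (rankedStick b).1 = if (∀ n, 0 ≤ stick b n) ∧ HasSum (stick b) 1 then
      ranked (stick b) else unitPoint.1 := fun b => by
    rw [rankedStick]
    split_ifs with h
    · rw [ranked_of (rankable_iff_of_hasSum.1 h).1]
    · rfl
  refine Measurable.subtype_mk (f := fun b => (rankedStick b).1) ?_
  simp_rw [this]
  exact Measurable.ite hgood (measurable_ranked.comp measurable_stick) measurable_const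

variable {θ lam : ℝ} {H : ℝ → ℝ → ℝ}

/-- Ranking commutes with dilation, as point measures show, so the ranked sequence may be replaced
by the stick-breaking order. The default value of `rankedStick` occurs with probability 0. -/
theorem lintegral_poissonDirichlet (hθ : 0 < θ) {v : ℝ} (hv : 0 < v) {φ : Omega → ℝ≥0∞}
    (hφ : Measurable φ) :
    ∫⁻ x, φ (ranked fun n => v * x.1.1 n) ∂poissonDirichlet θ =
      ∫⁻ w, φ (ranked fun n => v * w n)
        ∂(Measure.infinitePi fun _ : ℕ => betaMeasure 1 θ).map stick := by
  have hR : Measurable fun w : ℕ → ℝ => φ (ranked fun n => v * w n) :=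
    hφ.comp (measurable_ranked.comp (measurable_mul_seq measurable_const measurable_id))
  have hR' : Measurable fun x : OmegaOne => φ (ranked fun n => v * x.1.1 n) :=
    hR.comp (measurable_subtype_coe.comp measurable_subtype_coe)
  rw [poissonDirichlet, lintegral_map hR' measurable_rankedStick, lintegral_map hR measurable_stick]
  refine lintegral_congr_ae ?_
  filter_upwards [ae_of_ae_map measurable_stick.aemeasurable ((isGEM_stick hθ).ae_hasSum hθ)]
    with b hb
  have hb' : (∀ n, 0 ≤ stick b n) ∧ HasSum (stick b) 1 := ⟨fun n => (hb.1 n).le, hb.2⟩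
  have h1 : pointMeasure (rankedStick b).1.1 = pointMeasure (stick b) := by
    rw [rankedStick, dif_pos hb']
    exact pointMeasure_decr hb'.1 hb.2.summable
  have h2 : Rankable fun n => v * (rankedStick b).1.1 n := (dilate v hv (rankedStick b).1).2.2
  congr 1
  apply omega_ext
  rw [pointMeasure_ranked h2, pointMeasure_ranked (rankable_mul hv hb.1 hb.2),
    pointMeasure_mul h1 hv]

theorem IsHomogeneousKernel.const_mul (hH : IsHomogeneousKernel lam H) (hθ : 0 ≤ θ) :
    IsHomogeneousKernel lam fun x y => θ * H x y where
  measurable := by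
    have : (Set.Ioi (0 : ℝ) ×ˢ Set.Ioi (0 : ℝ)).indicator (fun p => θ * H p.1 p.2) = fun p =>
        θ * (Set.Ioi (0 : ℝ) ×ˢ Set.Ioi (0 : ℝ)).indicator (fun p => H p.1 p.2) p := by
      funext p
      by_cases hp : p ∈ Set.Ioi (0 : ℝ) ×ˢ Set.Ioi (0 : ℝ)
      · simp only [Set.indicator_of_mem hp]
      · simp only [Set.indicator_of_notMem hp, mul_zero]
    rw [this]
    exact hH.measurable.const_mul θ
  nonneg x y hx hy := mul_nonneg hθ (hH.nonneg x y hx hy)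
  symm x y hx hy := by rw [hH.symm x y hx hy]
  homogeneous a x y ha hx hy := by
    rw [hH.homogeneous a x y ha hx hy]
    ring

theorem setIntegral_Ioo_eq_mul {c : ℝ} (hc : 0 < c) (f : ℝ → ℝ) :
    ∫ y in Set.Ioo 0 c, f y = c * ∫ u in Set.Ioo (0 : ℝ) 1, f (u * c) := by
  have h := intervalIntegral.integral_comp_mul_right (a := 0) (b := 1) f hc.ne'
  rw [zero_mul, one_mul, intervalIntegral.integral_of_le zero_le_one,
    intervalIntegral.integral_of_le hc.le, integral_Ioc_eq_integral_Ioo,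
    integral_Ioc_eq_integral_Ioo, smul_eq_mul] at h
  rw [h, mul_inv_cancel_left₀ hc.ne']

/-- The substitution y = u zᵢ gives one factor zᵢ and the splitting rate the other; θ is absorbed in
the splitting kernel. -/
theorem genHθ_eq_genL (H : ℝ → ℝ → ℝ) (θ : ℝ) :
    genHθ H θ = genL (coagRate H) (fragRate fun x y => θ * H x y) := by
  funext Φ z
  rw [genHθ, genL, div_eq_mul_one_div θ 2, mul_comm θ, mul_assoc]
  refine congrArg₂ (· + ·) rfl (congrArg _ ?_)
  rw [← tsum_mul_left]
  refine tsum_congr fun i => ?_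
  split_ifs with hi
  · rw [setIntegral_Ioo_eq_mul hi, ← mul_assoc, ← integral_const_mul, ← integral_const_mul]
    congr 1
    funext u
    rw [fragRate, show z.1 i - u * z.1 i = (1 - u) * z.1 i by ring]
    ring
  · rw [mul_zero]

variable {S : Type v} [MeasurableSpace S] {P : Measure S} {X : S → OmegaOne} {V : S → ℝ}

theorem measurable_dilate (hV : ∀ ω, 0 < V ω) (hX : Measurable X) (hVm : Measurable V) :
    Measurable fun ω => dilate (V ω) (hV ω) (X ω).1 :=
  measurable_to_omega fun i =>
    hVm.mul ((measurable_entry i).comp (measurable_subtype_coe.comp hX))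

/-- Independence gives a product law for (V, X). `ranked` stands in for `dilate` because it is
defined for every real factor, so the integrand needs no proof of positivity. -/
theorem lintegral_dilate [IsProbabilityMeasure P] (hθ : 0 < θ) (hV : ∀ ω, 0 < V ω)
    (hX : Measurable X) (hVm : Measurable V) (hPD : P.map X = poissonDirichlet θ)
    (hind : IndepFun V X P) {φ : Omega → ℝ≥0∞} (hφ : Measurable φ) :
    ∫⁻ ω, φ (dilate (V ω) (hV ω) (X ω).1) ∂P =
      ∫⁻ v, ∫⁻ w, φ (ranked fun n => v * w n)
        ∂(Measure.infinitePi fun _ : ℕ => betaMeasure 1 θ).map stick ∂P.map V := by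
  have := Measure.isProbabilityMeasure_map (μ := P) hX.aemeasurable
  have hm : Measurable fun p : ℝ × OmegaOne => φ (ranked fun n => p.1 * p.2.1.1 n) :=
    hφ.comp (measurable_ranked.comp (measurable_mul_seq measurable_fst
      (measurable_subtype_coe.comp (measurable_subtype_coe.comp measurable_snd))))
  have h1 : ∀ ω, φ (dilate (V ω) (hV ω) (X ω).1) = φ (ranked fun n => V ω * (X ω).1.1 n) :=
    fun ω => congrArg φ (ranked_omega (dilate (V ω) (hV ω) (X ω).1)).symm
  simp_rw [h1]
  rw [← lintegral_map (μ := P) (g := fun ω => (V ω, X ω)) hm (hVm.prodMk hX),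
    (indepFun_iff_map_prod_eq_prod_map_map hVm.aemeasurable hX.aemeasurable).1 hind,
    lintegral_prod _ hm.aemeasurable]
  refine lintegral_congr_ae ?_
  have hpos : ∀ᵐ v ∂P.map V, 0 < v :=
    (ae_map_iff hVm.aemeasurable measurableSet_Ioi).2 (Filter.Eventually.of_forall hV)
  filter_upwards [hpos] with v hv
  rw [hPD]
  exact lintegral_poissonDirichlet hθ hv hφ

/-- Lifted Poisson–Dirichlet laws satisfy detailed balance. -/
theorem detailedBalance_dilate [IsProbabilityMeasure P] (hθ : 0 < θ)
    (hH : IsHomogeneousKernel lam H) (hV : ∀ ω, 0 < V ω)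
    (hX : Measurable X) (hVm : Measurable V) (hPD : P.map X = poissonDirichlet θ)
    (hind : IndepFun V X P) :
    DetailedBalance (quadRate (coagRate H)) (quadRate (fragRate fun x y => θ * H x y))
      (P.map fun ω => dilate (V ω) (hV ω) (X ω).1) := by
  intro g hg
  have h1 := measurable_mergeSum (measurable_quadRate_coagRate hH) hg
  have h2 := measurable_splitSum (measurable_quadRate_fragRate (hH.const_mul hθ.le)) hg
  have hD := measurable_dilate hV hX hVm
  rw [lintegral_map h1 hD, lintegral_map h2 hD, lintegral_dilate hθ hV hX hVm hPD hind h1,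
    lintegral_dilate hθ hV hX hVm hPD hind h2]
  refine lintegral_congr_ae ?_
  have hpos : ∀ᵐ v ∂P.map V, 0 < v :=
    (ae_map_iff hVm.aemeasurable measurableSet_Ioi).2 (Filter.Eventually.of_forall hV)
  filter_upwards [hpos] with v hv
  exact (isGEM_stick hθ).lintegral_mergeSum_eq hθ hH hv hg

theorem isReversible_genHθ [IsProbabilityMeasure P] (hlam : 0 ≤ lam) (hθ : 0 < θ)
    (hH : IsHomogeneousKernel lam H) (hH1 : CondH1 H) (hV : ∀ ω, 0 < V ω)
    (hX : Measurable X) (hVm : Measurable V) (hPD : P.map X = poissonDirichlet θ)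
    (hind : IndepFun V X P) :
    IsReversible.{u} (genHθ H θ) (P.map fun ω => dilate (V ω) (hV ω) (X ω).1) := by
  rw [genHθ_eq_genL]
  exact isReversible_homogeneous hlam hH hH1 (hH.const_mul hθ.le) (hH1.lintegral_ne_top hθ.le)
    (detailedBalance_dilate hθ hH hV hX hVm hPD hind)

end CoagFrag

theorem theorem2p4 :
    -- (i) detailed balance implies reversibility
    (∀ (lam : ℝ) (Hhat Hcheck : ℝ → ℝ → ℝ), 0 ≤ lam →
      IsHomogeneousKernel lam Hhat → CondH1 Hhat →
      IsHomogeneousKernel lam Hcheck → CondH2 Hcheck →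
      ∀ (S : Type v) [MeasurableSpace S] (P : Measure S) [IsProbabilityMeasure P]
        (Z : S → Omega), Measurable Z →
      ∀ (r₁ : ℝ → ℝ≥0∞) (r₂ : ℝ × ℝ → ℝ≥0∞)
        (P₁ : Kernel ℝ Config) [IsMarkovKernel P₁]
        (P₂ : Kernel (ℝ × ℝ) Config) [IsMarkovKernel P₂],
        IsCorrelationFunction₁ P Z r₁ → IsCorrelationFunction₂ P Z r₂ →
        IsPalm₁ P Z r₁ P₁ → IsPalm₂ P Z r₂ P₂ →
        (∀ᵐ z : ℝ × ℝ ∂(volume.restrict (Set.Ioi 0 ×ˢ Set.Ioi 0)),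
          (ENNReal.ofReal (coagRate Hhat z.1 z.2) * r₂ z) • P₂ z =
            (ENNReal.ofReal (fragRate Hcheck z.1 z.2) * r₁ (z.1 + z.2)) • P₁ (z.1 + z.2)) →
        IsReversible.{u} (genL (coagRate Hhat) (fragRate Hcheck)) (P.map Z)) ∧
    -- (ii) lifted Poisson-Dirichlet laws are reversible distributions
    (∀ (lam θ : ℝ) (H : ℝ → ℝ → ℝ), 0 ≤ lam → 0 < θ →
      IsHomogeneousKernel lam H → CondH1 H →
      ∀ (S : Type v) [MeasurableSpace S] (P : Measure S) [IsProbabilityMeasure P]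
        (X : S → OmegaOne) (V : S → ℝ) (hV : ∀ ω, 0 < V ω), Measurable X → Measurable V →
        P.map X = poissonDirichlet θ → IndepFun V X P →
        IsReversible.{u} (genHθ H θ) (P.map (fun ω => dilate (V ω) (hV ω) (X ω).1))) := by
  refine ⟨?_, ?_⟩
  · intro lam Hhat Hcheck hlam h1 h1' h2 h2' S _ P _ Z hZ r₁ r₂ P₁ _ P₂ _ hr₁ hr₂ hp₁ hp₂ hbal
    exact isReversible_of_palm hlam h1 h1' h2 h2' hZ hr₁.1 hr₂.1 hp₁ hp₂ hbal
  · intro lam θ H hlam hθ hH hH1 S _ P _ X V hV hX hVm hPD hind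
    exact isReversible_genHθ hlam hθ hH hH1 hV hX hVm hPD hind
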